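/- Let $Q\subset\mathbb{R}^2$ be a closed square and let $\varphi=(\varphi_1,\varphi_2):Q\to\mathbb{R}^2$ be Hölder continuous of regularity $\alpha$, i.e. $|\varphi(y)-\varphi(y')|\le C|y-y'|^{\alpha}$ on $Q$ for some constant $C$. For $n\ge 0$ let $\mathcal{P}_n(Q)$ be the partition of $Q$ into $4^n$ congruent squares with sides parallel to those of $Q$. For each $R\in\bigcup_n\mathcal{P}_n(Q)$ choose an arbitrary point $p_R\in R$ and put $$X_R:=\varphi(p_R)\in\mathbb{R}^2,\qquad \mathbb{X}^1_R:=\int_{\partial R}\varphi_1\,d\varphi_2\in\mathbb{R},$$ $$\mathbb{X}^2_R:=\tfrac12\left(\int_{\partial R}(\varphi_1-\varphi_1(p_R))^2\,d\varphi_2,\ \int_{\partial R}\varphi_1\,d\bigl((\varphi_2-\varphi_2(p_R))^2\bigr)\right)\in\mathbb{R}^2,$$ where the integrals are Riemann–Stieltjes (Young) integrals running counterclockwise around $\partial R$. Let $\deg(\varphi,Q,x)\in\mathbb{Z}$ be the mapping degree of $\varphi$ on the interior of $Q$ at $x\in\mathbb{R}^2\setminus\varphi(\partial Q)$. If $\alpha>\frac12$,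 then all these Riemann–Stieltjes integrals exist, $\varphi(\partial Q)$ is a Lebesgue null set, and $\deg(\varphi,Q,x)$ is thus defined for almost every $x\in\mathbb{R}^2$. Moreover: 1. If $\alpha>\frac23$ and $f:\mathbb{R}^2\to\mathbb{R}$ is Lipschitz, then $x\mapsto f(x)\deg(\varphi,Q,x)$ is integrable and $$\int_{\mathbb{R}^2}f(x)\deg(\varphi,Q,x)\,dx=\lim_{n\to\infty}\sum_{R\in\mathcal{P}_n(Q)}f(X_R)\,\mathbb{X}^1_R .$$ 2. If $\alpha>\frac12$ and $f\in C^{1,1}(\mathbb{R}^2,\mathbb{R})$, i.e. $f$ is $C^1$ with Lipschitz continuous derivative $Df$, then $x\mapsto f(x)\deg(\varphi,Q,x)$ is integrable and $$\int_{\mathbb{R}^2}f(x)\deg(\varphi,Q,x)\,dx=\lim_{n\to\infty}\sum_{R\in\mathcal{P}_n(Q)}\bigl[f(X_R)\,\mathbb{X}^1_R+Df(X_R)\,\mathbb{X}^2_R\bigr].$$ -/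

import Mathlib

open MeasureTheory Filter Topology Set
open scoped NNReal ContDiff

noncomputable section

namespace RoughSurface

/-- The Euclidean plane. -/
abbrev Plane := EuclideanSpace ℝ (Fin 2)

/-! ### Riemann-Stieltjes integrals -/

/-- `I` is the Riemann-Stieltjes integral of `f` against `g` over `[a, b]`: the limit of the sums
`∑ f(sᵢ) (g(tᵢ₊₁) - g(tᵢ))` over partitions `a = t₀ ≤ ⋯ ≤ tₘ = b` with tags `sᵢ ∈ [tᵢ, tᵢ₊₁]`,
as the mesh tends to zero. -/
def HasRSIntegral (f g : ℝ → ℝ) (a b I : ℝ) : Prop :=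
  ∀ ε > 0, ∃ δ > 0, ∀ (m : ℕ) (t s : ℕ → ℝ), t 0 = a → t m = b →
    (∀ i < m, t i ≤ s i ∧ s i ≤ t (i + 1) ∧ t (i + 1) - t i < δ) →
    |(∑ i ∈ Finset.range m, f (s i) * (g (t (i + 1)) - g (t i))) - I| < ε

/-- The Riemann-Stieltjes integral of `f` against `g` over `[a, b]` exists. -/
def RSIntegrable (f g : ℝ → ℝ) (a b : ℝ) : Prop := ∃ I, HasRSIntegral f g a b I

open Classical in
/-- The Riemann-Stieltjes integral of `f` against `g` over `[a, b]`, or `0` if it does not exist. -/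
def rsIntegral (f g : ℝ → ℝ) (a b : ℝ) : ℝ :=
  if h : RSIntegrable f g a b then h.choose else 0

/-! ### Squares and their boundaries -/

/-- Rotation of the plane by a quarter turn counterclockwise. -/
def rot (v : Plane) : Plane := !₂[-v 1, v 0]

/-- A (closed, nondegenerate, possibly rotated) square in the plane, given by one of its corners
and the edge vector `e` that leaves it counterclockwise along the boundary; the other edge vector
at this corner is `rot e`. -/
structure Square where
  corner : Plane
  edge : Plane
  edge_ne_zero : edge ≠ 0

namespace Square

/-- The standard parametrization of a square by `(u, v) ∈ [0, 1]²`. -/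
def param (R : Square) (u v : ℝ) : Plane := R.corner + u • R.edge + v • rot R.edge

/-- The square as a closed subset of the plane. -/
def toSet (R : Square) : Set Plane :=
  {y | ∃ u ∈ Icc (0 : ℝ) 1, ∃ v ∈ Icc (0 : ℝ) 1, y = R.param u v}

/-- The four corners, in counterclockwise order. -/
def vertex (R : Square) : Fin 4 → Plane :=
  ![R.param 0 0, R.param 1 0, R.param 1 1, R.param 0 1]

/-- The affine parametrization over `[0, 1]` of the `k`-th edge, running counterclockwise around
the boundary (`k + 1` is taken modulo `4`). -/
def side (R : Square) (k : Fin 4) (t : ℝ) : Plane :=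
  AffineMap.lineMap (R.vertex k) (R.vertex (k + 1)) t

/-- The Riemann-Stieltjes integral `∫_{∂R} g₁ dg₂` exists. -/
def BoundaryIntegrable (R : Square) (g₁ g₂ : Plane → ℝ) : Prop :=
  ∀ k : Fin 4, RSIntegrable (fun t => g₁ (R.side k t)) (fun t => g₂ (R.side k t)) 0 1

/-- The Riemann-Stieltjes integral `∫_{∂R} g₁ dg₂`, counterclockwise around the boundary. -/
def boundaryIntegral (R : Square) (g₁ g₂ : Plane → ℝ) : ℝ :=
  ∑ k : Fin 4, rsIntegral (fun t => g₁ (R.side k t)) (fun t => g₂ (R.side k t)) 0 1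

/-- The square in position `(i, j)`, `0 ≤ i, j < 2 ^ n`, of the partition `𝒫ₙ(Q)` of `Q` into
`4 ^ n` squares of side length `2⁻ⁿ` times that of `Q`. -/
def sub (Q : Square) (n i j : ℕ) : Square where
  corner := Q.param (i / 2 ^ n) (j / 2 ^ n)
  edge := ((2 : ℝ) ^ n)⁻¹ • Q.edge
  edge_ne_zero := smul_ne_zero (inv_ne_zero (pow_ne_zero n two_ne_zero)) Q.edge_ne_zero

/-- The sum of `F R` over all squares `R` of the partition `𝒫ₙ(Q)`. -/
def dyadicSum (Q : Square) (n : ℕ) (F : Square → ℝ) : ℝ :=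
  ∑ i ∈ Finset.range (2 ^ n), ∑ j ∈ Finset.range (2 ^ n), F (Q.sub n i j)

end Square

/-! ### The mapping degree -/

/-- `d` is the (Brouwer) mapping degree at `x` of the continuous map `φ : K → ℝ²` on the interior
of the compact set `K`, in the analytic definition of Heinz: for `x ∉ φ(∂K)` take a smooth `g` with
`|g - φ| < dist(x, φ(∂K))` on `K` and a continuous weight `z ↦ ψ(|z|)` of total mass one with `ψ`
supported in a compact subinterval of `(0, dist(x, g(∂K)))`; the degree is the integral of
`ψ(|g - x|) det Dg` over `K`, whatever `g` and `ψ`. (If `x ∈ φ(∂K)`, then `dist(x, φ(∂K)) = 0`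
and there is no such `g`.) -/
def IsMappingDegree (φ : Plane → Plane) (K : Set Plane) (x : Plane) (d : ℤ) : Prop :=
  ∃ (g : Plane → Plane) (ψ : ℝ → ℝ) (a b : ℝ),
    ContDiff ℝ ∞ g ∧
    (∀ y ∈ K, dist (g y) (φ y) < Metric.infDist x (φ '' frontier K)) ∧
    Continuous ψ ∧ 0 < a ∧ b < Metric.infDist x (g '' frontier K) ∧
    (∀ r, r ∉ Icc a b → ψ r = 0) ∧
    (∫ z : Plane, ψ ‖z‖) = 1 ∧
    (∫ y in interior K, ψ ‖g y - x‖ * (fderiv ℝ g y).det) = (d : ℝ)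

open Classical in
/-- The mapping degree `deg(φ, K, x)`, with the value `0` where it is not defined, in particular
on `φ(∂K)`. -/
def mappingDegree (φ : Plane → Plane) (K : Set Plane) (x : Plane) : ℤ :=
  if h : ∃ d, IsMappingDegree φ K x d then h.choose else 0

/-! ### First and second order terms -/

/-- `𝕏¹_R = ∫_{∂R} φ₁ dφ₂`. -/
def X1 (φ : Plane → Plane) (R : Square) : ℝ :=
  R.boundaryIntegral (fun y => φ y 0) (fun y => φ y 1)

/-- `𝕏²_R = ½ (∫_{∂R} (φ₁ - φ₁(p_R))² dφ₂, ∫_{∂R} φ₁ d(φ₂ - φ₂(p_R))²)`. -/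
def X2 (φ : Plane → Plane) (p : Square → Plane) (R : Square) : Plane :=
  (1 / 2 : ℝ) •
    !₂[R.boundaryIntegral (fun y => (φ y 0 - φ (p R) 0) ^ 2) (fun y => φ y 1),
      R.boundaryIntegral (fun y => φ y 0) (fun y => (φ y 1 - φ (p R) 1) ^ 2)]

/-- The integrals in `𝕏¹_R` and `𝕏²_R` exist as Riemann-Stieltjes integrals. -/
def TermsExist (φ : Plane → Plane) (p : Square → Plane) (R : Square) : Prop :=
  R.BoundaryIntegrable (fun y => φ y 0) (fun y => φ y 1) ∧
  R.BoundaryIntegrable (fun y => (φ y 0 - φ (p R) 0) ^ 2) (fun y => φ y 1) ∧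
  R.BoundaryIntegrable (fun y => φ y 0) (fun y => (φ y 1 - φ (p R) 1) ^ 2)

end RoughSurface

end

open RoughSurface

/-! The degree is replaced by the winding number of the curve `φ ∘ ∂Q`, and the winding number is
built in L¹ from triangles. Inscribe polygons in the image of the boundary, with `2 ^ N` dyadic
pieces on each side. Passing from level `N` to `N + 1` attaches one triangle per edge, so the
winding number changes by a sum of triangle indices `±1, 0` (`angleAt_triangle`,
`Square.polySum_eq_fillSum`). With `q = 2 ^ (-α)` such a triangle lies in a disc of radius `A q ^
N`. The change therefore has L¹ norm `O((2 q ^ 2) ^ N)`, which is summable exactly because `α >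
1/2`. The resulting `Square.index` is integrable, and its L¹ norm is of order (side length)^(2α)
(`Square.Tame.integrable_index`, `Square.tame_sub`).

The same telescoping gives Stokes' theorem. Integrating a polynomial 1-form along segments yields an
edge functional whose sum around a triangle is the integral of the form's exterior derivative
against the triangle index. Its polygonal sums converge to an integral against `index`, and also to
a Young integral, since on each edge it differs from a Riemann–Stieltjes increment only
quadratically (`Square.Tame.tendsto_polySum`, `Square.Tame.tendsto_boundaryIntegral`). Hence the
zeroth and first moments of the winding number are `X1` and `X2`.

For almost every `x` the index is the degree (`Square.ae_index_eq`). Green's formula turns the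
integral defining the degree of a smooth map into an angular integral along the boundary
(`eventually_degree_integral_eq_polyIndex`), and winding numbers are stable under perturbations
smaller than the distance to `x` (`Square.eventually_polyIndex_eq`).

Finally, winding numbers are additive over the dyadic subsquares, because interior edges cancel
(`Square.ae_index_eq_dyadicSum`). On each of the `4 ^ n` subsquares replace `f` by its Taylor
polynomial at `φ (p R)`, with error `O(q ^ (n m))` on the disc that supports the index; the L¹ norm
there is `O(q ^ (2 n))`. The total error `O((4 q ^ (m + 2)) ^ n)` vanishes in the limit if `α (m +
2) > 2`. Constants give `m = 1`, whence `α > 2/3`; affine functions give `m = 2`, whence `α > 1/2`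
(`Square.tendsto_dyadicSum`). -/

noncomputable section

namespace RoughSurface

/-! ### Oriented angles and the index of a triangle -/

/-- The identification of the plane with the complex numbers. -/
def toComplex (x : Plane) : ℂ := ⟨x 0, x 1⟩

@[simp] lemma toComplex_re (x : Plane) : (toComplex x).re = x 0 := rfl

@[simp] lemma toComplex_im (x : Plane) : (toComplex x).im = x 1 := rfl

lemma toComplex_sub (x y : Plane) : toComplex (x - y) = toComplex x - toComplex y := by
  apply Complex.ext <;> simp

lemma toComplex_eq_zero {x : Plane} : toComplex x = 0 ↔ x = 0 := by
  constructor
  · intro h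
    ext i
    fin_cases i
    · simpa using congrArg Complex.re h
    · simpa using congrArg Complex.im h
  · rintro rfl
    apply Complex.ext <;> simp

lemma norm_toComplex (x : Plane) : ‖toComplex x‖ = ‖x‖ := by
  rw [EuclideanSpace.norm_eq, Complex.norm_def, Complex.normSq_apply]
  simp [Fin.sum_univ_two, sq]

/-- The oriented angle, in `(-π, π]`, under which the segment from `p` to `q` is seen from `x`. -/
def angleAt (x p q : Plane) : ℝ := (toComplex (q - x) / toComplex (p - x)).arg

/-- The determinant of two vectors. -/
def cross (a b : Plane) : ℝ := a 0 * b 1 - a 1 * b 0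

lemma div_toComplex_im (a b : Plane) :
    (toComplex b / toComplex a).im = cross a b / ‖a‖ ^ 2 := by
  rw [Complex.div_im, ← norm_toComplex a, ← Complex.normSq_eq_norm_sq]
  simp only [toComplex_re, toComplex_im, cross]
  ring

lemma angleAt_coe {x p q : Plane} (hp : p ≠ x) (hq : q ≠ x) :
    (angleAt x p q : Real.Angle) = (toComplex (q - x)).arg - (toComplex (p - x)).arg := by
  rw [angleAt, Complex.arg_div_coe_angle] <;> simpa [toComplex_eq_zero, sub_eq_zero]

lemma ne_of_notMem_segment {x p q : Plane} (h : x ∉ segment ℝ p q) : p ≠ x ∧ q ≠ x :=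
  ⟨fun e => h (e ▸ left_mem_segment ℝ p q), fun e => h (e ▸ right_mem_segment ℝ p q)⟩

/-- An angle `π` means `q - x = r (p - x)` with `r < 0`, so that `x` divides the segment at
parameter `1 / (1 - r)`. -/
lemma angleAt_ne_pi {x p q : Plane} (h : x ∉ segment ℝ p q) : angleAt x p q ≠ Real.pi := by
  intro e
  obtain ⟨hp, hq⟩ := ne_of_notMem_segment h
  rw [angleAt, Complex.arg_eq_pi_iff] at e
  obtain ⟨hre, him⟩ := e
  set z := toComplex (q - x) / toComplex (p - x) with hz
  have hp' : toComplex (p - x) ≠ 0 := by simpa [toComplex_eq_zero, sub_eq_zero] using hp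
  have hzz : z = ((z.re : ℝ) : ℂ) := by apply Complex.ext <;> simp [him]
  have hq' : toComplex (q - x) = ((z.re : ℝ) : ℂ) * toComplex (p - x) := by
    rw [← hzz, hz, div_mul_cancel₀ _ hp']
  set r := z.re
  have h0 := congrArg Complex.re hq'
  have h1 := congrArg Complex.im hq'
  simp at h0 h1
  apply h
  rw [segment_eq_image]
  have hr : (1 - r) ≠ 0 := by linarith
  refine ⟨1 / (1 - r), ⟨by apply div_nonneg <;> linarith, ?_⟩, ?_⟩
  · rw [div_le_one (by linarith)]; linarith
  · ext i
    fin_cases i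
    · simp; field_simp; linarith
    · simp; field_simp; linarith

lemma abs_angleAt_lt {x p q : Plane} (h : x ∉ segment ℝ p q) : |angleAt x p q| < Real.pi := by
  refine lt_of_le_of_ne (Complex.abs_arg_le_pi _) fun e => ?_
  rcases abs_eq Real.pi_pos.le |>.1 e with e | e
  · exact angleAt_ne_pi h e
  · exact (Complex.neg_pi_lt_arg _).ne' e

lemma angleAt_pos_iff {x p q : Plane} (h : x ∉ segment ℝ p q) :
    0 < angleAt x p q ↔ 0 < cross (p - x) (q - x) := by
  obtain ⟨hp, hq⟩ := ne_of_notMem_segment h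
  have hn : 0 < ‖p - x‖ ^ 2 := by have := norm_pos_iff.2 (sub_ne_zero.2 hp); positivity
  have him := div_toComplex_im (p - x) (q - x)
  have hc : 0 < cross (p - x) (q - x) ↔
      0 < (toComplex (q - x) / toComplex (p - x)).im := by
    rw [him]; exact (div_pos_iff_of_pos_right hn).symm
  rw [hc]
  constructor
  · intro h0
    rcases (Complex.arg_nonneg_iff.1 h0.le).lt_or_eq with h1 | h1
    · exact h1
    · exfalso
      by_cases hre : 0 ≤ (toComplex (q - x) / toComplex (p - x)).re
      · exact h0.ne' (Complex.arg_eq_zero_iff.2 ⟨hre, h1.symm⟩)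
      · exact angleAt_ne_pi h (Complex.arg_eq_pi_iff.2 ⟨not_le.1 hre, h1.symm⟩)
  · intro h0
    refine lt_of_le_of_ne (Complex.arg_nonneg_iff.2 h0.le) fun e => ?_
    exact h0.ne' (Complex.arg_eq_zero_iff.1 e.symm).2

lemma angleAt_neg_iff {x p q : Plane} :
    angleAt x p q < 0 ↔ cross (p - x) (q - x) < 0 ∧ p ≠ x := by
  rw [angleAt, Complex.arg_neg_iff, div_toComplex_im]
  by_cases hp : p = x
  · simp [hp]
  · have hn : 0 < ‖p - x‖ ^ 2 := by have := norm_pos_iff.2 (sub_ne_zero.2 hp); positivity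
    rw [div_neg_iff]
    simp [hn, hp, not_lt.2 hn.le]

lemma angleAt_swap {x p q : Plane} (h : x ∉ segment ℝ p q) :
    angleAt x q p = -angleAt x p q := by
  have e : toComplex (p - x) / toComplex (q - x) = (toComplex (q - x) / toComplex (p - x))⁻¹ := by
    rw [inv_div]
  rw [angleAt, e, Complex.arg_inv, if_neg (by exact angleAt_ne_pi h), angleAt]

/-- The winding number around `x` of the triangle with vertices `p`, `m`, `q`, for `x` not on its
boundary. -/
def triIndex (p m q x : Plane) : ℝ :=
  if 0 < cross (p - x) (m - x) ∧ 0 < cross (m - x) (q - x) ∧ 0 < cross (q - x) (p - x) then 1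
  else if cross (p - x) (m - x) < 0 ∧ cross (m - x) (q - x) < 0 ∧ cross (q - x) (p - x) < 0 then -1
  else 0

/-- The three angles add up to a multiple of `2π`, and each is smaller than `π` in absolute value,
so only `-2π`, `0` and `2π` are possible. The value `2π` needs all three to be positive, and the
value `-2π` all three negative; the signs are those of the cross products. This makes `triIndex` the
coboundary of the angle. -/
lemma angleAt_triangle {x p m q : Plane} (h₁ : x ∉ segment ℝ p m) (h₂ : x ∉ segment ℝ m q)
    (h₃ : x ∉ segment ℝ q p) :
    angleAt x p m + angleAt x m q + angleAt x q p = 2 * Real.pi * triIndex p m q x := by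
  obtain ⟨hp, hm⟩ := ne_of_notMem_segment h₁
  obtain ⟨hq, -⟩ := ne_of_notMem_segment h₃
  have hint : ((angleAt x p m + angleAt x m q + angleAt x q p : ℝ) : Real.Angle) = 0 := by
    rw [Real.Angle.coe_add, Real.Angle.coe_add, angleAt_coe hp hm, angleAt_coe hm hq, angleAt_coe hq hp]
    abel
  rw [Real.Angle.coe_eq_zero_iff] at hint
  obtain ⟨n, hn⟩ := hint
  rw [zsmul_eq_mul] at hn
  have a₁ := abs_lt.1 (abs_angleAt_lt h₁)
  have a₂ := abs_lt.1 (abs_angleAt_lt h₂)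
  have a₃ := abs_lt.1 (abs_angleAt_lt h₃)
  have b₁ := angleAt_pos_iff h₁
  have b₂ := angleAt_pos_iff h₂
  have b₃ := angleAt_pos_iff h₃
  have c₁ := (angleAt_neg_iff (x := x) (p := p) (q := m)).trans (and_iff_left hp)
  have c₂ := (angleAt_neg_iff (x := x) (p := m) (q := q)).trans (and_iff_left hm)
  have c₃ := (angleAt_neg_iff (x := x) (p := q) (q := p)).trans (and_iff_left hq)
  simp only [triIndex, ← b₁, ← b₂, ← b₃, ← c₁, ← c₂, ← c₃]
  have hpi := Real.pi_pos
  have key : ∀ k : ℤ, (k - 1) * (2 * Real.pi) < angleAt x p m + angleAt x m q + angleAt x q p →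
      angleAt x p m + angleAt x m q + angleAt x q p < (k + 1) * (2 * Real.pi) → n = k := by
    intro k h1 h2
    rw [← hn] at h1 h2
    have h1' : ((k - 1 : ℤ) : ℝ) < n := by
      push_cast; exact lt_of_mul_lt_mul_right h1 (by positivity)
    have h2' : (n : ℝ) < ((k + 1 : ℤ) : ℝ) := by
      push_cast; exact lt_of_mul_lt_mul_right h2 (by positivity)
    have := Int.cast_lt.1 h1'
    have := Int.cast_lt.1 h2'
    omega
  rw [← hn]
  split_ifs with hA hB
  · rw [key 1 (by push_cast; linarith) (by push_cast; linarith)]; push_cast; ring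
  · rw [key (-1) (by push_cast; linarith) (by push_cast; linarith)]; push_cast; ring
  · have hn0 : n = 0 := by
      apply key 0
      · push_cast
        by_contra hcon
        apply hB
        refine ⟨?_, ?_, ?_⟩ <;> linarith
      · push_cast
        by_contra hcon
        apply hA
        refine ⟨?_, ?_, ?_⟩ <;> linarith
    rw [hn0]; simp

lemma triIndex_abs_le (p m q x : Plane) : |triIndex p m q x| ≤ 1 := by
  unfold triIndex; split_ifs <;> simp

lemma cross_add_cross_add_cross (p m q x : Plane) :
    cross (p - x) (m - x) + cross (m - x) (q - x) + cross (q - x) (p - x) =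
      cross (m - p) (q - p) := by
  simp only [cross, PiLp.sub_apply]; ring

/-- A point around which a triangle winds lies in every convex set containing its vertices. -/
lemma triIndex_eq_zero {s : Set Plane} (hs : Convex ℝ s) {p m q x : Plane} (hp : p ∈ s)
    (hm : m ∈ s) (hq : q ∈ s) (hx : x ∉ s) : triIndex p m q x = 0 := by
  have hsum := cross_add_cross_add_cross p m q x
  have key : ∀ a b c : ℝ, a = cross (p - x) (m - x) → b = cross (m - x) (q - x) →
      c = cross (q - x) (p - x) → a + b + c ≠ 0 → 0 ≤ a / (a + b + c) → 0 ≤ b / (a + b + c) →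
      0 ≤ c / (a + b + c) → False := by
    intro a b c ha hb hc h0 ha0 hb0 hc0
    apply hx
    -- The three cross products are twice the signed areas of the triangles that `x` forms with the
    -- edges, hence barycentric coordinates of `x` up to normalization.
    have hxx : x = (b / (a + b + c)) • p + (c / (a + b + c)) • m + (a / (a + b + c)) • q := by
      have e : (a + b + c) • x = b • p + c • m + a • q := by
        rw [ha, hb, hc]
        ext i
        fin_cases i <;> simp [cross] <;> ring
      rw [← inv_smul_smul₀ h0 x, e]
      simp only [smul_add, smul_smul, div_eq_inv_mul]
    rw [hxx]
    have := hs.sum_mem (t := (Finset.univ : Finset (Fin 3)))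
      (w := ![b / (a + b + c), c / (a + b + c), a / (a + b + c)]) (z := ![p, m, q])
      (by intro i _; fin_cases i <;> simpa) (by simp [Fin.sum_univ_three]; field_simp; ring)
      (by intro i _; fin_cases i <;> simpa)
    simpa [Fin.sum_univ_three] using this
  unfold triIndex
  split_ifs with hA hB
  · obtain ⟨h1, h2, h3⟩ := hA
    exact (key _ _ _ rfl rfl rfl (by positivity) (by positivity) (by positivity)
      (by positivity)).elim
  · obtain ⟨h1, h2, h3⟩ := hB
    exact (key _ _ _ rfl rfl rfl (by linarith)
      (div_nonneg_of_nonpos (by linarith) (by linarith))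
      (div_nonneg_of_nonpos (by linarith) (by linarith))
      (div_nonneg_of_nonpos (by linarith) (by linarith))).elim
  · rfl

lemma measurable_triIndex (p m q : Plane) : Measurable (triIndex p m q) := by
  have h : ∀ a b : Plane, Continuous fun x : Plane => cross (a - x) (b - x) := by
    intro a b
    simp only [cross]
    fun_prop
  unfold triIndex
  have h1 := h p m
  have h2 := h m q
  have h3 := h q p
  refine Measurable.ite ?_ measurable_const (Measurable.ite ?_ measurable_const measurable_const)
  · exact ((isOpen_lt continuous_const h1).inter
      ((isOpen_lt continuous_const h2).inter (isOpen_lt continuous_const h3))).measurableSet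
  · exact ((isOpen_lt h1 continuous_const).inter
      ((isOpen_lt h2 continuous_const).inter (isOpen_lt h3 continuous_const))).measurableSet

/-! ### Areas and null sets in the plane -/

/-- The image of a compact interval under a Hölder map of exponent larger than `1 / 2` is a null
set. -/
lemma volume_image_eq_zero {γ : ℝ → Plane} {s : Set ℝ} {C α : ℝ≥0} (hγ : HolderOnWith C α γ s)
    (hα : (1 / 2 : ℝ) < α) : volume (γ '' s) = 0 := by
  have hac : (volume : Measure Plane) ≪ Measure.hausdorffMeasure ((2 : ℕ) : ℝ) :=
    Measure.absolutelyContinuous_isAddHaarMeasure _ _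
  refine measure_zero_of_dimH_lt (d := ((2 : ℕ) : ℝ≥0)) (by simpa using hac) ?_
  have hα0 : 0 < α := by rw [← NNReal.coe_pos]; linarith
  have h1 : dimH s ≤ 1 := by
    calc dimH s ≤ dimH (univ : Set ℝ) := dimH_mono (subset_univ s)
      _ = 1 := by rw [Real.dimH_univ]
  -- A Hölder map of exponent `α` multiplies the Hausdorff dimension by at most `1 / α`, which is
  -- smaller than `2` here.
  calc dimH (γ '' s) ≤ dimH s / α := hγ.dimH_image_le hα0
    _ ≤ 1 / α := by gcongr
    _ < _ := by
      rw [ENNReal.div_lt_iff (Or.inl (by simpa using hα0.ne')) (Or.inl (by simp))]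
      have : (1 : ℝ≥0) < 2 * α := by
        rw [← NNReal.coe_lt_coe]; push_cast; linarith
      exact_mod_cast this

lemma volume_segment (p q : Plane) : volume (segment ℝ p q) = 0 := by
  rw [segment_eq_image_lineMap]
  have h : LipschitzWith (nndist p q) (AffineMap.lineMap (k := ℝ) p q) :=
    lipschitzWith_lineMap p q
  exact volume_image_eq_zero (h.lipschitzOnWith.holderOnWith) (by norm_num)

lemma ae_notMem_segment (p q : Plane) : ∀ᵐ x : Plane, x ∉ segment ℝ p q :=
  measure_eq_zero_iff_ae_notMem.1 (volume_segment p q)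

lemma linearMap_det (L : Plane →ₗ[ℝ] Plane) :
    LinearMap.det L = cross (L (EuclideanSpace.single 0 1)) (L (EuclideanSpace.single 1 1)) := by
  rw [← LinearMap.det_toMatrix (EuclideanSpace.basisFun (Fin 2) ℝ).toBasis, Matrix.det_fin_two]
  simp [LinearMap.toMatrix_apply, cross]
  ring

/-- The linear map `ℝ² → ℝ²` with columns `a` and `b`. -/
def columns (a b : Plane) : Plane →L[ℝ] Plane :=
  (EuclideanSpace.proj 0 : Plane →L[ℝ] ℝ).smulRight a +
    (EuclideanSpace.proj 1 : Plane →L[ℝ] ℝ).smulRight b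

lemma columns_apply (a b y : Plane) : columns a b y = y 0 • a + y 1 • b := rfl

lemma columns_det (a b : Plane) : (columns a b).det = cross a b := by
  have := linearMap_det (columns a b).toLinearMap
  rw [ContinuousLinearMap.det]
  rw [this]
  simp [columns_apply]

lemma integral_prod_eq_plane (g : Plane → ℝ) :
    ∫ z : ℝ × ℝ, g !₂[z.1, z.2] = ∫ y, g y := by
  have h1 := (volume_preserving_finTwoArrow ℝ).symm
  have h2 := (EuclideanSpace.volume_preserving_symm_measurableEquiv_toLp (Fin 2)).symm
  have h3 := h2.comp h1
  have := h3.integral_comp ((MeasurableEquiv.measurableEmbedding _).comp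
    (MeasurableEquiv.measurableEmbedding _)) g
  rw [← this]
  congr 1

/-- Affine change of variables. -/
lemma integral_affine (p : Plane) {a b : Plane} (h : cross a b ≠ 0) (g : Plane → ℝ) :
    ∫ x, g x = |cross a b| * ∫ z : ℝ × ℝ, g (p + (z.1 • a + z.2 • b)) := by
  have hinj : Function.Injective (columns a b) := by
    have : IsUnit (LinearMap.det (columns a b).toLinearMap) := by
      have := columns_det a b
      rw [ContinuousLinearMap.det] at this
      rw [this]; exact h.isUnit
    exact (LinearEquiv.ofIsUnitDet (f := (columns a b).toLinearMap)
      (v := (EuclideanSpace.basisFun (Fin 2) ℝ).toBasis)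
      (v' := (EuclideanSpace.basisFun (Fin 2) ℝ).toBasis)
      (by rwa [LinearMap.det_toMatrix])).injective
  have hsurj : Function.Surjective (columns a b) :=
    LinearMap.surjective_of_injective (f := (columns a b).toLinearMap) hinj
  have key := integral_image_eq_integral_abs_det_fderiv_smul (volume : Measure Plane)
    MeasurableSet.univ (f := fun y => p + columns a b y) (f' := fun _ => columns a b)
    (fun y _ => ((columns a b).hasFDerivAt.const_add p).hasFDerivWithinAt)
    (fun y _ z _ e => hinj (add_left_cancel e)) g
  have himg : (fun y => p + columns a b y) '' univ = univ := by
    rw [image_univ, range_eq_univ]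
    intro x
    obtain ⟨y, hy⟩ := hsurj (x - p)
    exact ⟨y, by simp [hy]⟩
  rw [himg] at key
  simp only [Measure.restrict_univ, columns_det, smul_eq_mul] at key
  rw [key, integral_const_mul, ← integral_prod_eq_plane]
  simp [columns_apply]

lemma integral_standard_triangle (a b c : ℝ) :
    ∫ z : ℝ × ℝ, (if 0 < z.1 ∧ 0 < z.2 ∧ 0 < 1 - z.1 - z.2 then a + b * z.1 + c * z.2 else 0) =
      (3 * a + b + c) / 6 := by
  set T : Set (ℝ × ℝ) := {z | 0 < z.1 ∧ 0 < z.2 ∧ 0 < 1 - z.1 - z.2} with hT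
  have hTo : IsOpen T := by
    refine (isOpen_lt continuous_const continuous_fst).inter
      ((isOpen_lt continuous_const continuous_snd).inter (isOpen_lt continuous_const
        ((continuous_const.sub continuous_fst).sub continuous_snd)))
  have hTb : T ⊆ Icc (0 : ℝ × ℝ) 1 := by
    rintro ⟨u, v⟩ ⟨h1, h2, h3⟩
    simp only at h1 h2 h3
    exact ⟨⟨h1.le, h2.le⟩, ⟨by simp; linarith, by simp; linarith⟩⟩
  have hcont : Continuous fun z : ℝ × ℝ => a + b * z.1 + c * z.2 := by fun_prop
  have hint : Integrable (T.indicator fun z : ℝ × ℝ => a + b * z.1 + c * z.2) :=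
    ((hcont.continuousOn.integrableOn_compact isCompact_Icc).mono_set hTb).integrable_indicator
      hTo.measurableSet
  have e : (fun z : ℝ × ℝ => if 0 < z.1 ∧ 0 < z.2 ∧ 0 < 1 - z.1 - z.2 then a + b * z.1 + c * z.2
      else 0) = T.indicator fun z : ℝ × ℝ => a + b * z.1 + c * z.2 := by
    ext z; simp only [indicator_apply, hT, mem_ofPred_eq]
  rw [e, Measure.volume_eq_prod, integral_prod _ hint]
  have inner : ∀ u : ℝ, ∫ v, T.indicator (fun z : ℝ × ℝ => a + b * z.1 + c * z.2) (u, v) =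
      (Ioc (0 : ℝ) 1).indicator (fun u => (a + b * u) * (1 - u) + c * ((1 - u) ^ 2 / 2)) u := by
    intro u
    by_cases hu : u ∈ Ioc (0 : ℝ) 1
    · rw [indicator_of_mem hu]
      have : (fun v => T.indicator (fun z : ℝ × ℝ => a + b * z.1 + c * z.2) (u, v)) =
          (Ioo 0 (1 - u)).indicator fun v => (a + b * u) + c * v := by
        ext v
        simp only [indicator_apply, hT, mem_ofPred_eq, mem_Ioo]
        have : (0 < u ∧ 0 < v ∧ 0 < 1 - u - v) ↔ (0 < v ∧ v < 1 - u) := by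
          constructor
          · rintro ⟨_, h2, h3⟩; exact ⟨h2, by linarith⟩
          · rintro ⟨h2, h3⟩; exact ⟨hu.1, h2, by linarith⟩
        simp only [this]
      have hI : IntervalIntegrable (fun v => c * v) volume 0 (1 - u) := by
        apply Continuous.intervalIntegrable; fun_prop
      rw [this, integral_indicator measurableSet_Ioo, ← integral_Ioc_eq_integral_Ioo,
        ← intervalIntegral.integral_of_le (by linarith [hu.2]),
        intervalIntegral.integral_add intervalIntegrable_const hI,
        intervalIntegral.integral_const, intervalIntegral.integral_const_mul, integral_id]
      simp; ring
    · rw [indicator_of_notMem hu]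
      rw [← integral_zero ℝ ℝ (μ := volume)]
      congr 1
      ext v
      rw [indicator_of_notMem]
      rintro ⟨h1, h2, h3⟩
      simp only at h1 h2 h3
      exact hu ⟨h1, by linarith⟩
  simp_rw [inner]
  rw [integral_indicator measurableSet_Ioc, ← intervalIntegral.integral_of_le zero_le_one]
  have hF : ∀ u ∈ uIcc (0 : ℝ) 1, HasDerivAt
      (fun u : ℝ => a * u + (b - a) * (u ^ 2 / 2) - b * (u ^ 3 / 3) - c * ((1 - u) ^ 3 / 6))
      ((a + b * u) * (1 - u) + c * ((1 - u) ^ 2 / 2)) u := by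
    intro u _
    have h1 := ((hasDerivAt_id u).const_mul a)
    have h2 := (((hasDerivAt_id u).pow 2).div_const 2).const_mul (b - a)
    have h3 := (((hasDerivAt_id u).pow 3).div_const 3).const_mul b
    have h4 := (((((hasDerivAt_id u).const_sub 1)).pow 3).div_const 6).const_mul c
    refine (((h1.add h2).sub h3).sub h4).congr_deriv ?_
    simp
    ring
  rw [intervalIntegral.integral_eq_sub_of_hasDerivAt hF (by
    apply Continuous.intervalIntegrable; fun_prop)]
  ring

/-- In affine coordinates the three cross products are `v`, `1 - u - v` and `u` times `cross a b`.
They sum to `cross a b`, so their common sign can only be that of `cross a b`. -/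
lemma triIndex_affine (p a b : Plane) (u v : ℝ) :
    triIndex p (p + a) (p + b) (p + (u • a + v • b)) =
      if 0 < u ∧ 0 < v ∧ 0 < 1 - u - v then (SignType.sign (cross a b) : ℝ) else 0 := by
  have e1 : cross (p - (p + (u • a + v • b))) (p + a - (p + (u • a + v • b))) = v * cross a b := by
    simp [cross]; ring
  have e2 : cross (p + a - (p + (u • a + v • b))) (p + b - (p + (u • a + v • b))) =
      (1 - u - v) * cross a b := by
    simp [cross]; ring
  have e3 : cross (p + b - (p + (u • a + v • b))) (p - (p + (u • a + v • b))) = u * cross a b := by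
    simp [cross]; ring
  rw [triIndex, e1, e2, e3]
  rcases lt_trichotomy (cross a b) 0 with h | h | h
  · have hn : ∀ t, t * cross a b < 0 ↔ 0 < t := fun t => by
      rw [mul_neg_iff]; constructor
      · rintro (h' | h')
        · exact h'.1
        · linarith [h'.2]
      · exact fun h' => Or.inl ⟨h', h⟩
    have hp : ∀ t, 0 < t * cross a b ↔ t < 0 := fun t => by
      rw [mul_pos_iff]; constructor
      · rintro (h' | h')
        · linarith [h'.2]
        · exact h'.1
      · exact fun h' => Or.inr ⟨h', h⟩
    simp only [hn, hp, sign_neg h]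
    have hA : ¬ (v < 0 ∧ 1 - u - v < 0 ∧ u < 0) := by rintro ⟨_, _, _⟩; linarith
    rw [if_neg hA]
    have hB : (0 < v ∧ 0 < 1 - u - v ∧ 0 < u) ↔ (0 < u ∧ 0 < v ∧ 0 < 1 - u - v) := by tauto
    simp only [hB]
    simp
  · simp [h]
  · have hp : ∀ t, 0 < t * cross a b ↔ 0 < t := fun t => mul_pos_iff_of_pos_right h
    have hn : ∀ t, t * cross a b < 0 ↔ t < 0 := fun t => by
      rw [← not_le, ← not_le, mul_nonneg_iff_of_pos_right h]
    simp only [hn, hp, sign_pos h]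
    have hA : ¬ (v < 0 ∧ 1 - u - v < 0 ∧ u < 0) := by rintro ⟨_, _, _⟩; linarith
    rw [if_neg hA]
    have hB : (0 < v ∧ 0 < 1 - u - v ∧ 0 < u) ↔ (0 < u ∧ 0 < v ∧ 0 < 1 - u - v) := by tauto
    simp only [hB]
    simp

/-- The integral of an affine function over an oriented triangle. -/
lemma integral_triIndex_mul (p m q : Plane) (a b c : ℝ) :
    ∫ x, triIndex p m q x * (a + b * x 0 + c * x 1) =
      cross (m - p) (q - p) / 6 * (3 * a + b * (p 0 + m 0 + q 0) + c * (p 1 + m 1 + q 1)) := by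
  -- For a degenerate triangle the cross products sum to zero and cannot share a strict sign, so the
  -- index vanishes identically. Otherwise the absolute value of the Jacobian and the sign in
  -- `triIndex_affine` combine to `cross`.
  by_cases h : cross (m - p) (q - p) = 0
  · rw [h, zero_div, zero_mul]
    convert integral_zero Plane ℝ with x
    have := cross_add_cross_add_cross p m q x
    rw [triIndex, if_neg, if_neg, zero_mul]
    · rintro ⟨h1, h2, h3⟩; linarith
    · rintro ⟨h1, h2, h3⟩; linarith
  · rw [integral_affine p h]
    have e : ∀ z : ℝ × ℝ, triIndex p m q (p + (z.1 • (m - p) + z.2 • (q - p))) *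
        (a + b * (p + (z.1 • (m - p) + z.2 • (q - p))) 0 +
          c * (p + (z.1 • (m - p) + z.2 • (q - p))) 1) =
        (SignType.sign (cross (m - p) (q - p)) : ℝ) *
        (if 0 < z.1 ∧ 0 < z.2 ∧ 0 < 1 - z.1 - z.2 then (a + b * p 0 + c * p 1) +
          (b * (m 0 - p 0) + c * (m 1 - p 1)) * z.1 +
          (b * (q 0 - p 0) + c * (q 1 - p 1)) * z.2 else 0) := by
      intro z
      have := triIndex_affine p (m - p) (q - p) z.1 z.2
      rw [add_sub_cancel, add_sub_cancel] at this
      rw [this]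
      split_ifs
      · simp only [PiLp.add_apply, PiLp.smul_apply, PiLp.sub_apply, smul_eq_mul]; ring
      · simp
    simp_rw [e]
    rw [integral_const_mul, integral_standard_triangle, ← mul_assoc, abs_mul_sign]
    ring

/-! ### Young integration -/

lemma sum_range_two_mul (N : ℕ) (F : ℕ → ℝ) :
    ∑ k ∈ Finset.range (2 * N), F k = ∑ k ∈ Finset.range N, (F (2 * k) + F (2 * k + 1)) := by
  induction N with
  | zero => simp
  | succ N ih =>
    rw [show 2 * (N + 1) = 2 * N + 1 + 1 by ring, Finset.sum_range_succ, Finset.sum_range_succ, ih,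
      Finset.sum_range_succ]
    ring

/-- Hölder continuity with constant `A` and exponent `-log₂ q`, tested at dyadic scales only. -/
def DyadicHolder (A q : ℝ) (f : ℝ → ℝ) : Prop :=
  ∀ (n : ℕ) (x y : ℝ), |x - y| ≤ (2 ^ n)⁻¹ → |f x - f y| ≤ A * q ^ n

/-- The left Riemann-Stieltjes sums of `f` against `g` over `[0, t]` along the dyadic partitions. -/
def dyadicRS (f g : ℝ → ℝ) (n : ℕ) (t : ℝ) : ℝ :=
  ∑ k ∈ Finset.range (2 ^ n),
    f (k / 2 ^ n) * (g (min t ((k + 1) / 2 ^ n)) - g (min t (k / 2 ^ n)))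

/-- Estimate of a sum over the dyadic intervals that meet `[u, v]`. -/
lemma abs_sum_cells_le {g : ℝ → ℝ} {B q : ℝ} (hg : DyadicHolder B q g) {m : ℕ} {u v M : ℝ}
    (hu : 0 ≤ u) (huv : u ≤ v) (hM : 0 ≤ M) (c a b : ℕ → ℝ)
    (ha : ∀ k : ℕ, (k : ℝ) / 2 ^ m ≤ a k) (hab : ∀ k, a k ≤ b k)
    (hb : ∀ k : ℕ, b k ≤ ((k : ℝ) + 1) / 2 ^ m)
    (hc : ∀ k : ℕ, u < ((k : ℝ) + 1) / 2 ^ m → (k : ℝ) / 2 ^ m < v → |c k| ≤ M) :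
    |∑ k ∈ Finset.range (2 ^ m),
      c k * ((g (min v (b k)) - g (min v (a k))) - (g (min u (b k)) - g (min u (a k))))| ≤
      ((v - u) * 2 ^ m + 2) * (M * (2 * (B * q ^ m))) := by
  have h2 : (0 : ℝ) < 2 ^ m := by positivity
  have hBq : 0 ≤ B * q ^ m := (abs_nonneg _).trans (hg m 0 0 (by simp))
  have hlen : ∀ k, b k - a k ≤ (2 ^ m : ℝ)⁻¹ := by
    intro k
    have h1 := ha k
    have h3 := hb k
    rw [add_div, one_div] at h3
    linarith
  have hd : ∀ t k, |g (min t (b k)) - g (min t (a k))| ≤ B * q ^ m := by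
    intro t k
    apply hg
    calc |min t (b k) - min t (a k)| ≤ max |t - t| |b k - a k| := abs_min_sub_min_le_max _ _ _ _
      _ ≤ _ := by
        rw [sub_self, abs_zero, abs_of_nonneg (sub_nonneg.2 (hab k))]
        exact max_le (by positivity) (hlen k)
  -- On a cell that misses the interval the increments cut off at `u` and at `v` coincide, so only
  -- the indices in `S` contribute. There are at most `(v - u) * 2 ^ m + 2` of them.
  set S := Finset.Icc ⌊u * 2 ^ m⌋₊ ⌊v * 2 ^ m⌋₊ with hS
  have hterm : ∀ k : ℕ, |c k * ((g (min v (b k)) - g (min v (a k))) -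
      (g (min u (b k)) - g (min u (a k))))| ≤ if k ∈ S then M * (2 * (B * q ^ m)) else 0 := by
    intro k
    by_cases h1 : u < ((k : ℝ) + 1) / 2 ^ m ∧ (k : ℝ) / 2 ^ m < v
    · have hk : k ∈ S := by
        rw [hS, Finset.mem_Icc]
        constructor
        · have h3 : u * 2 ^ m < k + 1 := (lt_div_iff₀ h2).1 h1.1
          rw [← Nat.lt_succ_iff, Nat.floor_lt (by positivity)]
          push_cast; exact h3
        · exact Nat.le_floor ((div_le_iff₀ h2).1 h1.2.le)
      rw [if_pos hk, abs_mul]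
      apply mul_le_mul (hc k h1.1 h1.2) _ (abs_nonneg _) hM
      have h1 := abs_le.1 (hd v k)
      have h2 := abs_le.1 (hd u k)
      rw [abs_le]
      constructor <;> linarith [h1.1, h1.2, h2.1, h2.2]
    · have h0 : (g (min v (b k)) - g (min v (a k))) - (g (min u (b k)) - g (min u (a k))) = 0 := by
        rw [not_and_or, not_lt, not_lt] at h1
        rcases h1 with h1 | h1
        · have hb' := (hb k).trans h1
          have ha' := (hab k).trans hb'
          rw [min_eq_right hb', min_eq_right ha', min_eq_right (hb'.trans huv),
            min_eq_right (ha'.trans huv), sub_self]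
        · have ha' := h1.trans (ha k)
          have hb' := ha'.trans (hab k)
          rw [min_eq_left hb', min_eq_left ha', min_eq_left (huv.trans hb'),
            min_eq_left (huv.trans ha')]
          ring
      rw [h0, mul_zero, abs_zero]
      split_ifs
      · positivity
      · rfl
  calc _ ≤ ∑ k ∈ Finset.range (2 ^ m), |c k * ((g (min v (b k)) - g (min v (a k))) -
      (g (min u (b k)) - g (min u (a k))))| := Finset.abs_sum_le_sum_abs _ _
    _ ≤ ∑ k ∈ Finset.range (2 ^ m), (if k ∈ S then M * (2 * (B * q ^ m)) else 0) :=
      Finset.sum_le_sum fun k _ => hterm k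
    _ ≤ (S.card : ℝ) * (M * (2 * (B * q ^ m))) := by
      rw [← Finset.sum_filter, Finset.sum_const, nsmul_eq_mul]
      gcongr
      intro k hk
      exact (Finset.mem_filter.1 hk).2
    _ ≤ _ := by
      gcongr
      rw [hS, Nat.card_Icc]
      have h3 : ⌊u * 2 ^ m⌋₊ ≤ ⌊v * 2 ^ m⌋₊ := Nat.floor_le_floor (by gcongr)
      rw [Nat.cast_sub (by omega)]
      have h4 := Nat.floor_le (show 0 ≤ v * 2 ^ m by have := hu.trans huv; positivity)
      have h5 := Nat.lt_floor_add_one (u * 2 ^ m)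
      push_cast
      linarith

/-- Under refinement the tag changes only on the right half of each cell, where it moves from the
left end point to the midpoint. -/
lemma dyadicRS_succ_sub (f g : ℝ → ℝ) (n : ℕ) (t : ℝ) :
    dyadicRS f g (n + 1) t - dyadicRS f g n t =
      ∑ k ∈ Finset.range (2 ^ n), (f ((2 * k + 1) / 2 ^ (n + 1)) - f (k / 2 ^ n)) *
        (g (min t ((k + 1) / 2 ^ n)) - g (min t ((2 * k + 1) / 2 ^ (n + 1)))) := by
  rw [dyadicRS, dyadicRS, pow_succ', sum_range_two_mul, ← Finset.sum_sub_distrib]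
  refine Finset.sum_congr rfl fun k _ => ?_
  push_cast
  have e1 : (2 * (k : ℝ)) / 2 ^ (n + 1) = k / 2 ^ n := by
    rw [pow_succ', mul_div_mul_left _ _ two_ne_zero]
  have e2 : (2 * (k : ℝ) + 1 + 1) / 2 ^ (n + 1) = (k + 1) / 2 ^ n := by
    rw [pow_succ', ← mul_div_mul_left _ _ (two_ne_zero (α := ℝ))]; ring
  rw [e1, e2]
  ring

lemma sum_cells (g : ℝ → ℝ) (n : ℕ) {t : ℝ} (h0 : 0 ≤ t) (h1 : t ≤ 1) :
    ∑ k ∈ Finset.range (2 ^ n), (g (min t (((k : ℝ) + 1) / 2 ^ n)) - g (min t (k / 2 ^ n))) =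
      g t - g 0 := by
  have := Finset.sum_range_sub (fun k : ℕ => g (min t (k / 2 ^ n))) (2 ^ n)
  simp only [Nat.cast_add, Nat.cast_one] at this
  rw [this]
  simp [h0, h1]

lemma dyadicHolder_le {A q : ℝ} {f : ℝ → ℝ} (hf : DyadicHolder A q f) {n : ℕ} {x y : ℝ}
    (h : |x - y| ≤ 2 * (2 ^ n)⁻¹) : |f x - f y| ≤ 2 * (A * q ^ n) := by
  have h1 := hf n x ((x + y) / 2) (by
    rw [show x - (x + y) / 2 = (x - y) / 2 by ring, abs_div, abs_two]; linarith)
  have h2 := hf n ((x + y) / 2) y (by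
    rw [show (x + y) / 2 - y = (x - y) / 2 by ring, abs_div, abs_two]; linarith)
  calc _ ≤ _ := abs_sub_le _ ((f ((x + y) / 2))) _
    _ ≤ _ := by linarith

/-- `J` is the indefinite Young integral, the limit of the dyadic sums. The bound carries a factor
`v - u` besides a power of `2 q ^ 2 < 1`. When it is summed over any partition of `[0, 1]` of small
mesh, the lengths add up to `1` and the power makes the error small, whatever the number of points
and the choice of tags. -/
lemma exists_young {f g : ℝ → ℝ} {A B q : ℝ} (hA : 0 ≤ A) (hB : 0 ≤ B) (hq : 0 ≤ q)
    (hq2 : 2 * q ^ 2 < 1) (hf : DyadicHolder A q f) (hg : DyadicHolder B q g) :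
    ∃ (J : ℝ → ℝ) (K : ℝ), 0 ≤ K ∧ ∀ (n : ℕ) (u v s : ℝ), 0 ≤ u → u ≤ s → s ≤ v → v ≤ 1 →
      v - u ≤ (2 ^ n)⁻¹ → |f s * (g v - g u) - (J v - J u)| ≤ K * (v - u) * (2 * q ^ 2) ^ n := by
  set r := 2 * q ^ 2 with hr
  have hr0 : 0 ≤ r := by positivity
  set D : ℕ → ℝ → ℝ := fun m t => dyadicRS f g (m + 1) t - dyadicRS f g m t with hD
  -- increments of consecutive sums
  have hDest : ∀ (m n : ℕ) (u v : ℝ), n ≤ m → 0 ≤ u → u ≤ v → v - u ≤ (2 ^ n)⁻¹ →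
      |D m v - D m u| ≤ 6 * A * B * (q ^ 2) ^ n * r ^ (m - n) := by
    intro m n u v hnm hu huv hn
    rw [hD]
    simp only
    rw [dyadicRS_succ_sub, dyadicRS_succ_sub, ← Finset.sum_sub_distrib]
    simp_rw [← mul_sub]
    have hkey := abs_sum_cells_le hg (m := m) hu huv (M := A * q ^ m) (by positivity)
      (fun k => f ((2 * k + 1) / 2 ^ (m + 1)) - f (k / 2 ^ m))
      (fun k => (2 * (k : ℝ) + 1) / 2 ^ (m + 1)) (fun k => ((k : ℝ) + 1) / 2 ^ m)
      (fun k => by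
        rw [pow_succ', ← mul_div_mul_left (k : ℝ) _ (two_ne_zero (α := ℝ))]; gcongr; linarith)
      (fun k => by
        rw [pow_succ', ← mul_div_mul_left ((k : ℝ) + 1) _ (two_ne_zero (α := ℝ))]; gcongr
        linarith)
      (fun k => le_rfl)
      (fun k _ _ => hf m _ _ (by
        rw [pow_succ', ← mul_div_mul_left (k : ℝ) _ (two_ne_zero (α := ℝ)), ← sub_div,
          add_sub_cancel_left, abs_of_nonneg (by positivity), one_div]
        gcongr
        have : (0 : ℝ) < 2 ^ m := by positivity
        linarith))
    refine hkey.trans ?_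
    -- At most `3 * 2 ^ (m - n)` cells of level `m` contribute, each with a product of increments of
    -- `f` and `g` of order `q ^ (2 m)`.
    have h3 : (v - u) * 2 ^ m + 2 ≤ 3 * 2 ^ (m - n) := by
      have h4 : (v - u) * 2 ^ m ≤ 2 ^ (m - n) := by
        calc (v - u) * 2 ^ m ≤ (2 ^ n)⁻¹ * 2 ^ m := by gcongr
          _ = 2 ^ (m - n) := by
            rw [pow_sub₀ _ two_ne_zero hnm]; ring
      have h5 : (1 : ℝ) ≤ 2 ^ (m - n) := one_le_pow₀ (by norm_num)
      linarith
    calc _ ≤ 3 * 2 ^ (m - n) * (A * q ^ m * (2 * (B * q ^ m))) := by gcongr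
      _ = 6 * A * B * (q ^ 2) ^ m * 2 ^ (m - n) := by ring
      _ = _ := by
        obtain ⟨d, rfl⟩ := Nat.exists_eq_add_of_le hnm
        rw [Nat.add_sub_cancel_left, hr, pow_add, mul_pow]; ring
  have hD0 : ∀ m, D m 0 = 0 := by
    intro m
    have h : ∀ n, dyadicRS f g n 0 = 0 := by
      intro n
      refine Finset.sum_eq_zero fun k _ => ?_
      rw [min_eq_left (by positivity), min_eq_left (by positivity), sub_self, mul_zero]
    rw [hD]; simp [h]
  have hsum : ∀ t, 0 ≤ t → t ≤ 1 → Summable fun m => D m t := by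
    intro t h0 h1
    refine Summable.of_norm_bounded (g := fun m => 6 * A * B * r ^ m)
      ((summable_geometric_of_lt_one hr0 hq2).mul_left _) fun m => ?_
    have := hDest m 0 0 t (Nat.zero_le _) le_rfl h0 (by simpa using h1)
    simpa [hD0] using this
  have htel : ∀ (n : ℕ) (t : ℝ), 0 ≤ t → t ≤ 1 →
      dyadicRS f g 0 t + ∑' m, D m t = dyadicRS f g n t + ∑' m, D (m + n) t := by
    intro n t h0 h1
    rw [← (hsum t h0 h1).sum_add_tsum_nat_add n, hD]
    simp only
    rw [Finset.sum_range_sub (fun m => dyadicRS f g m t)]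
    ring
  -- In the constant, `13 = 12 + 1` collects the error of the sum at the scale of `v - u` and that
  -- of the tag, and `6 / (1 - r)` is the geometric tail. The factor `2` comes from `2 ^ (-n) < 2 (v
  -- - u)`.
  refine ⟨fun t => dyadicRS f g 0 t + ∑' m, D m t,
    2 * (13 * A * B + 6 * A * B / (1 - r)), ?_, ?_⟩
  · have : 0 < 1 - r := by linarith
    positivity
  intro N u v s hu hus hsv hv hN
  rcases (hus.trans hsv).eq_or_lt with rfl | hlt
  · simp
  -- The scale of the interval: `2 ^ (-(n + 1)) < v - u ≤ 2 ^ (-n)`. All estimates are made at this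
  -- level and transferred to the coarser level `N ≤ n` at the end.
  obtain ⟨n, hn1, hn2⟩ := exists_nat_pow_near_of_lt_one (sub_pos.2 hlt)
    (by linarith : v - u ≤ 1) (show (0 : ℝ) < 1 / 2 by norm_num) (by norm_num)
  rw [one_div, inv_pow] at hn1 hn2
  have huv := hlt.le
  have hu1 := huv.trans hv
  have hv0 := hu.trans huv
  simp only
  rw [htel n v hv0 hv, htel n u hu hu1]
  have hsv' := (summable_nat_add_iff n).2 (hsum v hv0 hv)
  have hsu' := (summable_nat_add_iff n).2 (hsum u hu hu1)
  have htail : |∑' m, D (m + n) v - ∑' m, D (m + n) u| ≤ 6 * A * B * (q ^ 2) ^ n / (1 - r) := by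
    rw [← hsv'.tsum_sub hsu', ← Real.norm_eq_abs, div_eq_mul_inv]
    refine tsum_of_norm_bounded ((hasSum_geometric_of_lt_one hr0 hq2).mul_left _) fun m => ?_
    have := hDest (m + n) n u v (Nat.le_add_left _ _) hu huv hn2
    rwa [Nat.add_sub_cancel] at this
  have hlevel : |dyadicRS f g n v - dyadicRS f g n u - f u * (g v - g u)| ≤
      12 * A * B * (q ^ 2) ^ n := by
    have e : dyadicRS f g n v - dyadicRS f g n u - f u * (g v - g u) =
        ∑ k ∈ Finset.range (2 ^ n), (f (k / 2 ^ n) - f u) *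
          ((g (min v ((k + 1) / 2 ^ n)) - g (min v (k / 2 ^ n))) -
            (g (min u ((k + 1) / 2 ^ n)) - g (min u (k / 2 ^ n)))) := by
      rw [show g v - g u = (g v - g 0) - (g u - g 0) by ring, ← sum_cells g n hv0 hv,
        ← sum_cells g n hu hu1, dyadicRS, dyadicRS, ← Finset.sum_sub_distrib,
        ← Finset.sum_sub_distrib, Finset.mul_sum, ← Finset.sum_sub_distrib]
      exact Finset.sum_congr rfl fun k _ => by ring
    rw [e]
    refine (abs_sum_cells_le hg (m := n) hu huv (M := 2 * (A * q ^ n)) (by positivity)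
      (fun k => f (k / 2 ^ n) - f u) (fun k => k / 2 ^ n) (fun k => (k + 1) / 2 ^ n)
      (fun k => le_rfl) (fun k => by gcongr; linarith) (fun k => le_rfl)
      (fun k h1 h2 => dyadicHolder_le hf ?_)).trans ?_
    · rw [add_div, one_div] at h1
      rw [abs_le]
      constructor <;> linarith [show (0 : ℝ) < (2 ^ n)⁻¹ by positivity]
    · have h3 : (v - u) * 2 ^ n + 2 ≤ 3 := by
        have : (v - u) * 2 ^ n ≤ (2 ^ n)⁻¹ * 2 ^ n := by gcongr
        rw [inv_mul_cancel₀ (by positivity)] at this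
        linarith
      calc _ ≤ 3 * (2 * (A * q ^ n) * (2 * (B * q ^ n))) := by gcongr
        _ = _ := by ring
  have hs : |(f s - f u) * (g v - g u)| ≤ A * B * (q ^ 2) ^ n := by
    rw [abs_mul]
    have h1 := hf n s u (by rw [abs_of_nonneg (by linarith)]; linarith)
    have h2 := hg n v u (by rw [abs_of_nonneg (by linarith)]; linarith)
    calc _ ≤ (A * q ^ n) * (B * q ^ n) := by gcongr
      _ = _ := by ring
  have hfin : |f s * (g v - g u) - (dyadicRS f g n v + ∑' m, D (m + n) v -
      (dyadicRS f g n u + ∑' m, D (m + n) u))| ≤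
      (13 * A * B + 6 * A * B / (1 - r)) * (q ^ 2) ^ n := by
    have h1 := abs_le.1 htail
    have h2 := abs_le.1 hlevel
    have h3 := abs_le.1 hs
    have h4 : (13 * A * B + 6 * A * B / (1 - r)) * (q ^ 2) ^ n = 12 * A * B * (q ^ 2) ^ n +
      A * B * (q ^ 2) ^ n + 6 * A * B * (q ^ 2) ^ n / (1 - r) := by ring
    rw [h4, abs_le]
    constructor <;> linarith [h1.1, h1.2, h2.1, h2.2, h3.1, h3.2]
  refine hfin.trans ?_
  have hNn : N ≤ n := by
    have h1 : (2 ^ (n + 1) : ℝ)⁻¹ < (2 ^ N)⁻¹ := hn1.trans_le hN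
    rw [inv_lt_inv₀ (by positivity) (by positivity)] at h1
    have := (pow_lt_pow_iff_right₀ (one_lt_two (α := ℝ))).1 h1
    omega
  -- Splitting `q ^ 2 = r / 2` trades `2 ^ (-n)` for the length of the interval.
  have h1 : (q ^ 2) ^ n ≤ 2 * (v - u) * r ^ N := by
    calc (q ^ 2) ^ n = (2 ^ n)⁻¹ * r ^ n := by
          rw [hr, mul_pow]; field_simp
      _ ≤ (2 * (v - u)) * r ^ N := by
          have : (2 ^ n : ℝ)⁻¹ ≤ 2 * (v - u) := by
            rw [pow_succ, mul_inv] at hn1; linarith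
          have h6 : r ^ n ≤ r ^ N := pow_le_pow_of_le_one hr0 hq2.le hNn
          gcongr
  have hpos : 0 < 1 - r := by linarith
  calc _ ≤ (13 * A * B + 6 * A * B / (1 - r)) * (2 * (v - u) * r ^ N) := by gcongr
    _ = _ := by ring

lemma partition_mem {a b δ : ℝ} {m : ℕ} {t s : ℕ → ℝ} (h0 : t 0 = a) (h1 : t m = b)
    (hts : ∀ i < m, t i ≤ s i ∧ s i ≤ t (i + 1) ∧ t (i + 1) - t i < δ) :
    ∀ i ≤ m, t i ∈ Icc a b := by
  have hmono : ∀ i, i ≤ m → a ≤ t i := by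
    intro i
    induction i with
    | zero => intro _; rw [h0]
    | succ i ih =>
      intro hi
      have := hts i (by omega)
      exact (ih (by omega)).trans (this.1.trans this.2.1)
  have hmono' : ∀ i, i ≤ m → t (m - i) ≤ b := by
    intro i
    induction i with
    | zero => intro _; rw [Nat.sub_zero, h1]
    | succ i ih =>
      intro hi
      have h2 := hts (m - (i + 1)) (by omega)
      rw [show m - (i + 1) + 1 = m - i by omega] at h2
      exact (h2.1.trans h2.2.1).trans (ih (by omega))
  refine fun i hi => ⟨hmono i hi, ?_⟩
  have := hmono' (m - i) (by omega)
  rwa [Nat.sub_sub_self hi] at this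

/-- Young's theorem: the Riemann-Stieltjes integral exists. -/
theorem rsIntegrable_of_dyadicHolder {f g : ℝ → ℝ} {A B q : ℝ} (hA : 0 ≤ A) (hB : 0 ≤ B)
    (hq : 0 ≤ q) (hq2 : 2 * q ^ 2 < 1) (hf : DyadicHolder A q f) (hg : DyadicHolder B q g) :
    RSIntegrable f g 0 1 := by
  obtain ⟨J, K, hK, hJ⟩ := exists_young hA hB hq hq2 hf hg
  refine ⟨J 1 - J 0, fun ε hε => ?_⟩
  obtain ⟨n, hn⟩ := exists_pow_lt_of_lt_one (div_pos hε (show 0 < K + 1 by linarith)) hq2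
  refine ⟨(2 ^ n)⁻¹, by positivity, fun m t s h0 h1 hts => ?_⟩
  have hmem := partition_mem h0 h1 hts
  have e : J 1 - J 0 = ∑ i ∈ Finset.range m, (J (t (i + 1)) - J (t i)) := by
    rw [Finset.sum_range_sub (fun i => J (t i)), h0, h1]
  rw [e, ← Finset.sum_sub_distrib]
  calc _ ≤ ∑ i ∈ Finset.range m, |f (s i) * (g (t (i + 1)) - g (t i)) - (J (t (i + 1)) - J (t i))| :=
        Finset.abs_sum_le_sum_abs _ _
    _ ≤ ∑ i ∈ Finset.range m, K * (t (i + 1) - t i) * (2 * q ^ 2) ^ n := by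
      refine Finset.sum_le_sum fun i hi => ?_
      have hi := Finset.mem_range.1 hi
      have h2 := hts i hi
      exact hJ n _ _ _ (hmem i hi.le).1 h2.1 h2.2.1 (hmem (i + 1) hi).2 h2.2.2.le
    _ = K * (2 * q ^ 2) ^ n := by
      rw [← Finset.sum_mul, ← Finset.mul_sum, Finset.sum_range_sub, h0, h1]; ring
    _ ≤ (K + 1) * (2 * q ^ 2) ^ n := by gcongr; linarith
    _ < ε := by
      rwa [lt_div_iff₀ (by linarith), mul_comm] at hn

lemma HasRSIntegral.congr {f g f' g' : ℝ → ℝ} {a b I : ℝ} (h : HasRSIntegral f g a b I)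
    (hf : EqOn f f' (Icc a b)) (hg : EqOn g g' (Icc a b)) : HasRSIntegral f' g' a b I := by
  intro ε hε
  obtain ⟨δ, hδ, H⟩ := h ε hε
  refine ⟨δ, hδ, fun m t s h0 h1 hts => ?_⟩
  have hmem := partition_mem h0 h1 hts
  convert H m t s h0 h1 hts using 4 with i hi
  have hi := Finset.mem_range.1 hi
  have h2 := hts i hi
  rw [hf ⟨(hmem i hi.le).1.trans h2.1, h2.2.1.trans (hmem (i + 1) hi).2⟩,
    hg (hmem i hi.le), hg (hmem (i + 1) hi)]

/-- Hölder continuity on `[0, 1]` with constant `A` and exponent `-log₂ q`, tested at dyadic scales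
only. -/
def DyadicHolderOn {E : Type*} [PseudoMetricSpace E] (A q : ℝ) (f : ℝ → E) : Prop :=
  ∀ (n : ℕ), ∀ x ∈ Icc (0 : ℝ) 1, ∀ y ∈ Icc (0 : ℝ) 1, |x - y| ≤ (2 ^ n)⁻¹ →
    dist (f x) (f y) ≤ A * q ^ n

/-- Extension by constants beyond the end points: the projection to `[0, 1]` is `1`-Lipschitz.
Riemann–Stieltjes sums over `[0, 1]` do not see the extension. -/
lemma DyadicHolderOn.clamp {A q : ℝ} {f : ℝ → ℝ} (hf : DyadicHolderOn A q f) :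
    DyadicHolder A q fun t => f (projIcc 0 1 zero_le_one t) := by
  intro n x y hxy
  refine hf n _ (projIcc 0 1 zero_le_one x).2 _ (projIcc 0 1 zero_le_one y).2 (le_trans ?_ hxy)
  exact abs_projIcc_sub_projIcc zero_le_one

lemma DyadicHolderOn.nonneg {E : Type*} [PseudoMetricSpace E] {A q : ℝ} {f : ℝ → E}
    (hf : DyadicHolderOn A q f) : 0 ≤ A := by
  have := hf 0 0 (by simp) 0 (by simp) (by simp)
  simpa using this

theorem rsIntegrable_of_dyadicHolderOn {f g : ℝ → ℝ} {A B q : ℝ}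
    (hq : 0 ≤ q) (hq2 : 2 * q ^ 2 < 1) (hf : DyadicHolderOn A q f) (hg : DyadicHolderOn B q g) :
    RSIntegrable f g 0 1 := by
  obtain ⟨I, hI⟩ := rsIntegrable_of_dyadicHolder hf.nonneg hg.nonneg hq hq2 hf.clamp hg.clamp
  refine ⟨I, hI.congr ?_ ?_⟩ <;>
  · intro x hx
    simp only [projIcc_of_mem zero_le_one hx]

/-- The dyadic left sums converge to the Riemann-Stieltjes integral. -/
lemma RSIntegrable.tendsto {f g : ℝ → ℝ} (h : RSIntegrable f g 0 1) :
    Tendsto (fun N : ℕ => ∑ i ∈ Finset.range (2 ^ N),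
      f (i / 2 ^ N) * (g ((i + 1) / 2 ^ N) - g (i / 2 ^ N))) atTop (𝓝 (rsIntegral f g 0 1)) := by
  have hI : HasRSIntegral f g 0 1 (rsIntegral f g 0 1) := by
    rw [rsIntegral, dif_pos h]; exact h.choose_spec
  rw [Metric.tendsto_atTop]
  intro ε hε
  obtain ⟨δ, hδ, H⟩ := hI ε hε
  obtain ⟨n, hn⟩ := exists_pow_lt_of_lt_one hδ (show (1 / 2 : ℝ) < 1 by norm_num)
  refine ⟨n, fun N hN => ?_⟩
  rw [Real.dist_eq]
  have := H (2 ^ N) (fun i => i / 2 ^ N) (fun i => i / 2 ^ N) (by simp) (by simp) (fun i _ => by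
    refine ⟨le_rfl, ?_, ?_⟩
    · push_cast; gcongr; linarith
    · push_cast
      rw [← sub_div, add_sub_cancel_left]
      calc (1 : ℝ) / 2 ^ N = (1 / 2) ^ N := by rw [one_div, one_div, inv_pow]
        _ ≤ (1 / 2) ^ n := pow_le_pow_of_le_one (by norm_num) (by norm_num) hN
        _ < δ := hn)
  simpa using this

/-! ### The winding number of a polygon inscribed in the image of the boundary of a square -/

/-- The points that divide the image of the segment from `y` to `y'` dyadically. -/
def node (φ : Plane → Plane) (y y' : Plane) (N : ℕ) (t : ℝ) : Plane :=
  φ (AffineMap.lineMap y y' (t / 2 ^ N))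

lemma node_succ (φ : Plane → Plane) (y y' : Plane) (N : ℕ) (t : ℝ) :
    node φ y y' (N + 1) (2 * t) = node φ y y' N t := by
  rw [node, node, pow_succ', mul_div_mul_left _ _ two_ne_zero]

/-- The sum of an edge functional over the polygonal line through the nodes. -/
def edgeSum (E : Plane → Plane → ℝ) (φ : Plane → Plane) (N : ℕ) (y y' : Plane) : ℝ :=
  ∑ i ∈ Finset.range (2 ^ N), E (node φ y y' N i) (node φ y y' N (i + 1))

/-- The sum of a triangle functional over the triangles by which the polygonal line through the
nodes changes from level `N` to level `N + 1`. -/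
def triSum (T : Plane → Plane → Plane → ℝ) (φ : Plane → Plane) (N : ℕ) (y y' : Plane) : ℝ :=
  ∑ i ∈ Finset.range (2 ^ N),
    T (node φ y y' N i) (node φ y y' (N + 1) (2 * i + 1)) (node φ y y' N (i + 1))

/-- `T` is the coboundary of the antisymmetric functional `E` on all triples of points of `s`. -/
lemma edgeSum_succ {E : Plane → Plane → ℝ} {T : Plane → Plane → Plane → ℝ} {φ : Plane → Plane}
    {s : Set Plane} (hE : ∀ p ∈ s, ∀ q ∈ s, E q p = -E p q)
    (hT : ∀ p ∈ s, ∀ m ∈ s, ∀ q ∈ s, E p m + E m q + E q p = T p m q) {y y' : Plane}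
    (hs : ∀ (n i : ℕ), node φ y y' n i ∈ s) (N : ℕ) :
    edgeSum E φ (N + 1) y y' = edgeSum E φ N y y' + triSum T φ N y y' := by
  rw [edgeSum, edgeSum, triSum, pow_succ', sum_range_two_mul, ← Finset.sum_add_distrib]
  refine Finset.sum_congr rfl fun i _ => ?_
  have e1 : ((2 * i : ℕ) : ℝ) = 2 * (i : ℝ) := by push_cast; ring
  have e2 : ((2 * i + 1 : ℕ) : ℝ) + 1 = 2 * ((i : ℝ) + 1) := by push_cast; ring
  rw [e2, e1, node_succ, node_succ]
  have h1 := hs N i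
  have h2 := hs N (i + 1)
  have h3 := hs (N + 1) (2 * i + 1)
  push_cast at h1 h2 h3 ⊢
  rw [← hT _ h1 _ h3 _ h2, hE _ h1 _ h2]
  ring

namespace Square

/-- The sum of an edge functional over the polygon through the nodes on the four sides. -/
def polySum (R : Square) (E : Plane → Plane → ℝ) (φ : Plane → Plane) (N : ℕ) : ℝ :=
  ∑ k : Fin 4, edgeSum E φ N (R.vertex k) (R.vertex (k + 1))

/-- The sum of a triangle functional over two triangles that make up the initial quadrangle. -/
def baseSum (R : Square) (T : Plane → Plane → Plane → ℝ) (φ : Plane → Plane) : ℝ :=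
  T (φ (R.vertex 0)) (φ (R.vertex 1)) (φ (R.vertex 2)) +
    T (φ (R.vertex 0)) (φ (R.vertex 2)) (φ (R.vertex 3))

/-- The sum of a triangle functional over the triangles by which the polygon through the nodes
changes from level `N` to level `N + 1`. -/
def stepSum (R : Square) (T : Plane → Plane → Plane → ℝ) (φ : Plane → Plane) (N : ℕ) : ℝ :=
  ∑ k : Fin 4, triSum T φ N (R.vertex k) (R.vertex (k + 1))

/-- The sum of a triangle functional over a triangulation of the polygon of level `N`. -/
def fillSum (R : Square) (T : Plane → Plane → Plane → ℝ) (φ : Plane → Plane) (N : ℕ) : ℝ :=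
  R.baseSum T φ + ∑ n ∈ Finset.range N, R.stepSum T φ n

/-- A discrete Stokes formula. It is applied twice: with angles and triangle indices, where the
relations hold only off countably many segments (hence the set `s`), and with primitives of
polynomial forms and integrals over triangles, where `s` is everything. -/
lemma polySum_eq_fillSum (R : Square) {E : Plane → Plane → ℝ} {T : Plane → Plane → Plane → ℝ}
    {φ : Plane → Plane} {s : Set Plane} (hE : ∀ p ∈ s, ∀ q ∈ s, E q p = -E p q)
    (hT : ∀ p ∈ s, ∀ m ∈ s, ∀ q ∈ s, E p m + E m q + E q p = T p m q)
    (hs : ∀ (k : Fin 4) (n i : ℕ), node φ (R.vertex k) (R.vertex (k + 1)) n i ∈ s) (N : ℕ) :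
    R.polySum E φ N = R.fillSum T φ N := by
  induction N with
  | zero =>
    have hv : ∀ k, φ (R.vertex k) ∈ s := fun k => by
      have := hs k 0 0
      simpa [node] using this
    simp only [polySum, fillSum, baseSum, Finset.sum_range_zero, add_zero, Fin.sum_univ_four,
      edgeSum, pow_zero, Finset.sum_range_one, node, Nat.cast_zero, zero_add, div_one,
      AffineMap.lineMap_apply_zero, AffineMap.lineMap_apply_one]
    -- The diagonal joining vertices `0` and `2` is traversed once in each direction and drops out.
    rw [← hT _ (hv 0) _ (hv 1) _ (hv 2), ← hT _ (hv 0) _ (hv 2) _ (hv 3),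
      hE _ (hv 0) _ (hv 2)]
    simp only [show (1 : Fin 4) + 1 = 2 by decide, show (2 : Fin 4) + 1 = 3 by decide,
      show (3 : Fin 4) + 1 = 0 by decide]
    ring
  | succ N ih =>
    rw [fillSum, Finset.sum_range_succ, ← add_assoc, ← fillSum, ← ih, polySum, polySum, stepSum,
      ← Finset.sum_add_distrib]
    exact Finset.sum_congr rfl fun k _ => edgeSum_succ hE hT (hs k) N

/-- The winding number around `x` of the polygon through the nodes of level `N`. -/
def polyIndex (R : Square) (φ : Plane → Plane) (N : ℕ) (x : Plane) : ℝ :=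
  R.polySum (angleAt x) φ N / (2 * Real.pi)

/-- The winding number around `x` of the image of the boundary of a square. -/
def index (R : Square) (φ : Plane → Plane) (x : Plane) : ℝ :=
  R.baseSum (fun p m q => triIndex p m q x) φ +
    ∑' N, R.stepSum (fun p m q => triIndex p m q x) φ N

/-- There are only countably many nodes over all levels, so almost every `x` avoids all segments
between them, and the angle identities hold at `x` simultaneously for all `N`. -/
lemma ae_polyIndex (R : Square) (φ : Plane → Plane) :
    ∀ᵐ x, ∀ N, R.polyIndex φ N x = R.fillSum (fun p m q => triIndex p m q x) φ N := by
  set s : Set Plane := range fun z : Fin 4 × ℕ × ℕ =>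
    node φ (R.vertex z.1) (R.vertex (z.1 + 1)) z.2.1 z.2.2 with hs
  have hsc : s.Countable := countable_range _
  have hae : ∀ᵐ x, ∀ p ∈ s, ∀ q ∈ s, x ∉ segment ℝ p q :=
    (ae_ball_iff hsc).2 fun p _ => (ae_ball_iff hsc).2 fun q _ => ae_notMem_segment p q
  filter_upwards [hae] with x hx N
  have := R.polySum_eq_fillSum (E := angleAt x)
    (T := fun p m q => 2 * Real.pi * triIndex p m q x) (φ := φ) (s := s)
    (fun p hp q hq => angleAt_swap (hx p hp q hq))
    (fun p hp m hm q hq => angleAt_triangle (hx p hp m hm) (hx m hm q hq) (hx q hq p hp))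
    (fun k n i => ⟨(k, n, i), rfl⟩) N
  rw [polyIndex, this, div_eq_iff (by positivity)]
  simp only [fillSum, baseSum, stepSum, triSum, ← Finset.mul_sum]
  ring

/-- Once the polygonal winding numbers are constant the step sums vanish, and the series that
defines `index` is a finite sum. -/
lemma index_eq_of_eventually {R : Square} {φ : Plane → Plane} {x : Plane} {d : ℝ}
    (hx : ∀ N, R.polyIndex φ N x = R.fillSum (fun p m q => triIndex p m q x) φ N)
    (hd : ∀ᶠ N in atTop, R.polyIndex φ N x = d) : R.index φ x = d := by
  obtain ⟨M, hM⟩ := eventually_atTop.1 hd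
  have hz : ∀ N ∉ Finset.range M, R.stepSum (fun p m q => triIndex p m q x) φ N = 0 := by
    intro N hN
    rw [Finset.mem_range, not_lt] at hN
    have h1 := hM N hN
    have h2 := hM (N + 1) (by omega)
    rw [hx, fillSum] at h1 h2
    rw [Finset.sum_range_succ] at h2
    linarith
  rw [index, tsum_eq_sum hz, ← hM M le_rfl, hx, fillSum]

end Square

/-! ### Integrals of the winding number -/

/-- Tonelli for the series of norms. Where the series does not converge `tsum` has the value `0`, so
the pointwise bound by the sum of the norms holds everywhere, and pointwise summability need not be
discussed. -/
lemma integrable_and_integral_norm_tsum_le {F : ℕ → Plane → ℝ} {b : ℕ → ℝ} {S : ℝ}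
    (hm : ∀ n, Measurable (F n)) (hF : ∀ n, Integrable (F n)) (hb : ∀ n, ∫ x, ‖F n x‖ ≤ b n)
    (hS : HasSum b S) :
    Integrable (fun x => ∑' n, F n x) ∧ ∫ x, ‖∑' n, F n x‖ ≤ S := by
  have hb0 : ∀ n, 0 ≤ b n := fun n => (integral_nonneg fun x => norm_nonneg _).trans (hb n)
  have hle : ∫⁻ x, ‖∑' n, F n x‖ₑ ≤ ENNReal.ofReal S := by
    calc ∫⁻ x, ‖∑' n, F n x‖ₑ ≤ ∫⁻ x, ∑' n, ‖F n x‖ₑ := lintegral_mono fun x =>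
          enorm_tsum_le_tsum_enorm
      _ = ∑' n, ∫⁻ x, ‖F n x‖ₑ := lintegral_tsum fun n => (hm n).enorm.aemeasurable
      _ ≤ ∑' n, ENNReal.ofReal (b n) := by
        refine ENNReal.tsum_le_tsum fun n => ?_
        rw [← ofReal_integral_norm_eq_lintegral_enorm (hF n)]
        exact ENNReal.ofReal_le_ofReal (hb n)
      _ = ENNReal.ofReal S := by
        rw [← ENNReal.ofReal_tsum_of_nonneg hb0 hS.summable, hS.tsum_eq]
  have hint : Integrable (fun x => ∑' n, F n x) :=
    ⟨(Measurable.tsum hm).aestronglyMeasurable, hle.trans_lt ENNReal.ofReal_lt_top⟩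
  refine ⟨hint, ?_⟩
  rw [← ENNReal.ofReal_le_ofReal_iff (hS.nonneg hb0), ofReal_integral_norm_eq_lintegral_enorm hint]
  exact hle

/-- The area of the unit disc. -/
def discArea : ℝ := volume.real (Metric.ball (0 : Plane) 1)

lemma volume_closedBall_plane (p : Plane) {d : ℝ} (hd : 0 ≤ d) :
    volume.real (Metric.closedBall p d) = d ^ 2 * discArea := by
  rw [Measure.addHaar_real_closedBall _ _ hd]
  simp [discArea]

lemma integrable_triIndex_mul (p m q : Plane) {f : Plane → ℝ} (hf : Continuous f) :
    Integrable fun x => triIndex p m q x * f x := by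
  set K : Set Plane := convexHull ℝ {p, m, q} with hK
  have hKc : IsCompact K := (Set.toFinite _).isCompact_convexHull ℝ
  have e : (fun x => triIndex p m q x * f x) = K.indicator fun x => triIndex p m q x * f x := by
    ext x
    by_cases hx : x ∈ K
    · rw [indicator_of_mem hx]
    · rw [indicator_of_notMem hx, triIndex_eq_zero (convex_convexHull ℝ _)
        (subset_convexHull ℝ _ (by simp)) (subset_convexHull ℝ _ (by simp))
        (subset_convexHull ℝ _ (by simp)) hx, zero_mul]
  rw [e]
  refine IntegrableOn.integrable_indicator ?_ hKc.measurableSet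
  refine Integrable.bdd_mul (c := 1) (hf.continuousOn.integrableOn_compact hKc)
    (measurable_triIndex p m q).aestronglyMeasurable ?_
  exact ae_of_all _ fun x => triIndex_abs_le p m q x

lemma integrable_triIndex (p m q : Plane) : Integrable (triIndex p m q) := by
  simpa using integrable_triIndex_mul p m q (f := fun _ => 1) continuous_const

lemma integral_norm_triIndex_le {p m q c : Plane} {d : ℝ} (hp : p ∈ Metric.closedBall c d)
    (hm : m ∈ Metric.closedBall c d) (hq : q ∈ Metric.closedBall c d) :
    ∫ x, ‖triIndex p m q x‖ ≤ d ^ 2 * discArea := by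
  have hd : 0 ≤ d := dist_nonneg.trans hp
  calc ∫ x, ‖triIndex p m q x‖ ≤ ∫ x, (Metric.closedBall c d).indicator (fun _ => (1 : ℝ)) x := by
        refine integral_mono (integrable_triIndex p m q).norm
          ((integrable_indicator_iff Metric.isClosed_closedBall.measurableSet).2
            (integrableOn_const (measure_closedBall_lt_top.ne))) fun x => ?_
        by_cases hx : x ∈ Metric.closedBall c d
        · simpa [indicator_of_mem hx] using triIndex_abs_le p m q x
        · rw [indicator_of_notMem hx]
          simp [triIndex_eq_zero (convex_closedBall c d) hp hm hq hx]
    _ = d ^ 2 * discArea := by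
        rw [integral_indicator Metric.isClosed_closedBall.measurableSet, setIntegral_const,
          volume_closedBall_plane c hd, smul_eq_mul, mul_one]

namespace Square

/-- The boundary of `R` is mapped into the closed disc around `c` of radius `r`, and the map is
Hölder continuous on each side with constant `A` and exponent `-log₂ q > 1 / 2`. -/
structure Tame (R : Square) (φ : Plane → Plane) (A q : ℝ) (c : Plane) (r : ℝ) : Prop where
  nonneg : 0 ≤ q
  lt_one : 2 * q ^ 2 < 1
  holder : ∀ k, DyadicHolderOn A q fun t => φ (R.side k t)
  mem_ball : ∀ k, ∀ t ∈ Icc (0 : ℝ) 1, φ (R.side k t) ∈ Metric.closedBall c r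

section

variable {R : Square} {φ : Plane → Plane} {A q : ℝ} {c : Plane} {r : ℝ}

lemma Tame.node_mem (h : R.Tame φ A q c r) (k : Fin 4) (N : ℕ) {t : ℝ} (h0 : 0 ≤ t)
    (h1 : t ≤ 2 ^ N) :
    node φ (R.vertex k) (R.vertex (k + 1)) N t ∈ Metric.closedBall c r :=
  h.mem_ball k _ ⟨by positivity, by rwa [div_le_one (by positivity)]⟩

lemma succ_le_of_mem_range {N i : ℕ} (hi : i ∈ Finset.range (2 ^ N)) :
    (i : ℝ) + 1 ≤ 2 ^ N := by
  exact_mod_cast Finset.mem_range.1 hi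

lemma Tame.dist_node (h : R.Tame φ A q c r) (k : Fin 4) {n M N : ℕ} {s t : ℝ} (hs : 0 ≤ s)
    (hs1 : s ≤ 2 ^ M) (ht : 0 ≤ t) (ht1 : t ≤ 2 ^ N)
    (hst : |s / 2 ^ M - t / 2 ^ N| ≤ (2 ^ n)⁻¹) :
    dist (node φ (R.vertex k) (R.vertex (k + 1)) M s)
      (node φ (R.vertex k) (R.vertex (k + 1)) N t) ≤ A * q ^ n :=
  h.holder k n _ ⟨by positivity, by rwa [div_le_one (by positivity)]⟩ _
    ⟨by positivity, by rwa [div_le_one (by positivity)]⟩ hst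

lemma Tame.radius_nonneg (h : R.Tame φ A q c r) : 0 ≤ r :=
  dist_nonneg.trans (h.mem_ball 0 0 (by simp))

lemma Tame.const_nonneg (h : R.Tame φ A q c r) : 0 ≤ A := (h.holder 0).nonneg

lemma Tame.vertex_mem (h : R.Tame φ A q c r) (k : Fin 4) :
    φ (R.vertex k) ∈ Metric.closedBall c r := by
  have := h.mem_ball k 0 (by simp)
  simpa [side] using this

lemma baseSum_mul (T : Plane → Plane → Plane → ℝ) (a : ℝ) :
    R.baseSum T φ * a = R.baseSum (fun p m q => T p m q * a) φ := by
  simp only [baseSum]; ring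

lemma stepSum_mul (T : Plane → Plane → Plane → ℝ) (a : ℝ) (N : ℕ) :
    R.stepSum T φ N * a = R.stepSum (fun p m q => T p m q * a) φ N := by
  simp only [stepSum, triSum, Finset.sum_mul]

lemma integrable_baseSum {F : Plane → Plane → Plane → Plane → ℝ}
    (hF : ∀ p m q, Integrable (F p m q)) :
    Integrable fun x => R.baseSum (fun p m q => F p m q x) φ :=
  (hF _ _ _).add (hF _ _ _)

lemma integrable_stepSum {F : Plane → Plane → Plane → Plane → ℝ}
    (hF : ∀ p m q, Integrable (F p m q)) (N : ℕ) :
    Integrable fun x => R.stepSum (fun p m q => F p m q x) φ N :=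
  integrable_finsetSum _ fun _ _ => integrable_finsetSum _ fun _ _ => hF _ _ _

lemma integral_baseSum {F : Plane → Plane → Plane → Plane → ℝ}
    (hF : ∀ p m q, Integrable (F p m q)) :
    ∫ x, R.baseSum (fun p m q => F p m q x) φ = R.baseSum (fun p m q => ∫ x, F p m q x) φ :=
  integral_add (hF _ _ _) (hF _ _ _)

lemma integral_stepSum {F : Plane → Plane → Plane → Plane → ℝ}
    (hF : ∀ p m q, Integrable (F p m q)) (N : ℕ) :
    ∫ x, R.stepSum (fun p m q => F p m q x) φ N = R.stepSum (fun p m q => ∫ x, F p m q x) φ N := by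
  simp only [stepSum, triSum]
  rw [integral_finsetSum _ fun _ _ => integrable_finsetSum _ fun _ _ => hF _ _ _]
  exact Finset.sum_congr rfl fun _ _ => integral_finsetSum _ fun _ _ => hF _ _ _

lemma measurable_stepSum (N : ℕ) :
    Measurable fun x => R.stepSum (fun p m q => triIndex p m q x) φ N :=
  Finset.measurable_fun_sum _ fun _ _ => Finset.measurable_fun_sum _ fun _ _ =>
    measurable_triIndex _ _ _

lemma Tame.triangle_mem (h : R.Tame φ A q c r) (k : Fin 4) (N : ℕ) {i : ℕ}
    (hi : i ∈ Finset.range (2 ^ N)) :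
    node φ (R.vertex k) (R.vertex (k + 1)) N i ∈ Metric.closedBall c r ∧
    node φ (R.vertex k) (R.vertex (k + 1)) (N + 1) (2 * i + 1) ∈ Metric.closedBall c r ∧
    node φ (R.vertex k) (R.vertex (k + 1)) N (i + 1) ∈ Metric.closedBall c r := by
  have := succ_le_of_mem_range hi
  refine ⟨h.node_mem k N (by positivity) (by linarith),
    h.node_mem k (N + 1) (by positivity) (by rw [pow_succ]; linarith),
    h.node_mem k N (by positivity) this⟩

lemma Tame.stepSum_eq_zero (h : R.Tame φ A q c r) {x : Plane} (hx : x ∉ Metric.closedBall c r)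
    (N : ℕ) : R.stepSum (fun p m q => triIndex p m q x) φ N = 0 :=
  Finset.sum_eq_zero fun k _ => Finset.sum_eq_zero fun i hi => by
    obtain ⟨ha, hb, hd⟩ := h.triangle_mem k N hi
    exact triIndex_eq_zero (convex_closedBall c r) ha hb hd hx

lemma Tame.index_eq_zero (h : R.Tame φ A q c r) {x : Plane} (hx : x ∉ Metric.closedBall c r) :
    R.index φ x = 0 := by
  have hc := convex_closedBall c r
  rw [index, baseSum, triIndex_eq_zero hc (h.vertex_mem _) (h.vertex_mem _) (h.vertex_mem _) hx,
    triIndex_eq_zero hc (h.vertex_mem _) (h.vertex_mem _) (h.vertex_mem _) hx]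
  simp [h.stepSum_eq_zero hx]

/-- There are `4 * 2 ^ N` triangles, each contained in a disc of radius `A q ^ N` around its first
node. This is where `2 q ^ 2 < 1`, that is `α > 1/2`, becomes decisive. -/
lemma Tame.integral_norm_stepSum_le (h : R.Tame φ A q c r) (N : ℕ) :
    ∫ x, ‖R.stepSum (fun p m q => triIndex p m q x) φ N‖ ≤
      4 * A ^ 2 * discArea * (2 * q ^ 2) ^ N := by
  calc ∫ x, ‖R.stepSum (fun p m q => triIndex p m q x) φ N‖ ≤
      ∫ x, R.stepSum (fun p m q => ‖triIndex p m q x‖) φ N := by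
        refine integral_mono (integrable_stepSum integrable_triIndex N).norm
          (integrable_stepSum (fun p m q => (integrable_triIndex p m q).norm) N) fun x => ?_
        exact (norm_sum_le _ _).trans (Finset.sum_le_sum fun k _ => norm_sum_le _ _)
    _ = R.stepSum (fun p m q => ∫ x, ‖triIndex p m q x‖) φ N :=
        integral_stepSum (fun p m q => (integrable_triIndex p m q).norm) N
    _ ≤ ∑ k : Fin 4, ∑ i ∈ Finset.range (2 ^ N), (A * q ^ N) ^ 2 * discArea := by
        refine Finset.sum_le_sum fun k _ => Finset.sum_le_sum fun i hi => ?_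
        have hi' := succ_le_of_mem_range hi
        have hA := h.const_nonneg
        have hq := h.nonneg
        have h2 : (0 : ℝ) < 2 ^ N := by positivity
        refine integral_norm_triIndex_le (c := node φ (R.vertex k) (R.vertex (k + 1)) N i)
          (Metric.mem_closedBall_self (by positivity)) ?_ ?_
        · refine h.dist_node k (by positivity) (by rw [pow_succ]; linarith) (by positivity)
            (by linarith) ?_
          rw [show (2 * (i : ℝ) + 1) / 2 ^ (N + 1) - i / 2 ^ N = (2 ^ N)⁻¹ / 2 by
            rw [pow_succ]; field_simp; ring, abs_of_nonneg (by positivity)]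
          have : (0 : ℝ) < (2 ^ N)⁻¹ := by positivity
          linarith
        · refine h.dist_node k (by positivity) hi' (by positivity) (by linarith) ?_
          rw [← sub_div, add_sub_cancel_left, one_div, abs_of_nonneg (by positivity)]
    _ = 4 * A ^ 2 * discArea * (2 * q ^ 2) ^ N := by
        simp only [Finset.sum_const, Finset.card_univ, Fintype.card_fin, Finset.card_range,
          nsmul_eq_mul, mul_pow, ← pow_mul, mul_comm N 2]
        push_cast; ring

/-- The winding number is integrable, with a quantitative bound. -/
lemma Tame.integrable_index (h : R.Tame φ A q c r) :
    Integrable (R.index φ) ∧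
      ∫ x, ‖R.index φ x‖ ≤ (2 * r ^ 2 + 4 * A ^ 2 / (1 - 2 * q ^ 2)) * discArea := by
  have hr0 : 0 ≤ 2 * q ^ 2 := by positivity
  obtain ⟨h1, h2⟩ := integrable_and_integral_norm_tsum_le
    (measurable_stepSum (R := R) (φ := φ)) (integrable_stepSum integrable_triIndex)
    h.integral_norm_stepSum_le ((hasSum_geometric_of_lt_one hr0 h.lt_one).mul_left _)
  have h3 : Integrable fun x => R.baseSum (fun p m q => triIndex p m q x) φ :=
    integrable_baseSum integrable_triIndex
  have h4 : ∫ x, ‖R.baseSum (fun p m q => triIndex p m q x) φ‖ ≤ 2 * r ^ 2 * discArea := by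
    calc _ ≤ ∫ x, R.baseSum (fun p m q => ‖triIndex p m q x‖) φ :=
          integral_mono h3.norm (integrable_baseSum fun p m q => (integrable_triIndex p m q).norm)
            fun x => norm_add_le _ _
      _ = R.baseSum (fun p m q => ∫ x, ‖triIndex p m q x‖) φ :=
          integral_baseSum fun p m q => (integrable_triIndex p m q).norm
      _ ≤ r ^ 2 * discArea + r ^ 2 * discArea :=
          add_le_add
            (integral_norm_triIndex_le (h.vertex_mem _) (h.vertex_mem _) (h.vertex_mem _))
            (integral_norm_triIndex_le (h.vertex_mem _) (h.vertex_mem _) (h.vertex_mem _))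
      _ = _ := by ring
  refine ⟨h3.add h1, ?_⟩
  calc ∫ x, ‖R.index φ x‖ ≤ ∫ x, (‖R.baseSum (fun p m q => triIndex p m q x) φ‖ +
      ‖∑' N, R.stepSum (fun p m q => triIndex p m q x) φ N‖) :=
        integral_mono (h3.add h1).norm (h3.norm.add h1.norm) fun x => norm_add_le _ _
    _ ≤ _ := by
        rw [integral_add h3.norm h1.norm]
        refine (add_le_add h4 h2).trans (le_of_eq ?_)
        ring

/-- The winding number vanishes outside the closed disc of radius `r`, by convexity of the disc, and
`f` is bounded on it. -/
lemma Tame.integrable_index_mul (h : R.Tame φ A q c r) {f : Plane → ℝ} (hf : Continuous f) :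
    Integrable fun x => R.index φ x * f x := by
  have hK : IsCompact (Metric.closedBall c r) := isCompact_closedBall c r
  obtain ⟨M, hM⟩ := hK.exists_bound_of_continuousOn hf.continuousOn
  have e : (fun x => R.index φ x * f x) =
      fun x => (Metric.closedBall c r).indicator f x * R.index φ x := by
    ext x
    by_cases hx : x ∈ Metric.closedBall c r
    · rw [indicator_of_mem hx, mul_comm]
    · rw [h.index_eq_zero hx]; simp
  rw [e]
  refine h.integrable_index.1.bdd_mul (c := max M 0)
    (hf.measurable.indicator hK.measurableSet).aestronglyMeasurable (ae_of_all _ fun x => ?_)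
  by_cases hx : x ∈ Metric.closedBall c r
  · rw [indicator_of_mem hx]; exact (hM x hx).trans (le_max_left _ _)
  · rw [indicator_of_notMem hx, norm_zero]; exact le_max_right _ _

/-- Integrals against the winding number are limits of sums over polygons. -/
lemma Tame.tendsto_polySum (h : R.Tame φ A q c r) {f : Plane → ℝ} (hf : Continuous f)
    {E : Plane → Plane → ℝ} (hE : ∀ p q, E q p = -E p q)
    (hT : ∀ p m q, E p m + E m q + E q p = ∫ x, triIndex p m q x * f x) :
    Tendsto (fun N => R.polySum E φ N) atTop (𝓝 (∫ x, R.index φ x * f x)) := by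
  have hK : IsCompact (Metric.closedBall c r) := isCompact_closedBall c r
  obtain ⟨M, hM⟩ := hK.exists_bound_of_continuousOn hf.continuousOn
  have hFi := fun p m q => integrable_triIndex_mul p m q hf
  have hG : ∀ N, Integrable fun x => R.stepSum (fun p m q => triIndex p m q x * f x) φ N :=
    fun N => integrable_stepSum hFi N
  have hGn : ∀ N, ∫ x, ‖R.stepSum (fun p m q => triIndex p m q x * f x) φ N‖ ≤
      (4 * A ^ 2 * discArea * |M|) * (2 * q ^ 2) ^ N := by
    intro N
    calc _ ≤ ∫ x, ‖R.stepSum (fun p m q => triIndex p m q x) φ N‖ * |M| := by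
          refine integral_mono (hG N).norm
            ((integrable_stepSum integrable_triIndex N).norm.mul_const _) fun x => ?_
          simp only
          rw [← stepSum_mul, norm_mul]
          by_cases hx : x ∈ Metric.closedBall c r
          · gcongr
            exact (hM x hx).trans (le_abs_self M)
          · rw [h.stepSum_eq_zero hx]; simp
      _ ≤ (4 * A ^ 2 * discArea * (2 * q ^ 2) ^ N) * |M| := by
          rw [integral_mul_const]
          gcongr
          exact h.integral_norm_stepSum_le N
      _ = _ := by ring
  -- The step sums are summable in L¹ after multiplication by `f`, since they are supported in a
  -- disc where `|f|` is bounded; so sum and integral may be exchanged.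
  have hsum := hasSum_integral_of_summable_integral_norm hG
    (Summable.of_nonneg_of_le (fun N => integral_nonneg fun x => norm_nonneg _) hGn
      ((summable_geometric_of_lt_one (by positivity) h.lt_one).mul_left _))
  have hlim := (hsum.tendsto_sum_nat).const_add
    (∫ x, R.baseSum (fun p m q => triIndex p m q x * f x) φ)
  have hind : ∫ x, R.index φ x * f x = (∫ x, R.baseSum (fun p m q => triIndex p m q x * f x) φ) +
      ∫ x, ∑' N, R.stepSum (fun p m q => triIndex p m q x * f x) φ N := by
    have e : (fun x => ∑' N, R.stepSum (fun p m q => triIndex p m q x * f x) φ N) =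
        fun x => R.index φ x * f x - R.baseSum (fun p m q => triIndex p m q x * f x) φ := by
      ext x
      simp_rw [← stepSum_mul, ← baseSum_mul, index, tsum_mul_right]
      ring
    rw [e, integral_sub (h.integrable_index_mul hf) (integrable_baseSum hFi)]
    ring
  rw [hind]
  refine hlim.congr fun N => ?_
  rw [R.polySum_eq_fillSum (T := fun p m q => ∫ x, triIndex p m q x * f x) (s := univ)
    (fun p _ q _ => hE p q) (fun p _ m _ q _ => hT p m q) (fun _ _ _ => mem_univ _), fillSum,
    integral_baseSum hFi]
  congr 1
  exact Finset.sum_congr rfl fun n _ => integral_stepSum hFi n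

end

end Square

/-! ### Moments of the winding number as boundary integrals -/

lemma abs_coord_sub_le (x y : Plane) (i : Fin 2) : |x i - y i| ≤ dist x y := by
  rw [dist_eq_norm]
  exact PiLp.norm_apply_le (x - y) i

lemma DyadicHolderOn.coord {A q : ℝ} {γ : ℝ → Plane} (h : DyadicHolderOn A q γ) (i : Fin 2) :
    DyadicHolderOn A q fun t => γ t i :=
  fun n x hx y hy hxy => (abs_coord_sub_le _ _ i).trans (h n x hx y hy hxy)

lemma DyadicHolderOn.coord_sq {A q r : ℝ} {γ : ℝ → Plane} {c : Plane} (h : DyadicHolderOn A q γ)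
    (hr : ∀ t ∈ Icc (0 : ℝ) 1, γ t ∈ Metric.closedBall c r) (i : Fin 2) :
    DyadicHolderOn (2 * r * A) q fun t => (γ t i - c i) ^ 2 := by
  intro n x hx y hy hxy
  have h1 := (h.coord i) n x hx y hy hxy
  have h2 := (abs_coord_sub_le _ _ i).trans (hr x hx)
  have h3 := (abs_coord_sub_le _ _ i).trans (hr y hy)
  rw [Real.dist_eq] at h1 ⊢
  have h4 : |γ x i - c i + (γ y i - c i)| ≤ 2 * r := (abs_add_le _ _).trans (by linarith)
  rw [sq_sub_sq, abs_mul]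
  calc _ ≤ (2 * r) * (A * q ^ n) := by
        apply mul_le_mul h4 _ (abs_nonneg _) ((abs_nonneg _).trans h4)
        rwa [sub_sub_sub_cancel_right]
    _ = _ := by ring

namespace Square

variable {R : Square} {φ : Plane → Plane} {A q : ℝ} {c : Plane} {r : ℝ}

lemma Tame.boundaryIntegrable (h : R.Tame φ A q c r) :
    R.BoundaryIntegrable (fun y => φ y 0) (fun y => φ y 1) := fun k =>
  rsIntegrable_of_dyadicHolderOn h.nonneg h.lt_one ((h.holder k).coord 0) ((h.holder k).coord 1)

lemma Tame.boundaryIntegrable_sq_left (h : R.Tame φ A q c r) :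
    R.BoundaryIntegrable (fun y => (φ y 0 - c 0) ^ 2) (fun y => φ y 1) := fun k =>
  rsIntegrable_of_dyadicHolderOn h.nonneg h.lt_one ((h.holder k).coord_sq (h.mem_ball k) 0)
    ((h.holder k).coord 1)

lemma Tame.boundaryIntegrable_sq_right (h : R.Tame φ A q c r) :
    R.BoundaryIntegrable (fun y => φ y 0) (fun y => (φ y 1 - c 1) ^ 2) := fun k =>
  rsIntegrable_of_dyadicHolderOn h.nonneg h.lt_one ((h.holder k).coord 0)
    ((h.holder k).coord_sq (h.mem_ball k) 1)

/-- The polygonal sums of an edge functional that agrees to first order with the increments of a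
Riemann-Stieltjes integral converge to that integral. -/
lemma Tame.tendsto_boundaryIntegral (h : R.Tame φ A q c r) {E : Plane → Plane → ℝ}
    {F G : Plane → ℝ} {K : ℝ} (hE : ∀ x ∈ Metric.closedBall c r, ∀ y ∈ Metric.closedBall c r,
      |E x y - F x * (G y - G x)| ≤ K * dist x y ^ 2)
    (hRS : R.BoundaryIntegrable (fun y => F (φ y)) (fun y => G (φ y))) :
    Tendsto (fun N => R.polySum E φ N) atTop
      (𝓝 (R.boundaryIntegral (fun y => F (φ y)) (fun y => G (φ y)))) := by
  refine tendsto_finsetSum _ fun k _ => ?_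
  have h1 := (hRS k).tendsto
  -- The total discrepancy on one side: `2 ^ N` edges of length at most `A q ^ N`, each with a
  -- quadratic error.
  have h2 : Tendsto (fun N : ℕ => |K| * A ^ 2 * (2 * q ^ 2) ^ N) atTop (𝓝 0) := by
    have := (tendsto_pow_atTop_nhds_zero_of_lt_one (by positivity) h.lt_one).const_mul
      (|K| * A ^ 2)
    rwa [mul_zero] at this
  have h3 : Tendsto (fun N => edgeSum E φ N (R.vertex k) (R.vertex (k + 1)) -
      ∑ i ∈ Finset.range (2 ^ N), F (φ (R.side k (i / 2 ^ N))) *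
        (G (φ (R.side k ((i + 1) / 2 ^ N))) - G (φ (R.side k (i / 2 ^ N))))) atTop (𝓝 0) := by
    refine squeeze_zero_norm (fun N => ?_) h2
    rw [edgeSum, ← Finset.sum_sub_distrib]
    calc _ ≤ ∑ i ∈ Finset.range (2 ^ N), |K| * (A * q ^ N) ^ 2 := by
          refine norm_sum_le_of_le _ fun i hi => ?_
          have hi' := succ_le_of_mem_range hi
          obtain ⟨ha, -, hb⟩ := h.triangle_mem k N hi
          refine (hE _ ha _ hb).trans ?_
          have hd := h.dist_node k (n := N) (M := N) (N := N) (s := i) (t := i + 1) (by positivity)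
            (by linarith) (by positivity) hi' (by
              rw [← sub_div, sub_add_cancel_left, neg_div, abs_neg, one_div,
                abs_of_nonneg (by positivity)])
          calc _ ≤ |K| * dist _ _ ^ 2 := by gcongr; exact le_abs_self K
            _ ≤ _ := by gcongr
      _ = _ := by
          rw [Finset.sum_const, Finset.card_range, nsmul_eq_mul]
          push_cast
          rw [mul_pow, mul_pow, ← pow_mul, ← pow_mul, mul_comm N 2]
          ring
  have := h3.add h1
  simpa using this

/-- Stokes for the form `x₀ dx₁`, with exterior derivative `dx₀ ∧ dx₁`: `E` is its integral along a
segment, given by the trapezoidal rule. -/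
lemma Tame.integral_index (h : R.Tame φ A q c r) : ∫ x, R.index φ x = X1 φ R := by
  have h1 := h.tendsto_polySum (f := fun _ => 1) continuous_const
    (E := fun x y => (x 0 + y 0) / 2 * (y 1 - x 1)) (fun x y => by ring) (fun p m q => by
      have := integral_triIndex_mul p m q 1 0 0
      simp only [zero_mul, add_zero] at this
      rw [this]
      simp only [cross, PiLp.sub_apply]
      ring)
  simp only [mul_one] at h1
  refine tendsto_nhds_unique h1 (h.tendsto_boundaryIntegral (K := 1 / 2) (F := fun x => x 0)
    (G := fun x => x 1) (fun x _ y _ => ?_) h.boundaryIntegrable)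
  rw [show (x 0 + y 0) / 2 * (y 1 - x 1) - x 0 * (y 1 - x 1) =
    1 / 2 * ((x 0 - y 0) * (x 1 - y 1)) by ring, abs_mul, abs_mul,
    abs_of_nonneg (by norm_num : (0 : ℝ) ≤ 1 / 2), sq]
  have := abs_coord_sub_le x y 0
  have := abs_coord_sub_le x y 1
  gcongr

/-- Stokes for the form `½ (x₀ - c₀)² dx₁`, whose exterior derivative is `(x₀ - c₀) dx₀ ∧ dx₁`.
Again `E` is the exact integral along a segment. -/
lemma Tame.integral_index_mul_fst (h : R.Tame φ A q c r) :
    ∫ x, R.index φ x * (x 0 - c 0) =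
      1 / 2 * R.boundaryIntegral (fun y => (φ y 0 - c 0) ^ 2) (fun y => φ y 1) := by
  have h1 := h.tendsto_polySum (f := fun x => x 0 - c 0) (by fun_prop)
    (E := fun x y => 1 / 2 * (((x 0 - c 0) ^ 2 + (x 0 - c 0) * (y 0 - c 0) + (y 0 - c 0) ^ 2) / 3 *
      (y 1 - x 1))) (fun x y => by ring) (fun p m q => by
      have := integral_triIndex_mul p m q (-c 0) 1 0
      simp only [zero_mul, add_zero, one_mul] at this
      simp_rw [sub_eq_neg_add (_ : ℝ) (c 0)]
      rw [this]
      simp only [cross, PiLp.sub_apply]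
      ring)
  refine tendsto_nhds_unique h1 ?_
  have h2 := (h.tendsto_boundaryIntegral (E := fun x y => ((x 0 - c 0) ^ 2 +
    (x 0 - c 0) * (y 0 - c 0) + (y 0 - c 0) ^ 2) / 3 * (y 1 - x 1)) (K := r)
    (F := fun x => (x 0 - c 0) ^ 2)
    (G := fun x => x 1) (fun x hx y hy => ?_) h.boundaryIntegrable_sq_left).const_mul (1 / 2)
  · refine h2.congr fun N => ?_
    simp only [polySum, edgeSum, Finset.mul_sum]
  · have hx' := (abs_coord_sub_le _ _ 0).trans hx
    have hr := h.radius_nonneg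
    have hy' := (abs_coord_sub_le _ _ 0).trans hy
    have h4 : |(2 * (x 0 - c 0) + (y 0 - c 0)) / 3| ≤ r := by
      rw [abs_le] at *
      constructor <;> linarith [hx'.1, hx'.2, hy'.1, hy'.2]
    -- The difference to the increment tagged at the left end contains one coordinate difference in
    -- each direction, hence is quadratic; the remaining factor is at most `r` on the disc.
    rw [show ((x 0 - c 0) ^ 2 + (x 0 - c 0) * (y 0 - c 0) + (y 0 - c 0) ^ 2) / 3 * (y 1 - x 1) -
        (x 0 - c 0) ^ 2 * (y 1 - x 1) = (2 * (x 0 - c 0) + (y 0 - c 0)) / 3 *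
        ((x 0 - y 0) * (x 1 - y 1)) by ring, abs_mul, abs_mul, sq]
    have := abs_coord_sub_le x y 0
    have := abs_coord_sub_le x y 1
    gcongr

/-- Stokes for the form `½ x₀ d((x₁ - c₁)²)`, whose exterior derivative is `(x₁ - c₁) dx₀ ∧ dx₁`.
The cubic term in `E` corrects the trapezoidal rule to the exact integral along a segment. -/
lemma Tame.integral_index_mul_snd (h : R.Tame φ A q c r) :
    ∫ x, R.index φ x * (x 1 - c 1) =
      1 / 2 * R.boundaryIntegral (fun y => φ y 0) (fun y => (φ y 1 - c 1) ^ 2) := by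
  have h1 := h.tendsto_polySum (f := fun x => x 1 - c 1) (by fun_prop)
    (E := fun x y => 1 / 2 * ((x 0 + y 0) / 2 * ((y 1 - c 1) ^ 2 - (x 1 - c 1) ^ 2) +
      (y 0 - x 0) * (y 1 - x 1) ^ 2 / 6)) (fun x y => by ring) (fun p m q => by
      have := integral_triIndex_mul p m q (-c 1) 0 1
      simp only [zero_mul, add_zero, one_mul] at this
      simp_rw [sub_eq_neg_add (_ : ℝ) (c 1)]
      rw [this]
      simp only [cross, PiLp.sub_apply]
      ring)
  refine tendsto_nhds_unique h1 ?_
  have h2 := (h.tendsto_boundaryIntegral (E := fun x y => (x 0 + y 0) / 2 * ((y 1 - c 1) ^ 2 -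
      (x 1 - c 1) ^ 2) + (y 0 - x 0) * (y 1 - x 1) ^ 2 / 6) (K := r)
    (F := fun x => x 0)
    (G := fun x => (x 1 - c 1) ^ 2) (fun x hx y hy => ?_)
    h.boundaryIntegrable_sq_right).const_mul (1 / 2)
  · refine h2.congr fun N => ?_
    simp only [polySum, edgeSum, Finset.mul_sum]
  · have hx' := (abs_coord_sub_le _ _ 1).trans hx
    have hr := h.radius_nonneg
    have hy' := (abs_coord_sub_le _ _ 1).trans hy
    have h4 : |((x 1 - c 1) + 2 * (y 1 - c 1)) / 3| ≤ r := by
      rw [abs_le] at *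
      constructor <;> linarith [hx'.1, hx'.2, hy'.1, hy'.2]
    rw [show (x 0 + y 0) / 2 * ((y 1 - c 1) ^ 2 - (x 1 - c 1) ^ 2) +
        (y 0 - x 0) * (y 1 - x 1) ^ 2 / 6 - x 0 * ((y 1 - c 1) ^ 2 - (x 1 - c 1) ^ 2) =
        ((x 1 - c 1) + 2 * (y 1 - c 1)) / 3 * ((x 0 - y 0) * (x 1 - y 1)) by ring,
      abs_mul, abs_mul, sq]
    have := abs_coord_sub_le x y 0
    have := abs_coord_sub_le x y 1
    gcongr

end Square

/-! ### The geometry of squares -/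

lemma norm_sq_plane (a : Plane) : ‖a‖ ^ 2 = a 0 ^ 2 + a 1 ^ 2 := by
  rw [EuclideanSpace.real_norm_sq_eq, Fin.sum_univ_two]

lemma cross_rot (e : Plane) : cross e (rot e) = ‖e‖ ^ 2 := by
  rw [norm_sq_plane]; simp [cross, rot]; ring

lemma norm_rot (e : Plane) : ‖rot e‖ = ‖e‖ := by
  rw [← sq_eq_sq₀ (norm_nonneg _) (norm_nonneg _), norm_sq_plane, norm_sq_plane]
  simp [rot]; ring

namespace Square

lemma param_eq (R : Square) (u v : ℝ) :
    R.param u v = R.corner + (u • R.edge + v • rot R.edge) := by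
  rw [param, add_assoc]

lemma edge_norm_sq_ne_zero (R : Square) : R.edge 0 ^ 2 + R.edge 1 ^ 2 ≠ 0 := by
  rw [← norm_sq_plane]
  exact pow_ne_zero 2 (norm_ne_zero_iff.2 R.edge_ne_zero)

/-- The standard parametrization as a homeomorphism of the whole plane. -/
def paramHomeomorph (R : Square) : ℝ × ℝ ≃ₜ Plane where
  toFun z := R.param z.1 z.2
  invFun y := (((y 0 - R.corner 0) * R.edge 0 + (y 1 - R.corner 1) * R.edge 1) /
      (R.edge 0 ^ 2 + R.edge 1 ^ 2),
    ((y 1 - R.corner 1) * R.edge 0 - (y 0 - R.corner 0) * R.edge 1) /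
      (R.edge 0 ^ 2 + R.edge 1 ^ 2))
  left_inv z := by
    have h := R.edge_norm_sq_ne_zero
    ext
    · simp only [param, rot, PiLp.add_apply, PiLp.smul_apply, smul_eq_mul, Matrix.cons_val_zero,
        Matrix.cons_val_one]
      field_simp; ring
    · simp only [param, rot, PiLp.add_apply, PiLp.smul_apply, smul_eq_mul, Matrix.cons_val_zero,
        Matrix.cons_val_one]
      field_simp; ring
  right_inv y := by
    have h := R.edge_norm_sq_ne_zero
    ext i
    fin_cases i
    · simp [param, rot]
      field_simp; ring
    · simp [param, rot]
      field_simp; ring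
  continuous_toFun := by
    simp only [param]
    fun_prop
  continuous_invFun := by fun_prop

lemma paramHomeomorph_apply (R : Square) (z : ℝ × ℝ) :
    R.paramHomeomorph z = R.param z.1 z.2 := rfl

lemma toSet_eq_image (R : Square) :
    R.toSet = R.paramHomeomorph '' (Icc (0 : ℝ) 1 ×ˢ Icc (0 : ℝ) 1) := by
  ext y
  constructor
  · rintro ⟨u, hu, v, hv, rfl⟩
    exact ⟨(u, v), ⟨hu, hv⟩, rfl⟩
  · rintro ⟨⟨u, v⟩, ⟨hu, hv⟩, rfl⟩
    exact ⟨u, hu, v, hv, rfl⟩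

lemma isCompact_toSet (R : Square) : IsCompact R.toSet := by
  rw [toSet_eq_image]
  exact (isCompact_Icc.prod isCompact_Icc).image R.paramHomeomorph.continuous

lemma param_mem_interior (R : Square) (z : ℝ × ℝ) :
    R.param z.1 z.2 ∈ interior R.toSet ↔ z ∈ Ioo (0 : ℝ) 1 ×ˢ Ioo (0 : ℝ) 1 := by
  rw [toSet_eq_image, ← Homeomorph.image_interior, interior_prod_eq, interior_Icc,
    ← paramHomeomorph_apply, R.paramHomeomorph.injective.mem_set_image]

lemma side_zero (R : Square) (t : ℝ) : R.side 0 t = R.param t 0 := by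
  simp only [side, vertex, AffineMap.lineMap_apply, param]
  ext i; fin_cases i <;> simp [rot] <;> ring

lemma side_one (R : Square) (t : ℝ) : R.side 1 t = R.param 1 t := by
  simp only [side, vertex, AffineMap.lineMap_apply, param]
  ext i; fin_cases i <;> simp [rot] <;> ring

lemma side_two (R : Square) (t : ℝ) : R.side 2 t = R.param (1 - t) 1 := by
  simp only [side, vertex, AffineMap.lineMap_apply, param]
  ext i; fin_cases i <;> simp [rot] <;> ring

lemma side_three (R : Square) (t : ℝ) : R.side 3 t = R.param 0 (1 - t) := by
  simp only [side, vertex, AffineMap.lineMap_apply, param]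
  ext i; fin_cases i <;> simp [rot] <;> ring

lemma frontier_toSet (R : Square) : frontier R.toSet = ⋃ k, R.side k '' Icc 0 1 := by
  rw [toSet_eq_image, ← Homeomorph.image_frontier, frontier_prod_eq, closure_Icc,
    frontier_Icc zero_le_one]
  ext y
  simp only [mem_iUnion, mem_image, mem_union, mem_prod]
  constructor
  · rintro ⟨⟨u, v⟩, (⟨hu, hv⟩ | ⟨hu, hv⟩), rfl⟩
    · rcases hv with (rfl : v = 0) | (rfl : v = 1)
      · exact ⟨0, u, hu, R.side_zero u⟩
      · exact ⟨2, 1 - u, ⟨by linarith [hu.2], by linarith [hu.1]⟩, by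
          rw [side_two, sub_sub_cancel]; rfl⟩
    · rcases hu with (rfl : u = 0) | (rfl : u = 1)
      · exact ⟨3, 1 - v, ⟨by linarith [hv.2], by linarith [hv.1]⟩, by
          rw [side_three, sub_sub_cancel]; rfl⟩
      · exact ⟨1, v, hv, R.side_one v⟩
  · rintro ⟨k, t, ht, rfl⟩
    have ht' : 1 - t ∈ Icc (0 : ℝ) 1 := ⟨by linarith [ht.2], by linarith [ht.1]⟩
    fin_cases k
    · exact ⟨(t, 0), Or.inl ⟨ht, Or.inl rfl⟩, (R.side_zero t).symm⟩
    · exact ⟨(1, t), Or.inr ⟨Or.inr rfl, ht⟩, (R.side_one t).symm⟩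
    · exact ⟨(1 - t, 1), Or.inl ⟨ht', Or.inr rfl⟩, (R.side_two t).symm⟩
    · exact ⟨(0, 1 - t), Or.inr ⟨Or.inl rfl, ht'⟩, (R.side_three t).symm⟩

lemma side_mem_frontier (R : Square) (k : Fin 4) {t : ℝ} (ht : t ∈ Icc (0 : ℝ) 1) :
    R.side k t ∈ frontier R.toSet := by
  rw [frontier_toSet]
  exact mem_iUnion.2 ⟨k, t, ht, rfl⟩

lemma frontier_subset (R : Square) : frontier R.toSet ⊆ R.toSet :=
  R.isCompact_toSet.isClosed.frontier_subset

lemma frontier_nonempty (R : Square) : (frontier R.toSet).Nonempty :=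
  ⟨_, R.side_mem_frontier 0 (t := 0) (by simp)⟩

lemma isCompact_frontier (R : Square) : IsCompact (frontier R.toSet) :=
  R.isCompact_toSet.of_isClosed_subset isClosed_frontier R.frontier_subset

/-- Integration over a square in its standard parametrization. -/
lemma setIntegral_interior (R : Square) {F : Plane → ℝ} (hF : Continuous F) :
    ∫ y in interior R.toSet, F y =
      ∫ u in (0 : ℝ)..1, ∫ v in (0 : ℝ)..1, ‖R.edge‖ ^ 2 * F (R.param u v) := by
  have hne : cross R.edge (rot R.edge) ≠ 0 := by
    rw [cross_rot]; exact pow_ne_zero 2 (norm_ne_zero_iff.2 R.edge_ne_zero)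
  rw [← integral_indicator isOpen_interior.measurableSet, integral_affine R.corner hne]
  have e : (fun z : ℝ × ℝ => (interior R.toSet).indicator F
      (R.corner + (z.1 • R.edge + z.2 • rot R.edge))) =
      (Ioo (0 : ℝ) 1 ×ˢ Ioo (0 : ℝ) 1).indicator fun z => F (R.param z.1 z.2) := by
    ext z
    rw [← param_eq]
    by_cases hz : z ∈ Ioo (0 : ℝ) 1 ×ˢ Ioo (0 : ℝ) 1
    · rw [indicator_of_mem hz, indicator_of_mem ((R.param_mem_interior z).2 hz)]
    · rw [indicator_of_notMem hz, indicator_of_notMem (mt (R.param_mem_interior z).1 hz)]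
  have hc : Continuous fun z : ℝ × ℝ => F (R.param z.1 z.2) :=
    hF.comp R.paramHomeomorph.continuous
  have hI : IntegrableOn (fun z : ℝ × ℝ => F (R.param z.1 z.2))
      (Ioc (0 : ℝ) 1 ×ˢ Ioc (0 : ℝ) 1) (volume.prod volume) :=
    (hc.continuousOn.integrableOn_compact (isCompact_Icc.prod isCompact_Icc)).mono_set
      (prod_mono Ioc_subset_Icc_self Ioc_subset_Icc_self)
  rw [e, integral_indicator (measurableSet_Ioo.prod measurableSet_Ioo),
    setIntegral_congr_set (t := Ioc (0 : ℝ) 1 ×ˢ Ioc (0 : ℝ) 1)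
      (by rw [Measure.volume_eq_prod]; exact Measure.set_prod_ae_eq Ioo_ae_eq_Ioc Ioo_ae_eq_Ioc),
    Measure.volume_eq_prod, setIntegral_prod _ hI, cross_rot, abs_of_nonneg (by positivity)]
  simp only [intervalIntegral.integral_of_le zero_le_one, integral_const_mul]

end Square

/-! ### Winding of smooth curves -/

lemma mem_slitPlane_div {z w : ℂ} (h : ‖z - w‖ < ‖w‖) : z / w ∈ Complex.slitPlane := by
  have hw : w ≠ 0 := by rintro rfl; simp at h; linarith [norm_nonneg z]
  have : ‖z / w - 1‖ < 1 := by
    rw [div_sub_one hw, norm_div, div_lt_one (norm_pos_iff.2 hw)]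
    exact h
  have h2 : z / w = 1 + (z / w - 1) := by ring
  rw [h2]
  exact Complex.mem_slitPlane_of_norm_lt_one this

lemma eventually_uniform {E : Type*} [PseudoMetricSpace E] {γ : ℝ → E}
    (hγ : ContinuousOn γ (Icc 0 1)) {m : ℝ} (hm : 0 < m) :
    ∀ᶠ N : ℕ in atTop, ∀ s ∈ Icc (0 : ℝ) 1, ∀ t ∈ Icc (0 : ℝ) 1, |s - t| ≤ (2 ^ N)⁻¹ →
      dist (γ s) (γ t) < m := by
  have hu := isCompact_Icc.uniformContinuousOn_of_continuous hγ
  obtain ⟨δ, hδ, H⟩ := Metric.uniformContinuousOn_iff.1 hu m hm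
  have hlim : Tendsto (fun N : ℕ => ((2 : ℝ) ^ N)⁻¹) atTop (𝓝 0) :=
    (tendsto_pow_atTop_atTop_of_one_lt one_lt_two).inv_tendsto_atTop
  filter_upwards [hlim.eventually (gt_mem_nhds hδ)] with N hN s hs t ht hst
  exact H s hs t ht (hst.trans_lt hN)

lemma dyadic_mem {N i : ℕ} (hi : i < 2 ^ N) :
    (i : ℝ) / 2 ^ N ∈ Icc (0 : ℝ) 1 ∧ ((i : ℝ) + 1) / 2 ^ N ∈ Icc (0 : ℝ) 1 := by
  have : (i : ℝ) + 1 ≤ 2 ^ N := by exact_mod_cast hi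
  refine ⟨⟨by positivity, ?_⟩, ⟨by positivity, ?_⟩⟩
  · rw [div_le_one (by positivity)]; linarith
  · rwa [div_le_one (by positivity)]

/-- The winding of a `C¹` curve is the sum of the angles between sufficiently many points. -/
lemma eventually_integral_eq_sum_arg {ζ ζ' : ℝ → ℂ} (hζ : ∀ t, HasDerivAt ζ (ζ' t) t)
    (hζ' : Continuous ζ') (h0 : ∀ t ∈ Icc (0 : ℝ) 1, ζ t ≠ 0) :
    ∀ᶠ N : ℕ in atTop, ∫ t in (0 : ℝ)..1, (ζ' t / ζ t).im =
      ∑ i ∈ Finset.range (2 ^ N), (ζ ((i + 1) / 2 ^ N) / ζ (i / 2 ^ N)).arg := by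
  have hc : Continuous ζ := continuous_iff_continuousAt.2 fun t => (hζ t).continuousAt
  obtain ⟨t₀, ht₀, hmin⟩ := isCompact_Icc.exists_isMinOn (nonempty_Icc.2 zero_le_one)
    (hc.norm.continuousOn (s := Icc (0 : ℝ) 1))
  filter_upwards [eventually_uniform hc.continuousOn (norm_pos_iff.2 (h0 t₀ ht₀))] with N hN
  have hint : ∀ s ∈ Icc (0 : ℝ) 1, ∀ t ∈ Icc (0 : ℝ) 1, s ≤ t →
      IntervalIntegrable (fun t => (ζ' t / ζ t).im) volume s t := by
    intro s hs t ht hst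
    apply ContinuousOn.intervalIntegrable
    rw [uIcc_of_le hst]
    exact Complex.continuous_im.comp_continuousOn (hζ'.continuousOn.div hc.continuousOn
      fun x hx => h0 x ⟨hs.1.trans hx.1, hx.2.trans ht.2⟩)
  have hle : ∀ i : ℕ, (i : ℝ) / 2 ^ N ≤ ((i : ℝ) + 1) / 2 ^ N := fun i => by gcongr; linarith
  have hsum := intervalIntegral.sum_integral_adjacent_intervals (μ := volume)
    (f := fun t => (ζ' t / ζ t).im) (a := fun i : ℕ => (i : ℝ) / 2 ^ N) (n := 2 ^ N) (by
      intro i hi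
      have := dyadic_mem hi
      push_cast
      exact hint _ this.1 _ this.2 (hle i))
  simp only [Nat.cast_zero, zero_div, Nat.cast_pow, Nat.cast_ofNat, Nat.cast_add, Nat.cast_one]
    at hsum
  rw [div_self (by positivity)] at hsum
  rw [← hsum]
  refine Finset.sum_congr rfl fun i hi => ?_
  have hi := Finset.mem_range.1 hi
  obtain ⟨ha, hb⟩ := dyadic_mem hi
  have hnz : ζ (i / 2 ^ N) ≠ 0 := h0 _ ha
  have hderiv : ∀ t ∈ uIcc ((i : ℝ) / 2 ^ N) ((i + 1) / 2 ^ N),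
      -- On a short piece `ζ` moves by less than its minimal modulus, so the quotient by the initial
      -- value stays in the slit plane. There the logarithm is a primitive, and its imaginary part
      -- at the end is the angle.
      HasDerivAt (fun t => (Complex.log (ζ t / ζ (i / 2 ^ N))).im) ((ζ' t / ζ t).im) t := by
    intro t ht
    rw [uIcc_of_le (hle i)] at ht
    have ht' : t ∈ Icc (0 : ℝ) 1 := ⟨ha.1.trans ht.1, ht.2.trans hb.2⟩
    have hsl : ζ t / ζ (i / 2 ^ N) ∈ Complex.slitPlane := by
      apply mem_slitPlane_div
      rw [← dist_eq_norm]
      refine (hN t ht' _ ha ?_).trans_le (hmin ha)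
      rw [abs_of_nonneg (by linarith [ht.1])]
      have := ht.2
      rw [add_div, one_div] at this
      linarith
    have h1 := ((hζ t).div_const (ζ (i / 2 ^ N))).clog_real hsl
    have h2 := Complex.imCLM.hasFDerivAt.comp_hasDerivAt t h1
    refine h2.congr_deriv ?_
    rw [div_div_div_cancel_right₀ hnz]
    rfl
  rw [intervalIntegral.integral_eq_sub_of_hasDerivAt hderiv (hint _ ha _ hb (hle i)),
    div_self hnz, Complex.log_one, Complex.log_im]
  simp

/-! ### The degree integral of a smooth map -/

/-- Green's formula for the form `Q(|z|²) (z₁ dz₂ - z₂ dz₁)` pulled back to the unit square. -/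
lemma green_radial {z w : ℝ × ℝ → ℝ} (hz : ContDiff ℝ 2 z) (hw : ContDiff ℝ 2 w)
    {Q Q' h : ℝ → ℝ} (hQ : ∀ s, HasDerivAt Q (Q' s) s) (hh : Continuous h)
    (hQh : ∀ s, 2 * (Q s + s * Q' s) = h s) :
    (∫ u in (0 : ℝ)..1, ∫ v in (0 : ℝ)..1, h (z (u, v) ^ 2 + w (u, v) ^ 2) *
      (fderiv ℝ z (u, v) (1, 0) * fderiv ℝ w (u, v) (0, 1) -
        fderiv ℝ w (u, v) (1, 0) * fderiv ℝ z (u, v) (0, 1))) =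
    (((∫ u in (0 : ℝ)..1, -(Q (z (u, 1) ^ 2 + w (u, 1) ^ 2) *
        (z (u, 1) * fderiv ℝ w (u, 1) (1, 0) - w (u, 1) * fderiv ℝ z (u, 1) (1, 0)))) -
      ∫ u in (0 : ℝ)..1, -(Q (z (u, 0) ^ 2 + w (u, 0) ^ 2) *
        (z (u, 0) * fderiv ℝ w (u, 0) (1, 0) - w (u, 0) * fderiv ℝ z (u, 0) (1, 0)))) +
      ∫ v in (0 : ℝ)..1, Q (z (1, v) ^ 2 + w (1, v) ^ 2) *
        (z (1, v) * fderiv ℝ w (1, v) (0, 1) - w (1, v) * fderiv ℝ z (1, v) (0, 1))) -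
      ∫ v in (0 : ℝ)..1, Q (z (0, v) ^ 2 + w (0, v) ^ 2) *
        (z (0, v) * fderiv ℝ w (0, v) (0, 1) - w (0, v) * fderiv ℝ z (0, v) (0, 1)) := by
  have hz1 : Differentiable ℝ z := hz.differentiable two_ne_zero
  have hw1 : Differentiable ℝ w := hw.differentiable two_ne_zero
  have hzd : ContDiff ℝ 1 (fderiv ℝ z) := hz.fderiv_right (by norm_num)
  have hwd : ContDiff ℝ 1 (fderiv ℝ w) := hw.fderiv_right (by norm_num)
  have hz2 : Differentiable ℝ (fderiv ℝ z) := hzd.differentiable one_ne_zero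
  have hw2 : Differentiable ℝ (fderiv ℝ w) := hwd.differentiable one_ne_zero
  have hzs : ∀ p a b, fderiv ℝ (fderiv ℝ z) p a b = fderiv ℝ (fderiv ℝ z) p b a := fun p =>
    hz.contDiffAt.isSymmSndFDerivAt (by simp)
  have hws : ∀ p a b, fderiv ℝ (fderiv ℝ w) p a b = fderiv ℝ (fderiv ℝ w) p b a := fun p =>
    hw.contDiffAt.isSymmSndFDerivAt (by simp)
  set S : ℝ × ℝ → ℝ := fun p => z p ^ 2 + w p ^ 2 with hS
  have hSd : ∀ p, HasFDerivAt S ((2 * z p) • fderiv ℝ z p + (2 * w p) • fderiv ℝ w p) p := by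
    intro p
    have h1 := ((hz1 p).hasFDerivAt.pow 2).add ((hw1 p).hasFDerivAt.pow 2)
    refine h1.congr_fderiv ?_
    simp
  have hQS : ∀ p, HasFDerivAt (fun p => Q (S p))
      (Q' (S p) • ((2 * z p) • fderiv ℝ z p + (2 * w p) • fderiv ℝ w p)) p :=
    fun p => (hQ (S p)).comp_hasFDerivAt p (hSd p)
  have hform : ∀ (a : ℝ × ℝ) (p : ℝ × ℝ),
      HasFDerivAt (fun p => Q (S p) * (z p * fderiv ℝ w p a - w p * fderiv ℝ z p a))
        (Q (S p) • ((z p • ((fderiv ℝ (fderiv ℝ w) p).flip a) + fderiv ℝ w p a • fderiv ℝ z p) -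
          (w p • ((fderiv ℝ (fderiv ℝ z) p).flip a) + fderiv ℝ z p a • fderiv ℝ w p)) +
        (z p * fderiv ℝ w p a - w p * fderiv ℝ z p a) •
          (Q' (S p) • ((2 * z p) • fderiv ℝ z p + (2 * w p) • fderiv ℝ w p))) p := by
    intro a p
    have e1 : HasFDerivAt (fun p => fderiv ℝ w p a) ((fderiv ℝ (fderiv ℝ w) p).flip a) p := by
      have := (hw2 p).hasFDerivAt.clm_apply (hasFDerivAt_const a p)
      refine this.congr_fderiv ?_
      simp
    have e2 : HasFDerivAt (fun p => fderiv ℝ z p a) ((fderiv ℝ (fderiv ℝ z) p).flip a) p := by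
      have := (hz2 p).hasFDerivAt.clm_apply (hasFDerivAt_const a p)
      refine this.congr_fderiv ?_
      simp
    exact (hQS p).mul (((hz1 p).hasFDerivAt.mul e1).sub ((hw1 p).hasFDerivAt.mul e2))
  have hcont : ∀ a : ℝ × ℝ, Continuous fun p =>
      Q (S p) * (z p * fderiv ℝ w p a - w p * fderiv ℝ z p a) := fun a =>
    continuous_iff_continuousAt.2 fun p => (hform a p).continuousAt
  -- In the exterior derivative the second derivatives of `z` and `w` cancel by symmetry; the rest
  -- is `2 (Q + s Q') dz ∧ dw`.
  have hdiv : ∀ p : ℝ × ℝ,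
      (Q (S p) • ((z p • ((fderiv ℝ (fderiv ℝ w) p).flip (0, 1)) +
          fderiv ℝ w p (0, 1) • fderiv ℝ z p) -
          (w p • ((fderiv ℝ (fderiv ℝ z) p).flip (0, 1)) + fderiv ℝ z p (0, 1) • fderiv ℝ w p)) +
        (z p * fderiv ℝ w p (0, 1) - w p * fderiv ℝ z p (0, 1)) •
          (Q' (S p) • ((2 * z p) • fderiv ℝ z p + (2 * w p) • fderiv ℝ w p))) (1, 0) +
      (-(Q (S p) • ((z p • ((fderiv ℝ (fderiv ℝ w) p).flip (1, 0)) +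
          fderiv ℝ w p (1, 0) • fderiv ℝ z p) -
          (w p • ((fderiv ℝ (fderiv ℝ z) p).flip (1, 0)) + fderiv ℝ z p (1, 0) • fderiv ℝ w p)) +
        (z p * fderiv ℝ w p (1, 0) - w p * fderiv ℝ z p (1, 0)) •
          (Q' (S p) • ((2 * z p) • fderiv ℝ z p + (2 * w p) • fderiv ℝ w p)))) (0, 1) =
      h (S p) * (fderiv ℝ z p (1, 0) * fderiv ℝ w p (0, 1) -
        fderiv ℝ w p (1, 0) * fderiv ℝ z p (0, 1)) := by
    intro p
    rw [← hQh]
    simp only [add_apply, neg_apply, sub_apply, smul_apply,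
      ContinuousLinearMap.flip_apply, smul_eq_mul]
    rw [hzs p (0, 1) (1, 0), hws p (0, 1) (1, 0)]
    simp only [hS]
    ring
  have hcdiv : Continuous fun p => h (S p) * (fderiv ℝ z p (1, 0) * fderiv ℝ w p (0, 1) -
      fderiv ℝ w p (1, 0) * fderiv ℝ z p (0, 1)) := by
    have := hzd.continuous
    have := hwd.continuous
    have := hz.continuous
    have := hw.continuous
    fun_prop
  -- The divergence theorem for the field `(ω_v, -ω_u)` made from the coefficients of the 1-form
  -- `ω_u du + ω_v dv`.
  have key := integral2_divergence_prod_of_hasFDerivAt_off_countable _ _ _ _ 0 0 1 1 ∅ countable_empty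
    (hcont (0, 1)).continuousOn (hcont (1, 0)).neg.continuousOn (fun p _ => hform (0, 1) p)
    (fun p _ => (hform (1, 0) p).neg) (by
      simp only [hdiv]
      exact hcdiv.continuousOn.integrableOn_compact (isCompact_uIcc.prod isCompact_uIcc))
  simp only [hdiv] at key
  exact key

/-- A radial weight of mass one is the exterior derivative of a form that is the angular form
outside its support. -/
lemma exists_radial_primitive {ψ : ℝ → ℝ} {a b : ℝ} (hψ : Continuous ψ) (ha : 0 < a)
    (hsupp : ∀ r, r ∉ Icc a b → ψ r = 0) (hmass : (∫ z : Plane, ψ ‖z‖) = 1) :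
    ∃ Q Q' : ℝ → ℝ, (∀ s, HasDerivAt Q (Q' s) s) ∧
      (∀ s, 2 * (Q s + s * Q' s) = ψ (Real.sqrt s)) ∧
      ∀ s, b ≤ Real.sqrt s → Q s = 1 / (2 * Real.pi) / s := by
  set P : ℝ → ℝ := fun ρ => ∫ r in (0 : ℝ)..ρ, r * ψ r with hP
  have hc : Continuous fun r => r * ψ r := continuous_id.mul hψ
  have hPd : ∀ ρ, HasDerivAt P (ρ * ψ ρ) ρ := fun ρ =>
    intervalIntegral.integral_hasDerivAt_right (hc.intervalIntegrable _ _)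
      (hc.stronglyMeasurableAtFilter _ _) hc.continuousAt
  have hP0 : ∀ ρ, 0 ≤ ρ → ρ < a → P ρ = 0 := by
    intro ρ h0 h1
    have : ∀ r ∈ uIcc 0 ρ, r * ψ r = 0 := by
      intro r hr
      rw [uIcc_of_le h0] at hr
      rw [hsupp r fun h => by linarith [h.1, hr.2], mul_zero]
    rw [hP]
    simp only
    rw [intervalIntegral.integral_congr (g := fun _ => 0) this]
    simp
  have hPb : ∀ ρ, 0 ≤ ρ → b ≤ ρ → P ρ = 1 / (2 * Real.pi) := by
    intro ρ h0 h1
    -- In polar coordinates the mass condition says that `2π` times the integral of `r ψ(r)` over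
    -- `(0, ∞)` is one; beyond `b` the primitive `P` has exhausted this integral.
    have hnorm := integral_fun_norm_addHaar (volume : Measure Plane) ψ
    rw [hmass] at hnorm
    have hball : volume.real (Metric.ball (0 : Plane) 1) = Real.pi := by
      rw [measureReal_def, InnerProductSpace.volume_ball_of_dim_even (k := 1) (by simp)]
      simp [Real.pi_pos.le]
    rw [hball] at hnorm
    simp only [finrank_euclideanSpace, Fintype.card_fin, nsmul_eq_mul, smul_eq_mul] at hnorm
    have e : ∫ y in Ioi (0 : ℝ), y ^ (2 - 1) * ψ y = P ρ := by
      rw [hP]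
      simp only
      rw [intervalIntegral.integral_of_le h0]
      simp only [show 2 - 1 = 1 by norm_num, pow_one]
      refine setIntegral_eq_of_subset_of_forall_sdiff_eq_zero measurableSet_Ioi
        (fun r hr => hr.1) fun r hr => ?_
      have hr2 : ρ < r := by
        by_contra hcon
        exact hr.2 ⟨hr.1, not_lt.1 hcon⟩
      rw [hsupp r fun h => by linarith [h.2], mul_zero]
    rw [e] at hnorm
    have := Real.pi_pos
    field_simp
    push_cast at hnorm
    linarith
  have hψ0 : ∀ s, s < a ^ 2 → ψ (Real.sqrt s) = 0 ∧ P (Real.sqrt s) = 0 := by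
    intro s hs
    have : Real.sqrt s < a := by rwa [Real.sqrt_lt' ha]
    exact ⟨hsupp _ fun h => by linarith [h.1], hP0 _ (Real.sqrt_nonneg _) this⟩
  have hH : ∀ s, HasDerivAt (fun s => P (Real.sqrt s)) (ψ (Real.sqrt s) / 2) s := by
    intro s
    rcases lt_or_ge s (a ^ 2) with hs | hs
    · rw [(hψ0 s hs).1, zero_div]
      refine (hasDerivAt_const s (0 : ℝ)).congr_of_eventuallyEq ?_
      filter_upwards [gt_mem_nhds hs] with t ht using (hψ0 t ht).2
    · have hspos : 0 < s := lt_of_lt_of_le (by positivity) hs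
      have h1 := (hPd (Real.sqrt s)).comp s (Real.hasDerivAt_sqrt hspos.ne')
      refine h1.congr_deriv ?_
      have := Real.sqrt_pos.2 hspos
      field_simp
  -- The equation `2 (s Q)' = ψ(√s)` is solved by `s Q = P(√s)`. As `P(√s)` vanishes for `s < a ^
  -- 2`, the division by `s` does no harm at `0`, nor do the conventional values of the square root
  -- for negative `s`.
  refine ⟨fun s => P (Real.sqrt s) / s,
    fun s => (ψ (Real.sqrt s) / 2 * s - P (Real.sqrt s)) / s ^ 2, fun s => ?_, fun s => ?_,
    fun s hs => ?_⟩
  · rcases eq_or_ne s 0 with rfl | hs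
    · simp only [(hψ0 0 (by positivity)).2, mul_zero, sub_zero, zero_div]
      refine (hasDerivAt_const (0 : ℝ) (0 : ℝ)).congr_of_eventuallyEq ?_
      filter_upwards [gt_mem_nhds (show (0 : ℝ) < a ^ 2 by positivity)] with t ht
      rw [(hψ0 t ht).2, zero_div]
    · have := (hH s).div (hasDerivAt_id s) hs
      refine this.congr_deriv ?_
      simp
  · rcases eq_or_ne s 0 with rfl | hs
    · rw [(hψ0 0 (by positivity)).1]; simp
    · field_simp; ring
  · simp only
    rw [hPb _ (Real.sqrt_nonneg _) hs]

/-- The identification of the plane with the complex numbers as a continuous linear map. -/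
def toComplexL : Plane →L[ℝ] ℂ :=
  LinearMap.toContinuousLinearMap
    { toFun := toComplex
      map_add' := fun x y => by apply Complex.ext <;> simp
      map_smul' := fun a x => by apply Complex.ext <;> simp }

lemma cross_map (L : Plane →L[ℝ] Plane) (a b : Plane) : cross (L a) (L b) = L.det * cross a b := by
  have h : ∀ v : Plane, v = v 0 • EuclideanSpace.single 0 1 + v 1 • EuclideanSpace.single 1 1 := by
    intro v
    ext i; fin_cases i <;> simp
  have hd : L.det = _ := linearMap_det L.toLinearMap
  have ha : L a = a 0 • L (EuclideanSpace.single 0 1) + a 1 • L (EuclideanSpace.single 1 1) := by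
    conv_lhs => rw [h a]
    simp
  have hb : L b = b 0 • L (EuclideanSpace.single 0 1) + b 1 • L (EuclideanSpace.single 1 1) := by
    conv_lhs => rw [h b]
    simp
  rw [hd, ha, hb]
  simp [cross]
  ring

/-- The integral that defines the degree of a smooth map on a square is the winding number of a
sufficiently fine polygon inscribed in the image of the boundary. -/
theorem eventually_degree_integral_eq_polyIndex (R : Square) {g : Plane → Plane}
    (hg : ContDiff ℝ ∞ g) {ψ : ℝ → ℝ} {a b : ℝ} {x : Plane} (hψ : Continuous ψ) (ha : 0 < a)
    (hb : b < Metric.infDist x (g '' frontier R.toSet)) (hsupp : ∀ r, r ∉ Icc a b → ψ r = 0)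
    (hmass : (∫ z : Plane, ψ ‖z‖) = 1) (hx : x ∉ g '' frontier R.toSet) :
    ∀ᶠ N in atTop,
      (∫ y in interior R.toSet, ψ ‖g y - x‖ * (fderiv ℝ g y).det) = R.polyIndex g N x := by
  obtain ⟨Q, Q', hQ, hQψ, hQb⟩ := exists_radial_primitive hψ ha hsupp hmass
  have hgd : Differentiable ℝ g := hg.differentiable (by simp)
  have hgc : Continuous (fderiv ℝ g) := hg.continuous_fderiv (by simp)
  -- the two coordinates in the standard parametrization
  set p : ℝ × ℝ → Plane := fun z => R.param z.1 z.2 with hp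
  have hps : ContDiff ℝ 2 p := by
    rw [hp]; simp only [Square.param]
    fun_prop
  have hpd : ∀ z, HasFDerivAt p ((ContinuousLinearMap.fst ℝ ℝ ℝ).smulRight R.edge +
      (ContinuousLinearMap.snd ℝ ℝ ℝ).smulRight (rot R.edge)) z := by
    intro z
    have h1 := (((ContinuousLinearMap.fst ℝ ℝ ℝ).smulRight R.edge +
      (ContinuousLinearMap.snd ℝ ℝ ℝ).smulRight (rot R.edge)).hasFDerivAt (x := z)).const_add
        R.corner
    refine h1.congr_of_eventuallyEq (Eventually.of_forall fun y => ?_)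
    simp [hp, Square.param_eq]
  set Z : Fin 2 → ℝ × ℝ → ℝ := fun i z => (g (p z) - x) i with hZ
  have hg2 : ContDiff ℝ 2 g := contDiff_infty.1 hg 2
  have hZs : ∀ i, ContDiff ℝ 2 (Z i) := by
    intro i
    exact (EuclideanSpace.proj (𝕜 := ℝ) i).contDiff.comp ((hg2.comp hps).sub contDiff_const)
  have hZd : ∀ i z h, fderiv ℝ (Z i) z h =
      (fderiv ℝ g (p z) (h.1 • R.edge + h.2 • rot R.edge)) i := by
    intro i z h
    have h1 := (EuclideanSpace.proj (𝕜 := ℝ) i).hasFDerivAt.comp z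
      (((hgd (p z)).hasFDerivAt.comp z (hpd z)).sub_const x)
    have h2 : fderiv ℝ (Z i) z = _ := HasFDerivAt.fderiv h1
    rw [h2]
    rfl
  have hnorm : ∀ z, Real.sqrt (Z 0 z ^ 2 + Z 1 z ^ 2) = ‖g (p z) - x‖ := by
    intro z
    rw [← Real.sqrt_sq (norm_nonneg (g (p z) - x)), norm_sq_plane]
  have hgreen := green_radial (hZs 0) (hZs 1) hQ (hψ.comp Real.continuous_sqrt) hQψ
  have hleft : (∫ y in interior R.toSet, ψ ‖g y - x‖ * (fderiv ℝ g y).det) =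
      ∫ u in (0 : ℝ)..1, ∫ v in (0 : ℝ)..1, (ψ ∘ Real.sqrt) (Z 0 (u, v) ^ 2 + Z 1 (u, v) ^ 2) *
      (fderiv ℝ (Z 0) (u, v) (1, 0) * fderiv ℝ (Z 1) (u, v) (0, 1) -
        fderiv ℝ (Z 1) (u, v) (1, 0) * fderiv ℝ (Z 0) (u, v) (0, 1)) := by
    rw [R.setIntegral_interior (by
      have hgcont := hg.continuous
      have hdet : Continuous fun y => (fderiv ℝ g y).det := by
        have : (fun y => (fderiv ℝ g y).det) = fun y =>
            cross (fderiv ℝ g y (EuclideanSpace.single 0 1))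
              (fderiv ℝ g y (EuclideanSpace.single 1 1)) := by
          ext y
          exact linearMap_det _
        rw [this]
        simp only [cross]
        fun_prop
      fun_prop)]
    congr 1; ext u; congr 1; ext v
    rw [Function.comp_apply, hnorm, hZd, hZd, hZd, hZd]
    have h1 := cross_map (fderiv ℝ g (p (u, v))) R.edge (rot R.edge)
    rw [cross_rot] at h1
    simp only [cross] at h1
    simp only [one_smul, zero_smul, add_zero, zero_add]
    rw [h1]
    ring
  -- the boundary terms
  set G : Plane → Plane → ℝ := fun y e => Q (‖g y - x‖ ^ 2) * cross (g y - x) (fderiv ℝ g y e)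
    with hG
  have hGZ : ∀ z h, Q (Z 0 z ^ 2 + Z 1 z ^ 2) *
      (Z 0 z * fderiv ℝ (Z 1) z h - Z 1 z * fderiv ℝ (Z 0) z h) =
      G (p z) (h.1 • R.edge + h.2 • rot R.edge) := by
    intro z h
    simp only [hZd, hG]
    rw [norm_sq_plane]
    rfl
  simp only [hGZ, one_smul, zero_smul, add_zero, zero_add] at hgreen
  have hGneg : ∀ y e, G y (-e) = -G y e := by
    intro y e
    simp only [hG, map_neg, cross, PiLp.neg_apply]
    ring
  set dir : Fin 4 → Plane := fun k => R.vertex (k + 1) - R.vertex k with hdir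
  have hd0 : dir 0 = R.edge := by
    simp [hdir, Square.vertex, Square.param]
  have hd1 : dir 1 = rot R.edge := by
    simp [hdir, Square.vertex, Square.param]
  have hd2 : dir 2 = -R.edge := by
    simp [hdir, Square.vertex, Square.param]
  have hd3 : dir 3 = -rot R.edge := by
    simp [hdir, Square.vertex, Square.param]
  have hsum : (∫ y in interior R.toSet, ψ ‖g y - x‖ * (fderiv ℝ g y).det) =
      ∑ k : Fin 4, ∫ t in (0 : ℝ)..1, G (R.side k t) (dir k) := by
    rw [hleft]
    refine hgreen.trans ?_
    rw [Fin.sum_univ_four, hd0, hd1, hd2, hd3]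
    simp only [R.side_zero, R.side_one, R.side_two, R.side_three, hGneg,
      intervalIntegral.integral_neg]
    rw [intervalIntegral.integral_comp_sub_left (fun t => G (R.param t 1) R.edge),
      intervalIntegral.integral_comp_sub_left (fun t => G (R.param 0 t) (rot R.edge))]
    simp only [sub_self, sub_zero, hp]
    ring
  -- On the boundary `‖g - x‖` exceeds `b`, so the form is already the angular form divided by `2π`.
  have hwind : ∀ k, ∫ t in (0 : ℝ)..1, G (R.side k t) (dir k) =
      1 / (2 * Real.pi) * ∫ t in (0 : ℝ)..1, (toComplex (fderiv ℝ g (R.side k t) (dir k)) /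
        toComplex (g (R.side k t) - x)).im := by
    intro k
    rw [← intervalIntegral.integral_const_mul]
    refine intervalIntegral.integral_congr fun t ht => ?_
    rw [uIcc_of_le zero_le_one] at ht
    have hbt : b ≤ ‖g (R.side k t) - x‖ := by
      rw [← dist_eq_norm, dist_comm]
      exact hb.le.trans (Metric.infDist_le_dist_of_mem
        (mem_image_of_mem g (R.side_mem_frontier k ht)))
    rw [div_toComplex_im, hG]
    simp only
    rw [hQb _ (by rwa [Real.sqrt_sq (norm_nonneg _)])]
    ring
  have hcurve : ∀ k, ∀ᶠ N in atTop, ∫ t in (0 : ℝ)..1,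
      (toComplex (fderiv ℝ g (R.side k t) (dir k)) / toComplex (g (R.side k t) - x)).im =
      edgeSum (angleAt x) g N (R.vertex k) (R.vertex (k + 1)) := by
    intro k
    have hside : ∀ t, HasDerivAt (R.side k) (dir k) t := fun t => AffineMap.hasDerivAt_lineMap
    have hsc : Continuous (R.side k) :=
      continuous_iff_continuousAt.2 fun t => (hside t).continuousAt
    exact eventually_integral_eq_sum_arg (ζ := fun t => toComplex (g (R.side k t) - x))
      (fun t => toComplexL.hasFDerivAt.comp_hasDerivAt t
        (((hgd (R.side k t)).hasFDerivAt.comp_hasDerivAt t (hside t)).sub_const x))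
      (toComplexL.continuous.comp ((hgc.comp hsc).clm_apply continuous_const))
      (fun t ht h0 => hx ⟨_, R.side_mem_frontier k ht, sub_eq_zero.1 (toComplex_eq_zero.1 h0)⟩)
  filter_upwards [eventually_all.2 hcurve] with N hN
  rw [hsum, Square.polyIndex, Square.polySum, Finset.sum_div]
  refine Finset.sum_congr rfl fun k _ => ?_
  rw [hwind, hN]
  ring

/-! ### The mapping degree is the winding number -/

lemma abs_arg_div_lt {z w : ℂ} (h : ‖z - w‖ < ‖w‖) : |(z / w).arg| < Real.pi / 2 := by
  have hw : w ≠ 0 := by rintro rfl; simp at h; linarith [norm_nonneg z]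
  rw [Complex.abs_arg_lt_pi_div_two_iff]
  left
  have h1 : ‖z / w - 1‖ < 1 := by
    rw [div_sub_one hw, norm_div, div_lt_one (norm_pos_iff.2 hw)]
    exact h
  have h2 := (abs_lt.1 ((Complex.abs_re_le_norm _).trans_lt h1)).1
  simp at h2
  linarith

lemma abs_angleAt_lt_of_dist_lt {x p q : Plane} (h : dist q p < dist p x) :
    |angleAt x p q| < Real.pi / 2 := by
  apply abs_arg_div_lt
  rw [← toComplex_sub, norm_toComplex, norm_toComplex, sub_sub_sub_cancel_right, ← dist_eq_norm,
    ← dist_eq_norm]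
  exact h

lemma eq_of_coe_angle_eq {s t : ℝ} (h : (s : Real.Angle) = t) (hst : |s - t| < 2 * Real.pi) :
    s = t := by
  obtain ⟨k, hk⟩ := Real.Angle.angle_eq_iff_two_pi_dvd_sub.1 h
  rw [hk, abs_mul, abs_of_pos Real.two_pi_pos] at hst
  have h1 : |(k : ℝ)| < 1 := by
    by_contra hcon
    rw [not_lt] at hcon
    nlinarith [Real.pi_pos]
  have h2 : k = 0 := by
    rw [← Int.cast_abs] at h1
    have : |k| < 1 := by exact_mod_cast h1
    exact Int.abs_lt_one_iff.1 this
  rw [h2] at hk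
  simpa [sub_eq_zero] using hk

/-- The change of an angle if its end points are moved. -/
lemma angleAt_move {x p q p' q' : Plane} (hpq : dist q p < dist p x)
    (hpq' : dist q' p' < dist p' x) (hp : dist p' p < dist p x) (hq : dist q' q < dist q x) :
    angleAt x p' q' = angleAt x p q + (angleAt x q q' - angleAt x p p') := by
  have npx : p ≠ x := by rintro rfl; simp at hpq; linarith [dist_nonneg (x := q) (y := p)]
  have nqx : q ≠ x := by rintro rfl; simp at hq; linarith [dist_nonneg (x := q') (y := q)]
  have npx' : p' ≠ x := by rintro rfl; simp at hpq'; linarith [dist_nonneg (x := q') (y := p')]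
  have nqx' : q' ≠ x := by rintro rfl; rw [dist_comm] at hq; exact lt_irrefl _ hq
  have h1 := abs_lt.1 (abs_angleAt_lt_of_dist_lt hpq)
  have h2 := abs_lt.1 (abs_angleAt_lt_of_dist_lt hpq')
  have h3 := abs_lt.1 (abs_angleAt_lt_of_dist_lt hp)
  have h4 := abs_lt.1 (abs_angleAt_lt_of_dist_lt hq)
  apply eq_of_coe_angle_eq
  · rw [Real.Angle.coe_add, Real.Angle.coe_sub, angleAt_coe npx nqx, angleAt_coe npx' nqx',
      angleAt_coe nqx nqx', angleAt_coe npx npx']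
    abel
  -- Four angles, each smaller than `π / 2`: the two sides agree modulo `2π` and differ by less than
  -- `2π`.
  · rw [abs_lt]
    constructor <;> linarith [h1.1, h1.2, h2.1, h2.2, h3.1, h3.2, h4.1, h4.2]

namespace Square

variable (R : Square)

lemma continuous_side (k : Fin 4) : Continuous (R.side k) :=
  AffineMap.lineMap_continuous

lemma continuousOn_side {φ : Plane → Plane} (hφ : ContinuousOn φ R.toSet) (k : Fin 4) :
    ContinuousOn (fun t => φ (R.side k t)) (Icc 0 1) :=
  hφ.comp (R.continuous_side k).continuousOn
    fun _ ht => R.frontier_subset (R.side_mem_frontier k ht)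

lemma side_zero_eq (k : Fin 4) : R.side k 0 = R.vertex k := AffineMap.lineMap_apply_zero _ _

lemma side_one_eq (k : Fin 4) : R.side k 1 = R.vertex (k + 1) := AffineMap.lineMap_apply_one _ _

lemma isCompact_image_frontier {φ : Plane → Plane} (hφ : ContinuousOn φ R.toSet) :
    IsCompact (φ '' frontier R.toSet) :=
  R.isCompact_frontier.image_of_continuousOn (hφ.mono R.frontier_subset)

lemma infDist_pos {φ : Plane → Plane} (hφ : ContinuousOn φ R.toSet) {x : Plane}
    (hx : x ∉ φ '' frontier R.toSet) : 0 < Metric.infDist x (φ '' frontier R.toSet) :=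
  ((R.isCompact_image_frontier hφ).isClosed.notMem_iff_infDist_pos
    (R.frontier_nonempty.image φ)).1 hx

lemma eventually_dist_node_lt {φ : Plane → Plane} (hφ : ContinuousOn φ R.toSet) {x : Plane}
    (hx : x ∉ φ '' frontier R.toSet) :
    ∀ᶠ N : ℕ in atTop, ∀ (k : Fin 4), ∀ i : ℕ, i < 2 ^ N →
      dist (φ (R.side k ((i + 1) / 2 ^ N))) (φ (R.side k (i / 2 ^ N))) <
        dist (φ (R.side k (i / 2 ^ N))) x := by
  refine eventually_all.2 fun k => ?_
  filter_upwards [eventually_uniform (R.continuousOn_side hφ k) (R.infDist_pos hφ hx)] with N hN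
    i hi
  obtain ⟨ha, hb⟩ := dyadic_mem hi
  refine (hN _ hb _ ha ?_).trans_le ?_
  · rw [← sub_div, add_sub_cancel_left, one_div, abs_of_nonneg (by positivity)]
  · rw [dist_comm _ x]
    exact Metric.infDist_le_dist_of_mem (mem_image_of_mem φ (R.side_mem_frontier k ha))

/-- The winding number does not change under perturbations that are smaller than the distance. -/
lemma eventually_polyIndex_eq {φ g : Plane → Plane} (hφ : ContinuousOn φ R.toSet)
    (hg : ContinuousOn g R.toSet) {x : Plane}
    (h : ∀ y ∈ frontier R.toSet, dist (g y) (φ y) < dist (φ y) x) :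
    ∀ᶠ N in atTop, R.polyIndex g N x = R.polyIndex φ N x := by
  have hx : x ∉ φ '' frontier R.toSet := by
    rintro ⟨y, hy, rfl⟩
    have := h y hy
    rw [dist_self] at this
    linarith [dist_nonneg (x := g y) (y := φ y)]
  have hx' : x ∉ g '' frontier R.toSet := by
    rintro ⟨y, hy, rfl⟩
    have := h y hy
    rw [dist_comm] at this
    exact lt_irrefl _ this
  filter_upwards [R.eventually_dist_node_lt hφ hx, R.eventually_dist_node_lt hg hx'] with N h1 h2
  -- The correction on each edge is an increment of the angle between `φ` and `g` as seen from `x`.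
  -- It telescopes along a side, and the values at the corners cancel around the square.
  have hedge : ∀ k, edgeSum (angleAt x) g N (R.vertex k) (R.vertex (k + 1)) =
      edgeSum (angleAt x) φ N (R.vertex k) (R.vertex (k + 1)) +
        (angleAt x (φ (R.vertex (k + 1))) (g (R.vertex (k + 1))) -
          angleAt x (φ (R.vertex k)) (g (R.vertex k))) := by
    intro k
    have htel := Finset.sum_range_sub (fun i : ℕ => angleAt x (φ (R.side k (i / 2 ^ N)))
      (g (R.side k (i / 2 ^ N)))) (2 ^ N)
    simp only [Nat.cast_zero, zero_div, Nat.cast_pow, Nat.cast_ofNat, Nat.cast_add, Nat.cast_one]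
      at htel
    rw [div_self (by positivity), side_zero_eq, side_one_eq] at htel
    rw [← htel, edgeSum, edgeSum, ← Finset.sum_add_distrib]
    refine Finset.sum_congr rfl fun i hi => ?_
    have hi := Finset.mem_range.1 hi
    obtain ⟨ha, hb⟩ := dyadic_mem hi
    exact angleAt_move (h1 k i hi) (h2 k i hi) (h _ (R.side_mem_frontier k ha))
      (h _ (R.side_mem_frontier k hb))
  rw [polyIndex, polyIndex, polySum, polySum]
  congr 1
  simp only [hedge, Fin.sum_univ_four, show (1 : Fin 4) + 1 = 2 by decide,
    show (2 : Fin 4) + 1 = 3 by decide, show (3 : Fin 4) + 1 = 0 by decide, zero_add]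
  ring

/-- The winding number of a closed polygon is an integer. -/
lemma exists_int_polyIndex {φ : Plane → Plane} {x : Plane} (hx : x ∉ φ '' frontier R.toSet)
    (N : ℕ) : ∃ d : ℤ, R.polyIndex φ N x = d := by
  have hne : ∀ (k : Fin 4), ∀ t ∈ Icc (0 : ℝ) 1, φ (R.side k t) ≠ x := fun k t ht e =>
    hx ⟨_, R.side_mem_frontier k ht, e⟩
  -- Modulo `2π` each angle is a difference of arguments, so the sum along a side telescopes.
  have hedge : ∀ k, ((edgeSum (angleAt x) φ N (R.vertex k) (R.vertex (k + 1)) : ℝ) : Real.Angle) =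
      (toComplex (φ (R.vertex (k + 1)) - x)).arg - (toComplex (φ (R.vertex k) - x)).arg := by
    intro k
    have htel := Finset.sum_range_sub (fun i : ℕ =>
      (((toComplex (φ (R.side k (i / 2 ^ N)) - x)).arg : ℝ) : Real.Angle)) (2 ^ N)
    simp only [Nat.cast_zero, zero_div, Nat.cast_pow, Nat.cast_ofNat, Nat.cast_add, Nat.cast_one]
      at htel
    rw [div_self (by positivity), side_zero_eq, side_one_eq] at htel
    rw [← htel, edgeSum, ← Real.Angle.coe_coeHom, map_sum]
    refine Finset.sum_congr rfl fun i hi => ?_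
    have hi := Finset.mem_range.1 hi
    obtain ⟨ha, hb⟩ := dyadic_mem hi
    exact angleAt_coe (hne k _ ha) (hne k _ hb)
  have hsum : ((R.polySum (angleAt x) φ N : ℝ) : Real.Angle) = 0 := by
    rw [polySum, Fin.sum_univ_four, Real.Angle.coe_add, Real.Angle.coe_add, Real.Angle.coe_add,
      hedge, hedge, hedge, hedge]
    simp only [show (1 : Fin 4) + 1 = 2 by decide,
      show (2 : Fin 4) + 1 = 3 by decide, show (3 : Fin 4) + 1 = 0 by decide, zero_add]
    abel
  obtain ⟨d, hd⟩ := Real.Angle.coe_eq_zero_iff.1 hsum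
  refine ⟨d, ?_⟩
  rw [polyIndex, ← hd, zsmul_eq_mul, mul_div_assoc, div_self Real.two_pi_pos.ne', mul_one]

/-- A mapping degree is a winding number. -/
theorem eventually_polyIndex_eq_degree {φ : Plane → Plane} (hφ : ContinuousOn φ R.toSet)
    {x : Plane} {d : ℤ} (h : IsMappingDegree φ R.toSet x d) :
    ∀ᶠ N in atTop, R.polyIndex φ N x = d := by
  obtain ⟨g, ψ, a, b, hg, hgφ, hψ, ha, hb, hsupp, hmass, hd⟩ := h
  have hclose : ∀ y ∈ frontier R.toSet, dist (g y) (φ y) < dist (φ y) x := fun y hy =>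
    (hgφ y (R.frontier_subset hy)).trans_le
      ((Metric.infDist_le_dist_of_mem (mem_image_of_mem φ hy)).trans_eq (dist_comm _ _))
  have hx' : x ∉ g '' frontier R.toSet := by
    rintro ⟨y, hy, rfl⟩
    have := hclose y hy
    rw [dist_comm] at this
    exact lt_irrefl _ this
  filter_upwards [R.eventually_polyIndex_eq hφ hg.continuous.continuousOn hclose,
    eventually_degree_integral_eq_polyIndex R hg hψ ha hb hsupp hmass hx'] with N h1 h2
  rw [← h1, ← h2, hd]

end Square

/-- Tietze extension to the whole plane, followed by the density of smooth maps for uniform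
convergence on compact sets. -/
lemma exists_contDiff_dist_lt {φ : Plane → Plane} {K : Set Plane} (hK : IsCompact K)
    (hφ : ContinuousOn φ K) {ε : ℝ} (hε : 0 < ε) :
    ∃ g : Plane → Plane, ContDiff ℝ ∞ g ∧ ∀ y ∈ K, dist (g y) (φ y) < ε := by
  obtain ⟨F, hF⟩ := ContinuousMap.exists_restrict_eq hK.isClosed
    (⟨K.domRestrict φ, hφ.domRestrict⟩ : C(K, Plane))
  have hd := ContinuousMap.dense_setOfPred_contDiff (E := Plane) (F := Plane) F
  rw [mem_closure_iff_nhds_basis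
    (nhds_basis_uniformity Metric.uniformity_basis_dist.compactConvergenceUniformity)] at hd
  obtain ⟨g, hg, hgF⟩ := hd (K, ε) ⟨hK, hε⟩
  refine ⟨g, hg, fun y hy => ?_⟩
  have h1 := hgF y hy
  have h2 : F y = φ y := congrArg (fun f : C(K, Plane) => f ⟨y, hy⟩) hF
  rw [← h2]
  exact h1

/-- There is a radial weight of mass one supported in any given annulus. -/
lemma exists_radial_weight {a b : ℝ} (ha : 0 < a) (hab : a < b) :
    ∃ ψ : ℝ → ℝ, Continuous ψ ∧ (∀ r, r ∉ Icc a b → ψ r = 0) ∧ (∫ z : Plane, ψ ‖z‖) = 1 := by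
  set ρ : ℝ → ℝ := fun r => max 0 (min (r - a) (b - r)) with hρ
  have hc : Continuous ρ := by fun_prop
  have hs : ∀ r, r ∉ Icc a b → ρ r = 0 := by
    intro r hr
    apply max_eq_left
    by_contra hcon
    rw [not_le, lt_min_iff] at hcon
    exact hr ⟨by linarith [hcon.1], by linarith [hcon.2]⟩
  have hpos : 0 < ∫ z : Plane, ρ ‖z‖ := by
    refine Continuous.integral_pos_of_hasCompactSupport_nonneg_nonzero
      (x := ((a + b) / 2) • EuclideanSpace.single 0 1) (hc.comp continuous_norm) ?_
      (fun z => le_max_left _ _) ?_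
    · refine HasCompactSupport.intro (isCompact_closedBall (0 : Plane) b) fun z hz => ?_
      apply hs
      rintro ⟨-, h2⟩
      exact hz (by simpa using h2)
    · have hn : ‖((a + b) / 2) • (EuclideanSpace.single 0 1 : Plane)‖ = (a + b) / 2 := by
        rw [norm_smul]
        simp [abs_of_pos (show 0 < a + b by linarith)]
      simp only [hn, hρ]
      refine (lt_max_of_lt_right (lt_min ?_ ?_)).ne' <;> linarith
  refine ⟨fun r => ρ r / ∫ z : Plane, ρ ‖z‖, hc.div_const _, fun r hr => by
    simp only [hs r hr, zero_div],
    ?_⟩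
  rw [integral_div, div_self hpos.ne']

/-- The point is that the integral over the interior is an integer, which holds because it equals
the winding number of a closed polygon. -/
theorem exists_isMappingDegree (R : Square) {φ : Plane → Plane} (hφ : ContinuousOn φ R.toSet)
    {x : Plane} (hx : x ∉ φ '' frontier R.toSet) : ∃ d, IsMappingDegree φ R.toSet x d := by
  obtain ⟨g, hg, hgφ⟩ := exists_contDiff_dist_lt R.isCompact_toSet hφ (R.infDist_pos hφ hx)
  have hx' : x ∉ g '' frontier R.toSet := by
    rintro ⟨y, hy, rfl⟩
    have := (hgφ y (R.frontier_subset hy)).trans_le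
      (Metric.infDist_le_dist_of_mem (mem_image_of_mem φ hy))
    exact lt_irrefl _ this
  have hpos := R.infDist_pos hg.continuous.continuousOn hx'
  set ρ := Metric.infDist x (g '' frontier R.toSet)
  -- Any compact subinterval of `(0, ρ)` with nonempty interior would serve in place of `[ρ / 4, ρ /
  -- 2]`.
  obtain ⟨ψ, hψ, hsupp, hmass⟩ := exists_radial_weight (show 0 < ρ / 4 by positivity)
    (show ρ / 4 < ρ / 2 by linarith)
  obtain ⟨N, hN⟩ := (eventually_degree_integral_eq_polyIndex R hg hψ
    (show 0 < ρ / 4 by positivity) (show ρ / 2 < ρ by linarith) hsupp hmass hx').exists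
  obtain ⟨d, hd⟩ := R.exists_int_polyIndex hx' N
  exact ⟨d, g, ψ, ρ / 4, ρ / 2, hg, hgφ, hψ, by positivity, by linarith, hsupp, hmass,
    hN.trans hd⟩

/-- Every admissible pair of approximation and weight yields the same winding number, so the choice
made in `mappingDegree` is immaterial. -/
lemma eventually_polyIndex_eq_mappingDegree (R : Square) {φ : Plane → Plane}
    (hφ : ContinuousOn φ R.toSet) {x : Plane} (hx : x ∉ φ '' frontier R.toSet) :
    ∀ᶠ N in atTop, R.polyIndex φ N x = mappingDegree φ R.toSet x := by
  have h := exists_isMappingDegree R hφ hx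
  rw [mappingDegree, dif_pos h]
  exact R.eventually_polyIndex_eq_degree hφ h.choose_spec

/-! ### Additivity of the winding number -/

lemma sum_range_mul (M N : ℕ) (F : ℕ → ℝ) :
    ∑ k ∈ Finset.range (M * N), F k =
      ∑ i ∈ Finset.range M, ∑ j ∈ Finset.range N, F (i * N + j) := by
  induction M with
  | zero => simp
  | succ M ih => rw [Nat.succ_mul, Finset.sum_range_add, ih, Finset.sum_range_succ]

/-- Level `N` nodes on the `2 ^ n` pieces of a segment are exactly its level `n + N` nodes. -/
lemma edgeSum_add (E : Plane → Plane → ℝ) (φ : Plane → Plane) (n N : ℕ) (y y' : Plane) :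
    edgeSum E φ (n + N) y y' = ∑ i ∈ Finset.range (2 ^ n), edgeSum E φ N
      (AffineMap.lineMap y y' ((i : ℝ) / 2 ^ n)) (AffineMap.lineMap y y' (((i : ℝ) + 1) / 2 ^ n)) := by
  have hnode : ∀ (i : ℕ) (t : ℝ), node φ (AffineMap.lineMap y y' ((i : ℝ) / 2 ^ n))
      (AffineMap.lineMap y y' (((i : ℝ) + 1) / 2 ^ n)) N t =
      node φ y y' (n + N) (i * 2 ^ N + t) := by
    intro i t
    rw [node, node, ← AffineMap.apply_lineMap]
    congr 2
    rw [AffineMap.lineMap_apply_ring', pow_add]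
    field_simp
    ring
  rw [edgeSum, pow_add, sum_range_mul]
  refine Finset.sum_congr rfl fun i _ => Finset.sum_congr rfl fun j _ => ?_
  rw [hnode, hnode]
  push_cast
  rw [add_assoc]

lemma edgeSum_swap {E : Plane → Plane → ℝ} {φ : Plane → Plane} {s : Set Plane}
    (hE : ∀ p ∈ s, ∀ q ∈ s, E q p = -E p q) {y y' : Plane} {N : ℕ}
    (hs : ∀ i : ℕ, node φ y y' N i ∈ s) : edgeSum E φ N y' y = -edgeSum E φ N y y' := by
  have hnode : ∀ t : ℝ, node φ y' y N t = node φ y y' N (2 ^ N - t) := by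
    intro t
    rw [node, node, ← AffineMap.lineMap_apply_one_sub, sub_div, div_self (by positivity)]
  rw [edgeSum, edgeSum, ← Finset.sum_range_reflect, ← Finset.sum_neg_distrib]
  refine Finset.sum_congr rfl fun i hi => ?_
  have hi := Finset.mem_range.1 hi
  have e : ((2 ^ N - 1 - i : ℕ) : ℝ) = 2 ^ N - 1 - i := by
    rw [Nat.sub_sub, Nat.cast_sub (by omega)]
    push_cast; ring
  have h1 := hs i
  have h2 := hs (i + 1)
  push_cast at h2
  rw [hnode, hnode, e, show (2 : ℝ) ^ N - (2 ^ N - 1 - i) = i + 1 by ring,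
    show (2 : ℝ) ^ N - (2 ^ N - 1 - i + 1) = i by ring, hE _ h1 _ h2]

namespace Square

variable (Q : Square)

/-- The points of the dyadic grid. -/
def gridPoint (n i j : ℕ) : Plane := Q.param (i / 2 ^ n) (j / 2 ^ n)

lemma sub_param (n i j : ℕ) (u v : ℝ) :
    (Q.sub n i j).param u v = Q.param ((i + u) / 2 ^ n) ((j + v) / 2 ^ n) := by
  ext k
  fin_cases k <;> simp [param, sub, rot] <;> field_simp <;> ring

lemma sub_vertex (n i j : ℕ) : (Q.sub n i j).vertex =
    ![Q.gridPoint n i j, Q.gridPoint n (i + 1) j, Q.gridPoint n (i + 1) (j + 1),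
      Q.gridPoint n i (j + 1)] := by
  simp only [vertex, sub_param, gridPoint]
  push_cast
  simp

lemma vertex_eq_gridPoint (n : ℕ) : Q.vertex =
    ![Q.gridPoint n 0 0, Q.gridPoint n (2 ^ n) 0, Q.gridPoint n (2 ^ n) (2 ^ n),
      Q.gridPoint n 0 (2 ^ n)] := by
  simp [vertex, gridPoint]

lemma lineMap_param_left (u u' v t : ℝ) :
    AffineMap.lineMap (Q.param u v) (Q.param u' v) t = Q.param (AffineMap.lineMap u u' t) v := by
  ext k
  fin_cases k <;> simp [AffineMap.lineMap_apply, param, rot] <;> ring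

lemma lineMap_param_right (u v v' t : ℝ) :
    AffineMap.lineMap (Q.param u v) (Q.param u v') t = Q.param u (AffineMap.lineMap v v' t) := by
  ext k
  fin_cases k <;> simp [AffineMap.lineMap_apply, param, rot] <;> ring

/-- Each interior grid edge belongs to two subsquares, which traverse it in opposite directions.
With `H` and `V` the contributions of horizontal and vertical edges, the sum telescopes to the outer
boundary, whose level is then `n + N`. -/
lemma sum_polySum_sub {E : Plane → Plane → ℝ} {φ : Plane → Plane} {s : Set Plane}
    (hE : ∀ p ∈ s, ∀ q ∈ s, E q p = -E p q) (n N : ℕ)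
    (hs : ∀ i j i' j' M m : ℕ, node φ (Q.gridPoint n i j) (Q.gridPoint n i' j') M m ∈ s) :
    Q.dyadicSum n (fun R => R.polySum E φ N) = Q.polySum E φ (n + N) := by
  set H : ℕ → ℕ → ℝ := fun i j =>
    edgeSum E φ N (Q.gridPoint n i j) (Q.gridPoint n (i + 1) j) with hH
  set V : ℕ → ℕ → ℝ := fun i j =>
    edgeSum E φ N (Q.gridPoint n i j) (Q.gridPoint n i (j + 1)) with hV
  have hsub : ∀ i j, (Q.sub n i j).polySum E φ N =
      (V (i + 1) j - V i j) - (H i (j + 1) - H i j) := by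
    intro i j
    have h1 := edgeSum_swap hE (y := Q.gridPoint n i (j + 1))
      (y' := Q.gridPoint n (i + 1) (j + 1)) (hs _ _ _ _ N)
    have h2 := edgeSum_swap hE (y := Q.gridPoint n i j)
      (y' := Q.gridPoint n i (j + 1)) (hs _ _ _ _ N)
    simp only [polySum, Fin.sum_univ_four, sub_vertex, show (1 : Fin 4) + 1 = 2 by decide,
      show (2 : Fin 4) + 1 = 3 by decide, show (3 : Fin 4) + 1 = 0 by decide, zero_add]
    simp only [Matrix.cons_val]
    rw [h1, h2, hH, hV]
    ring
  have hHsum : ∀ j, edgeSum E φ (n + N) (Q.gridPoint n 0 j) (Q.gridPoint n (2 ^ n) j) =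
      ∑ i ∈ Finset.range (2 ^ n), H i j := by
    intro j
    rw [edgeSum_add]
    refine Finset.sum_congr rfl fun i _ => ?_
    simp only [gridPoint, lineMap_param_left, hH]
    push_cast
    simp [AffineMap.lineMap_apply]
  have hVsum : ∀ i, edgeSum E φ (n + N) (Q.gridPoint n i 0) (Q.gridPoint n i (2 ^ n)) =
      ∑ j ∈ Finset.range (2 ^ n), V i j := by
    intro i
    rw [edgeSum_add]
    refine Finset.sum_congr rfl fun j _ => ?_
    simp only [gridPoint, lineMap_param_right, hV]
    push_cast
    simp [AffineMap.lineMap_apply]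
  have h1 := edgeSum_swap hE (y := Q.gridPoint n 0 (2 ^ n))
    (y' := Q.gridPoint n (2 ^ n) (2 ^ n)) (hs _ _ _ _ (n + N))
  have h2 := edgeSum_swap hE (y := Q.gridPoint n 0 0)
    (y' := Q.gridPoint n 0 (2 ^ n)) (hs _ _ _ _ (n + N))
  simp only [dyadicSum, hsub]
  rw [polySum]
  simp only [Fin.sum_univ_four, Q.vertex_eq_gridPoint n, show (1 : Fin 4) + 1 = 2 by decide,
      show (2 : Fin 4) + 1 = 3 by decide, show (3 : Fin 4) + 1 = 0 by decide, zero_add]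
  simp only [Matrix.cons_val]
  rw [h1, h2, hHsum, hHsum, hVsum, hVsum]
  simp only [Finset.sum_sub_distrib (G := ℝ)]
  have hh : ∑ i ∈ Finset.range (2 ^ n), ∑ j ∈ Finset.range (2 ^ n), H i (j + 1) -
      ∑ i ∈ Finset.range (2 ^ n), ∑ j ∈ Finset.range (2 ^ n), H i j =
      ∑ i ∈ Finset.range (2 ^ n), H i (2 ^ n) - ∑ i ∈ Finset.range (2 ^ n), H i 0 := by
    rw [← Finset.sum_sub_distrib, ← Finset.sum_sub_distrib]
    refine Finset.sum_congr rfl fun i _ => ?_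
    rw [← Finset.sum_sub_distrib, Finset.sum_range_sub (fun j => H i j)]
  rw [hh, ← Finset.sum_sub_distrib,
    Finset.sum_range_sub (fun i => ∑ j ∈ Finset.range (2 ^ n), V i j)]
  ring

lemma ae_sum_polyIndex_sub (φ : Plane → Plane) (n : ℕ) :
    ∀ᵐ x, ∀ N, Q.dyadicSum n (fun R => R.polyIndex φ N x) = Q.polyIndex φ (n + N) x := by
  set s : Set Plane := range fun z : (ℕ × ℕ) × (ℕ × ℕ) × (ℕ × ℕ) =>
    node φ (Q.gridPoint n z.1.1 z.1.2) (Q.gridPoint n z.2.1.1 z.2.1.2) z.2.2.1 z.2.2.2 with hs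
  have hsc : s.Countable := countable_range _
  have hae : ∀ᵐ x, ∀ p ∈ s, ∀ q ∈ s, x ∉ segment ℝ p q :=
    (ae_ball_iff hsc).2 fun p _ => (ae_ball_iff hsc).2 fun q _ => ae_notMem_segment p q
  filter_upwards [hae] with x hx N
  have := Q.sum_polySum_sub (E := angleAt x) (φ := φ) (s := s)
    (fun p hp q hq => angleAt_swap (hx p hp q hq)) n N
    (fun i j i' j' M m => ⟨((i, j), (i', j'), (M, m)), rfl⟩)
  rw [polyIndex, ← this]
  simp only [dyadicSum, polyIndex, Finset.sum_div]

/-! ### Hölder continuous maps on squares -/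

lemma dist_vertex_succ (R : Square) (k : Fin 4) :
    dist (R.vertex k) (R.vertex (k + 1)) = ‖R.edge‖ := by
  rw [dist_comm, dist_eq_norm]
  fin_cases k
  · simp [vertex, param]
  · simp [vertex, param, norm_rot]
  · simp [vertex, param]
  · simp [vertex, param, norm_rot]

lemma dist_side (R : Square) (k : Fin 4) (s t : ℝ) :
    dist (R.side k s) (R.side k t) = |s - t| * ‖R.edge‖ := by
  rw [side, side, dist_lineMap_lineMap, dist_vertex_succ, Real.dist_eq]

lemma dist_le_of_mem (R : Square) {y y' : Plane} (hy : y ∈ R.toSet) (hy' : y' ∈ R.toSet) :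
    dist y y' ≤ 2 * ‖R.edge‖ := by
  obtain ⟨u, hu, v, hv, rfl⟩ := hy
  obtain ⟨u', hu', v', hv', rfl⟩ := hy'
  have e : R.param u v - R.param u' v' = (u - u') • R.edge + (v - v') • rot R.edge := by
    simp only [param]; module
  rw [dist_eq_norm, e]
  calc _ ≤ _ := norm_add_le _ _
    _ = |u - u'| * ‖R.edge‖ + |v - v'| * ‖R.edge‖ := by
      rw [norm_smul, norm_smul, norm_rot, Real.norm_eq_abs, Real.norm_eq_abs]
    _ ≤ 1 * ‖R.edge‖ + 1 * ‖R.edge‖ := by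
      gcongr <;> rw [abs_le]
      · constructor <;> linarith [hu.1, hu.2, hu'.1, hu'.2]
      · constructor <;> linarith [hv.1, hv.2, hv'.1, hv'.2]
    _ = _ := by ring

lemma sub_subset {n i j : ℕ} (hi : i < 2 ^ n) (hj : j < 2 ^ n) :
    (Q.sub n i j).toSet ⊆ Q.toSet := by
  rintro y ⟨u, hu, v, hv, rfl⟩
  rw [sub_param]
  have hi' : (i : ℝ) + 1 ≤ 2 ^ n := by exact_mod_cast hi
  have hj' : (j : ℝ) + 1 ≤ 2 ^ n := by exact_mod_cast hj
  refine ⟨_, ⟨?_, ?_⟩, _, ⟨?_, ?_⟩, rfl⟩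
  · have := hu.1; positivity
  · rw [div_le_one (by positivity)]; linarith [hu.2]
  · have := hv.1; positivity
  · rw [div_le_one (by positivity)]; linarith [hv.2]

lemma norm_sub_edge (n i j : ℕ) : ‖(Q.sub n i j).edge‖ = (2 ^ n)⁻¹ * ‖Q.edge‖ := by
  simp [sub, norm_smul]

end Square

variable {φ : Plane → Plane} {C α : ℝ≥0}

lemma rpow_half_pow (α : ℝ) (n : ℕ) : ((2 ^ n : ℝ)⁻¹) ^ α = ((1 / 2 : ℝ) ^ α) ^ n := by
  rw [← Real.rpow_natCast ((1 / 2 : ℝ) ^ α) n, ← Real.rpow_mul (by norm_num), mul_comm α,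
    Real.rpow_mul (by norm_num), Real.rpow_natCast, one_div, inv_pow]

/-- The source of both thresholds: `k = 1`, `m = 2` controls the refinement of the boundary curve,
and `k = 2` controls the sum over the `4 ^ n` subsquares. -/
lemma rpow_half_pow_lt {α : ℝ} {m k : ℕ} (h : (k : ℝ) < α * m) :
    2 ^ k * ((1 / 2 : ℝ) ^ α) ^ m < 1 := by
  rw [← Real.rpow_natCast ((1 / 2 : ℝ) ^ α), ← Real.rpow_mul (by norm_num)]
  have h1 : (1 / 2 : ℝ) ^ (α * m) < (1 / 2 : ℝ) ^ (k : ℝ) :=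
    Real.rpow_lt_rpow_of_exponent_gt (by norm_num) (by norm_num) h
  calc _ < 2 ^ k * (1 / 2 : ℝ) ^ (k : ℝ) := by gcongr
    _ = 1 := by rw [Real.rpow_natCast, ← mul_pow]; norm_num

lemma Square.tame_of_holderOnWith {R : Square} (hφ : HolderOnWith C α φ R.toSet)
    (hα : (1 / 2 : ℝ) < α) {y : Plane} (hy : y ∈ R.toSet) :
    R.Tame φ (C * ‖R.edge‖ ^ (α : ℝ)) ((1 / 2) ^ (α : ℝ)) (φ y)
      (C * (2 * ‖R.edge‖) ^ (α : ℝ)) where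
  nonneg := by positivity
  lt_one := by
    have := rpow_half_pow_lt (α := α) (m := 2) (k := 1) (by push_cast; linarith)
    simpa using this
  holder k n s hs t ht hst := by
    refine (hφ.dist_le (R.frontier_subset (R.side_mem_frontier k hs))
      (R.frontier_subset (R.side_mem_frontier k ht))).trans ?_
    rw [R.dist_side, ← rpow_half_pow, mul_assoc, ← Real.mul_rpow (norm_nonneg _) (by positivity),
      mul_comm |s - t|]
    gcongr
  mem_ball k t ht := by
    have ht' := R.frontier_subset (R.side_mem_frontier k ht)
    refine (hφ.dist_le ht' hy).trans ?_
    gcongr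
    exact R.dist_le_of_mem ht' hy

/-- Scaling: halving the side multiplies the Hölder constant in the parameter of a side, and the
radius of the disc, by `q = 2 ^ (-α)`. -/
lemma Square.tame_sub {Q : Square} (hφ : HolderOnWith C α φ Q.toSet)
    (hα : (1 / 2 : ℝ) < α) {n i j : ℕ} (hi : i < 2 ^ n) (hj : j < 2 ^ n) {y : Plane}
    (hy : y ∈ (Q.sub n i j).toSet) :
    (Q.sub n i j).Tame φ (C * ‖Q.edge‖ ^ (α : ℝ) * ((1 / 2) ^ (α : ℝ)) ^ n) ((1 / 2) ^ (α : ℝ))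
      (φ y) (C * (2 * ‖Q.edge‖) ^ (α : ℝ) * ((1 / 2) ^ (α : ℝ)) ^ n) := by
  have h := Square.tame_of_holderOnWith (hφ.mono (Q.sub_subset hi hj)) hα hy
  rw [Q.norm_sub_edge, mul_left_comm, Real.mul_rpow (by positivity) (by positivity),
    Real.mul_rpow (by positivity) (by positivity), rpow_half_pow,
    mul_comm (((1 / 2 : ℝ) ^ (α : ℝ)) ^ n), mul_comm (((1 / 2 : ℝ) ^ (α : ℝ)) ^ n),
    ← mul_assoc, ← mul_assoc] at h
  exact h

lemma Square.volume_image_frontier {R : Square} (hφ : HolderOnWith C α φ R.toSet)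
    (hα : (1 / 2 : ℝ) < α) : volume (φ '' frontier R.toSet) = 0 := by
  rw [R.frontier_toSet, image_iUnion]
  refine measure_iUnion_null fun k => ?_
  rw [← image_comp]
  have hL : LipschitzWith (nndist (R.vertex k) (R.vertex (k + 1))) (R.side k) :=
    lipschitzWith_lineMap _ _
  have h := hφ.comp (hL.lipschitzOnWith (s := Icc 0 1)).holderOnWith
    fun t ht => R.frontier_subset (R.side_mem_frontier k ht)
  exact volume_image_eq_zero h (by simpa using hα)

/-! ### Index and degree of a Hölder map, and dyadic Riemann sums -/

lemma Square.ae_index_eq {R : Square} (hφ : HolderOnWith C α φ R.toSet) (hα : (1 / 2 : ℝ) < α) :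
    ∀ᵐ x, R.index φ x = mappingDegree φ R.toSet x := by
  have hc : ContinuousOn φ R.toSet := hφ.continuousOn (by
    rw [← NNReal.coe_pos]; linarith)
  filter_upwards [R.ae_polyIndex φ, measure_eq_zero_iff_ae_notMem.1
    (R.volume_image_frontier hφ hα)] with x h1 h2
  exact index_eq_of_eventually h1 (eventually_polyIndex_eq_mappingDegree R hc h2)

lemma Square.ae_index_eq_dyadicSum {Q : Square} (hφ : HolderOnWith C α φ Q.toSet)
    (hα : (1 / 2 : ℝ) < α) (n : ℕ) :
    ∀ᵐ x, Q.index φ x = Q.dyadicSum n fun R => R.index φ x := by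
  have hα0 : 0 < α := by rw [← NNReal.coe_pos]; linarith
  have hsub : ∀ᵐ x, ∀ i ∈ Finset.range (2 ^ n), ∀ j ∈ Finset.range (2 ^ n),
      ∀ᶠ N in atTop, (Q.sub n i j).polyIndex φ N x = (Q.sub n i j).index φ x := by
    refine (Finset.eventually_all _).2 fun i hi => (Finset.eventually_all _).2 fun j hj => ?_
    have hφ' := hφ.mono (Q.sub_subset (Finset.mem_range.1 hi) (Finset.mem_range.1 hj))
    filter_upwards [ae_index_eq hφ' hα, measure_eq_zero_iff_ae_notMem.1
      (volume_image_frontier hφ' hα)] with x h1 h2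
    rw [h1]
    exact eventually_polyIndex_eq_mappingDegree _ (hφ'.continuousOn hα0) h2
  filter_upwards [hsub, ae_index_eq hφ hα, Q.ae_sum_polyIndex_sub φ n,
    measure_eq_zero_iff_ae_notMem.1 (volume_image_frontier hφ hα)] with x h1 h2 h3 h4
  have h5 := (tendsto_add_atTop_nat n).eventually
    (eventually_polyIndex_eq_mappingDegree Q (hφ.continuousOn hα0) h4)
  have h6 : ∀ᶠ N in atTop, ∀ i ∈ Finset.range (2 ^ n), ∀ j ∈ Finset.range (2 ^ n),
      (Q.sub n i j).polyIndex φ N x = (Q.sub n i j).index φ x :=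
    (Finset.eventually_all _).2 fun i hi => (Finset.eventually_all _).2 fun j hj => h1 i hi j hj
  -- A single level `N` at which the polygons of all the finitely many subsquares, and the level `N
  -- + n` polygon of `Q`, have reached their final winding numbers.
  obtain ⟨N, h7, h8⟩ := (h5.and h6).exists
  rw [h2, ← h7, add_comm, ← h3 N]
  exact Finset.sum_congr rfl fun i hi => Finset.sum_congr rfl fun j hj => h8 i hi j hj

/-- The error of a dyadic Riemann sum, if on each square the integrand is replaced by an
approximation. -/
lemma Square.tendsto_dyadicSum {Q : Square} (hφ : HolderOnWith C α φ Q.toSet)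
    (hα : (1 / 2 : ℝ) < α) {f : Plane → ℝ} (hf : Continuous f) {p : Square → Plane}
    (hp : ∀ n i j : ℕ, i < 2 ^ n → j < 2 ^ n → p (Q.sub n i j) ∈ (Q.sub n i j).toSet)
    {a : Plane → Plane → ℝ} (ha : ∀ c, Continuous (a c)) {L : ℝ} {m : ℕ} (hm : 2 < α * (m + 2))
    (hfa : ∀ c r, ∀ x ∈ Metric.closedBall c r, |f x - a c x| ≤ L * r ^ m) :
    Tendsto (fun n => Q.dyadicSum n fun R => ∫ x, R.index φ x * a (φ (p R)) x) atTop
      (𝓝 (∫ x, Q.index φ x * f x)) := by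
  set q : ℝ := (1 / 2) ^ (α : ℝ) with hq
  set A : ℝ := C * ‖Q.edge‖ ^ (α : ℝ)
  set r : ℝ := C * (2 * ‖Q.edge‖) ^ (α : ℝ)
  set K : ℝ := |L| * r ^ m * ((2 * r ^ 2 + 4 * A ^ 2 / (1 - 2 * q ^ 2)) * discArea) with hK
  have hq0 : 0 ≤ q := by positivity
  -- The factor `4` counts squares, `q ^ m` is the approximation error, and `q ^ 2` is the L¹ norm
  -- of the winding number of one square.
  have hlim : Tendsto (fun n : ℕ => K * (4 * q ^ (m + 2)) ^ n) atTop (𝓝 0) := by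
    have h1 := rpow_half_pow_lt (α := α) (m := m + 2) (k := 2) (by push_cast; linarith)
    have := (tendsto_pow_atTop_nhds_zero_of_lt_one (r := 4 * q ^ (m + 2)) (by positivity)
      (by rw [hq]; linarith)).const_mul K
    rwa [mul_zero] at this
  have hint : ∀ n, ∫ x, Q.index φ x * f x =
      Q.dyadicSum n fun R => ∫ x, R.index φ x * f x := by
    intro n
    have hI : ∀ i ∈ Finset.range (2 ^ n), ∀ j ∈ Finset.range (2 ^ n),
        Integrable fun x => (Q.sub n i j).index φ x * f x := fun i hi j hj => by
      have hi := Finset.mem_range.1 hi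
      have hj := Finset.mem_range.1 hj
      exact (tame_sub hφ hα hi hj (hp n i j hi hj)).integrable_index_mul hf
    simp only [dyadicSum]
    rw [integral_congr_ae (g := fun x => ∑ i ∈ Finset.range (2 ^ n), ∑ j ∈ Finset.range (2 ^ n),
      (Q.sub n i j).index φ x * f x), integral_finsetSum _ fun i hi =>
        integrable_finsetSum _ (hI i hi)]
    · exact Finset.sum_congr rfl fun i hi => integral_finsetSum _ (hI i hi)
    · filter_upwards [ae_index_eq_dyadicSum hφ hα n] with x hx
      rw [hx]
      simp only [dyadicSum, Finset.sum_mul]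
  have herr : ∀ n, ‖(Q.dyadicSum n fun R => ∫ x, R.index φ x * a (φ (p R)) x) -
      ∫ x, Q.index φ x * f x‖ ≤ K * (4 * q ^ (m + 2)) ^ n := by
    intro n
    rw [hint n]
    simp only [dyadicSum, ← Finset.sum_sub_distrib]
    calc _ ≤ ∑ i ∈ Finset.range (2 ^ n), ∑ j ∈ Finset.range (2 ^ n), K * (q ^ (m + 2)) ^ n := by
          refine norm_sum_le_of_le _ fun i hi => norm_sum_le_of_le _ fun j hj => ?_
          have hi := Finset.mem_range.1 hi
          have hj := Finset.mem_range.1 hj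
          have hT := tame_sub hφ hα hi hj (hp n i j hi hj)
          rw [← integral_sub (hT.integrable_index_mul (ha _)) (hT.integrable_index_mul hf)]
          have hr := hT.radius_nonneg
          calc _ ≤ ∫ x, |L| * (r * q ^ n) ^ m * ‖(Q.sub n i j).index φ x‖ := by
                refine norm_integral_le_of_norm_le (hT.integrable_index.1.norm.const_mul _)
                  (ae_of_all _ fun x => ?_)
                rw [← mul_sub, norm_mul, mul_comm]
                -- The approximation is good only near `φ (p R)`, but the winding number vanishes
                -- off this disc.
                by_cases hx : x ∈ Metric.closedBall (φ (p (Q.sub n i j))) (r * q ^ n)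
                · gcongr
                  rw [norm_sub_rev]
                  refine (hfa _ _ x hx).trans ?_
                  gcongr
                  exact le_abs_self L
                · rw [hT.index_eq_zero hx]; simp
            _ ≤ |L| * (r * q ^ n) ^ m * ((2 * (r * q ^ n) ^ 2 + 4 * (A * q ^ n) ^ 2 /
                  (1 - 2 * q ^ 2)) * discArea) := by
                rw [integral_const_mul]
                gcongr
                exact hT.integrable_index.2
            _ = _ := by
                rw [hK]
                ring
      _ = _ := by
          simp only [Finset.sum_const, Finset.card_range, nsmul_eq_mul]
          push_cast
          rw [mul_pow, show (4 : ℝ) = 2 * 2 by norm_num, mul_pow]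
          ring
  have := squeeze_zero_norm herr hlim
  exact tendsto_sub_nhds_zero_iff.1 this

lemma Square.integrable_mul_mappingDegree {Q : Square} (hφ : HolderOnWith C α φ Q.toSet)
    (hα : (1 / 2 : ℝ) < α) {f : Plane → ℝ} (hf : Continuous f) :
    Integrable (fun x => f x * (mappingDegree φ Q.toSet x : ℝ)) ∧
      ∫ x, Q.index φ x * f x = ∫ x, f x * (mappingDegree φ Q.toSet x : ℝ) := by
  have hmem : Q.param 0 0 ∈ Q.toSet := ⟨0, by simp, 0, by simp, rfl⟩
  have h := (tame_of_holderOnWith hφ hα hmem).integrable_index_mul hf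
  have hae : (fun x => Q.index φ x * f x) =ᵐ[volume]
      fun x => f x * (mappingDegree φ Q.toSet x : ℝ) := by
    filter_upwards [ae_index_eq hφ hα] with x hx
    rw [hx, mul_comm]
  exact ⟨h.congr hae, integral_congr_ae hae⟩

lemma apply_eq_coord (D : Plane →L[ℝ] ℝ) (v : Plane) :
    D v = v 0 * D (EuclideanSpace.single 0 1) + v 1 * D (EuclideanSpace.single 1 1) := by
  have h : v = v 0 • EuclideanSpace.single 0 1 + v 1 • EuclideanSpace.single 1 1 := by
    ext i; fin_cases i <;> simp
  conv_lhs => rw [h]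
  simp

/-- The summands of the second order formula are exactly the integrals of the affine approximation
against the winding number; `X2` holds the first moments about `φ (p R)`. -/
lemma Square.Tame.integral_index_mul_affine {R : Square} {A q r : ℝ} {p : Square → Plane}
    (h : R.Tame φ A q (φ (p R)) r) (b : ℝ) (D : Plane →L[ℝ] ℝ) :
    ∫ x, R.index φ x * (b + D (x - φ (p R))) = b * X1 φ R + D (X2 φ p R) := by
  have e : ∀ x, R.index φ x * (b + D (x - φ (p R))) = b * R.index φ x +
      (D (EuclideanSpace.single 0 1) * (R.index φ x * (x 0 - φ (p R) 0)) +
        D (EuclideanSpace.single 1 1) * (R.index φ x * (x 1 - φ (p R) 1))) := by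
    intro x
    rw [apply_eq_coord D (x - φ (p R))]
    simp only [PiLp.sub_apply]
    ring
  have h0 := h.integrable_index_mul (f := fun x => x 0 - φ (p R) 0) (by fun_prop)
  have h1 := h.integrable_index_mul (f := fun x => x 1 - φ (p R) 1) (by fun_prop)
  simp_rw [e]
  have h01 : Integrable fun x => D (EuclideanSpace.single 0 1) *
      (R.index φ x * (x 0 - φ (p R) 0)) +
        D (EuclideanSpace.single 1 1) * (R.index φ x * (x 1 - φ (p R) 1)) :=
    (h0.const_mul _).add (h1.const_mul _)
  rw [integral_add (h.integrable_index.1.const_mul _) h01,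
    integral_add (h0.const_mul _) (h1.const_mul _), integral_const_mul, integral_const_mul,
    integral_const_mul, h.integral_index, h.integral_index_mul_fst, h.integral_index_mul_snd,
    apply_eq_coord D (X2 φ p R)]
  simp only [X2, PiLp.smul_apply, smul_eq_mul, Matrix.cons_val_zero, Matrix.cons_val_one]
  ring

end RoughSurface

end

/-! ### The first and second order formulas -/

theorem mainTheorem4 (Q : Square) (α C : ℝ≥0) (φ : Plane → Plane)
    (hφ : HolderOnWith C α φ Q.toSet)
    (p : Square → Plane)
    (hp : ∀ n i j : ℕ, i < 2 ^ n → j < 2 ^ n → p (Q.sub n i j) ∈ (Q.sub n i j).toSet) :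
    -- the degree is defined almost everywhere and the boundary integrals exist
    ((1 / 2 : ℝ) < α →
      (∀ᵐ x : Plane, x ∉ φ '' frontier Q.toSet ∧ ∃ d, IsMappingDegree φ Q.toSet x d) ∧
      ∀ n i j : ℕ, i < 2 ^ n → j < 2 ^ n → TermsExist φ p (Q.sub n i j)) ∧
    -- the first order formula
    ((2 / 3 : ℝ) < α → ∀ (f : Plane → ℝ) (L : ℝ≥0), LipschitzWith L f →
      Integrable (fun x => f x * (mappingDegree φ Q.toSet x : ℝ)) ∧
      Tendsto (fun n => Q.dyadicSum n fun R => f (φ (p R)) * X1 φ R) atTop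
        (𝓝 (∫ x : Plane, f x * (mappingDegree φ Q.toSet x : ℝ)))) ∧
    -- the second order formula
    ((1 / 2 : ℝ) < α → ∀ (f : Plane → ℝ) (L : ℝ≥0), ContDiff ℝ 1 f →
      LipschitzWith L (fderiv ℝ f) →
      Integrable (fun x => f x * (mappingDegree φ Q.toSet x : ℝ)) ∧
      Tendsto (fun n => Q.dyadicSum n fun R =>
          f (φ (p R)) * X1 φ R + fderiv ℝ f (φ (p R)) (X2 φ p R)) atTop
        (𝓝 (∫ x : Plane, f x * (mappingDegree φ Q.toSet x : ℝ)))) := by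
  refine ⟨fun hα => ⟨?_, fun n i j hi hj => ?_⟩, fun hα f L hf => ?_, fun hα f L hf hfL => ?_⟩
  · have hc : ContinuousOn φ Q.toSet := hφ.continuousOn (by rw [← NNReal.coe_pos]; linarith)
    filter_upwards [measure_eq_zero_iff_ae_notMem.1 (Q.volume_image_frontier hφ hα)] with x hx
    exact ⟨hx, exists_isMappingDegree Q hc hx⟩
  · have hT := Square.tame_sub hφ hα hi hj (hp n i j hi hj)
    exact ⟨hT.boundaryIntegrable, hT.boundaryIntegrable_sq_left, hT.boundaryIntegrable_sq_right⟩
  · have hα' : (1 / 2 : ℝ) < α := by linarith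
    obtain ⟨h1, h2⟩ := Square.integrable_mul_mappingDegree hφ hα' hf.continuous
    refine ⟨h1, ?_⟩
    rw [← h2]
    -- Approximation by a constant has error `L r`, so the condition is `3 α > 2`.
    refine (Square.tendsto_dyadicSum hφ hα' hf.continuous hp (a := fun c _ => f c)
      (fun c => continuous_const) (L := L) (m := 1) (by push_cast; linarith)
      fun c r x hx => ?_).congr fun n => ?_
    · rw [pow_one, ← Real.dist_eq]
      exact (hf.dist_le_mul x c).trans (by gcongr; exact hx)
    · refine Finset.sum_congr rfl fun i hi => Finset.sum_congr rfl fun j hj => ?_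
      have hi := Finset.mem_range.1 hi
      have hj := Finset.mem_range.1 hj
      beta_reduce
      rw [integral_mul_const, (Square.tame_sub hφ hα' hi hj (hp n i j hi hj)).integral_index,
        mul_comm]
  · obtain ⟨h1, h2⟩ := Square.integrable_mul_mappingDegree hφ hα hf.continuous
    refine ⟨h1, ?_⟩
    rw [← h2]
    -- Approximation by the first Taylor polynomial has error `L r ^ 2`, so the condition is `4 α >
    -- 2`.
    refine (Square.tendsto_dyadicSum hφ hα hf.continuous hp
      (a := fun c x => f c + fderiv ℝ f c (x - c)) (fun c => by fun_prop) (L := L) (m := 2)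
      (by push_cast; linarith) fun c r x hx => ?_).congr fun n => ?_
    · have hr : 0 ≤ r := dist_nonneg.trans hx
      -- Mean value inequality for `f` minus its differential at `c`: on the disc the derivative of
      -- this difference has norm at most `L r`.
      have key := (convex_closedBall c r).norm_image_sub_le_of_norm_fderiv_le' (𝕜 := ℝ) (f := f)
        (φ := fderiv ℝ f c) (C := L * r)
        (fun y _ => (hf.differentiable one_ne_zero) y)
        (fun y hy => by
          rw [← dist_eq_norm]
          exact (hfL.dist_le_mul y c).trans (by gcongr; exact hy))
        (Metric.mem_closedBall_self hr) hx
      rw [← sub_sub, ← Real.norm_eq_abs]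
      refine key.trans ?_
      rw [← dist_eq_norm, sq, ← mul_assoc]
      gcongr
      exact hx
    · refine Finset.sum_congr rfl fun i hi => Finset.sum_congr rfl fun j hj => ?_
      have hi := Finset.mem_range.1 hi
      have hj := Finset.mem_range.1 hj
      exact (Square.tame_sub hφ hα hi hj (hp n i j hi hj)).integral_index_mul_affine _ _
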